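/- Let $\mathbb{K}$ be a field of characteristic zero. All modules are over $\mathbb{K}$ and $\mathbb{Z}$-graded, differentials have degree $-1$, and Koszul signs are used. A graded $\mathbb{S}$-module is a family of graded right $\mathbb{K}[\mathbb{S}_n]$-modules $\mathcal{V}(n)$, $n \geq 0$; $\circ$ is the composite product of $\mathbb{S}$-modules, $\mathcal{I}$ its unit, and $\mathbb{T}\mathcal{V}$ the free operad on $\mathcal{V}$ (operads are monoids, cooperads are comonoids for $\circ$). A curved cooperad is a coaugmented graded cooperad $\mathscr{C} = (\mathcal{C}, \Delta, \epsilon, 1)$ with a coderivation $d$ of degree $-1$ such that $d(1) = 0$ and a map $\theta : \mathcal{C}(1) \to \mathbb{K}$ of degree $-2$ such that $$ d^2 = (\theta \otimes \mathrm{Id} - \mathrm{Id} \otimes \theta)\Delta_2, \qquad \theta d = 0, $$ where $\Delta_2$ denotes the infinitesimal decomposition of $\mathscr{C}$ (the part of $\Delta$, applied to $\overline{\mathcal{C}} = \ker \epsilon$ and with the terms involving $1$ removed, that decomposes an element into two factors $x_1 \otimes x_2$, with $x_2$ grafted on one input of $x_1$). It is conilpotent if the process of successive decomposition ends on every element, that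 is, if the filtration $F_0 = \mathbb{K}\cdot 1$, $F_{r+1} = \Delta^{-1}(F_r \circ F_r + \mathcal{I} \circ \mathcal{C} + \mathcal{C} \circ \mathcal{I})$ exhausts $\mathcal{C}$, where $\mathcal{I}$ is identified with $\mathbb{K}\cdot 1 \subseteq \mathcal{C}$. A morphism of curved conilpotent cooperads is a morphism of $\mathbb{S}$-modules (of degree $0$) that commutes with $\Delta$, $\epsilon$, $1$, $d$ and $\theta$. The cobar construction of $\mathscr{C}$ is the dg operad $\Omega_u \mathscr{C} = \mathbb{T}(s^{-1}\overline{\mathcal{C}})$ with the derivation determined by $$ s^{-1}x \mapsto \theta(x)1 - s^{-1}dx - \sum (-1)^{|x_1|} s^{-1}x_1 \otimes s^{-1}x_2, \qquad \sum x_1 \otimes x_2 = \Delta_2 x; $$ it is functorial in $\mathscr{C}$. A morphism of dg operads is a cofibration if it has the left lifting property with respect to all morphisms of dg operads that are surjective in every arity and degree and are quasi-isomorphisms in every arity (these are the cofibrations of Hinich's model structure). A morphism $f$ of curved conilpotent cooperads is called a cofibration if $\Omega_u(f)$ is a cofibration of dg operads. **Proposition.** Let $f : \mathscr{C} \to \mathscr{D}$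 be a morphism of curved conilpotent cooperads. Then $f$ is a cofibration if and only if it is degreewise injective, that is, $f : \mathcal{C}(n)_i \to \mathcal{D}(n)_i$ is injective for all $n \in \mathbb{N}$ and all $i \in \mathbb{Z}$. -/

import Mathlib

universe u

namespace OperadTheory

/-! ### Graded symmetric modules

Conventions: differentials lower the degree by one, the degree of the symbols `s⁻¹`, `d`, ... is
moved through products with the Koszul sign, and degrees range over all of `ℤ`. -/

/-- A graded `𝕊`-module over `K`: a family of `K`-modules `V n i` (arity `n`, degree `i`), functorial
in bijections `Fin m ≃ Fin n`, so that `Fin n ≃ Fin n` acts on `V n i`. (The groupoid of finite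
sets `Fin n` is isomorphic to its opposite through inverses, so that left and right actions give
the same notion.) -/
structure SMod (K : Type u) [Field K] where
  obj : ℕ → ℤ → Type u
  [acg : ∀ n i, AddCommGroup (obj n i)]
  [mod : ∀ n i, Module K (obj n i)]
  map : ∀ {m n : ℕ} {i : ℤ}, (Fin m ≃ Fin n) → obj m i →ₗ[K] obj n i
  map_refl : ∀ {n : ℕ} {i : ℤ} (x : obj n i), map (Equiv.refl (Fin n)) x = x
  map_trans : ∀ {l m n : ℕ} {i : ℤ} (σ : Fin l ≃ Fin m) (τ : Fin m ≃ Fin n) (x : obj l i),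
    map (σ.trans τ) x = map τ (map σ x)

attribute [instance] SMod.acg SMod.mod

variable {K : Type u} [Field K]

/-- Write `V n i` for the component of arity `n` and degree `i`. -/
instance : CoeFun (SMod K) (fun _ => ℕ → ℤ → Type u) := ⟨SMod.obj⟩

namespace SMod

/-- A morphism (of degree `0`) of graded `𝕊`-modules. -/
@[ext] structure Hom (V W : SMod K) where
  app : ∀ {n : ℕ} {i : ℤ}, V n i →ₗ[K] W n i
  naturality : ∀ {m n : ℕ} {i : ℤ} (σ : Fin m ≃ Fin n) (x : V m i),
    app (V.map σ x) = W.map σ (app x)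

/-- A map of graded `𝕊`-modules that lowers the degree by `k`, i.e. is homogeneous of degree `-k`.
The source degree `i` and the target degree `j` are only required to satisfy `i = j + k`. -/
@[ext] structure DegHom (k : ℤ) (V W : SMod K) where
  app : ∀ {n : ℕ} {i j : ℤ}, i = j + k → V n i →ₗ[K] W n j
  naturality : ∀ {m n : ℕ} {i j : ℤ} (h : i = j + k) (σ : Fin m ≃ Fin n) (x : V m i),
    app h (V.map σ x) = W.map σ (app h x)

/-- The direct sum `V ⊕ W`. -/
def prod (V W : SMod K) : SMod K where
  obj n i := V n i × W n i
  map σ := (V.map σ).prodMap (W.map σ)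
  map_refl x := by simp [V.map_refl, W.map_refl]
  map_trans σ τ x := by simp [V.map_trans, W.map_trans]

end SMod

/-! ### Graded operads

Operads are given by their partial compositions `x ∘ᵢ y`, which is equivalent to monoids for the
composite product of `𝕊`-modules. -/

/-- A way of numbering the inputs of `x ∘ᵢ y` by `Fin n`, where `x` has inputs `Fin m` and `y` has
inputs `Fin b`: the inputs of `x ∘ᵢ y` are those of `x` other than `i`, and those of `y`. -/
abbrev Slot (m b n : ℕ) (i : Fin m) := {j : Fin m // j ≠ i} ⊕ Fin b ≃ Fin n

/-- Relabelling the inputs of `x` by `σ`, those of `y` by `τ` and those of `x ∘ᵢ y` by `ρ` turns the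
numbering `e` into the numbering `e'`. -/
def Slot.Equivar {m b n m' b' n' : ℕ} {i : Fin m} (e : Slot m b n i) {i' : Fin m'}
    (e' : Slot m' b' n' i') (σ : Fin m ≃ Fin m') (τ : Fin b ≃ Fin b') (ρ : Fin n ≃ Fin n') :
    Prop :=
  σ i = i' ∧
  (∀ (j : {j // j ≠ i}) (j' : {j // j ≠ i'}), σ j = j' → ρ (e (.inl j)) = e' (.inl j')) ∧
  (∀ k, ρ (e (.inr k)) = e' (.inr (τ k)))

/-- The numberings used in `(x ∘ᵢ y) ∘ z`, where `z` is plugged into the input `j` of `y`, and in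
`x ∘ᵢ (y ∘ⱼ z)`, agree. -/
def Slot.Seq {m b c n s t : ℕ} {i : Fin m} (e : Slot m b n i) {j : Fin b}
    (e' : Slot n c s (e (.inr j))) (f : Slot m t s i) (f' : Slot b c t j) : Prop :=
  (∀ a, e' (.inl ⟨e (.inl a), by simp⟩) = f (.inl a)) ∧
  (∀ a : {a // a ≠ j}, e' (.inl ⟨e (.inr a), by simpa using a.2⟩) = f (.inr (f' (.inl a)))) ∧
  (∀ a, e' (.inr a) = f (.inr (f' (.inr a))))

/-- The numberings used in `(x ∘ᵢ y) ∘ⱼ z` and in `(x ∘ⱼ z) ∘ᵢ y`, for two inputs `i ≠ j` of `x`,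
agree. -/
def Slot.Par {m b c n n' s : ℕ} {i j : Fin m} (hij : i ≠ j) (e : Slot m b n i)
    (e' : Slot n c s (e (.inl ⟨j, hij.symm⟩))) (g : Slot m c n' j)
    (g' : Slot n' b s (g (.inl ⟨i, hij⟩))) : Prop :=
  (∀ (a : Fin m) (hi : a ≠ i) (hj : a ≠ j),
    e' (.inl ⟨e (.inl ⟨a, hi⟩), by simpa using hj⟩) =
      g' (.inl ⟨g (.inl ⟨a, hj⟩), by simpa using hi⟩)) ∧
  (∀ y, e' (.inl ⟨e (.inr y), by simp⟩) = g' (.inr y)) ∧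
  (∀ z, e' (.inr z) = g' (.inl ⟨g (.inr z), by simp⟩))

/-- A graded (symmetric, unital) operad: partial compositions `x ∘ᵢ y` that are equivariant, unital,
and satisfy the sequential and the parallel associativity relations, the latter with the Koszul
sign. -/
structure Operad (K : Type u) [Field K] extends SMod K where
  one : obj 1 0
  comp : ∀ {m b n : ℕ} {p q r : ℤ} (i : Fin m) (_ : Slot m b n i) (_ : p + q = r),
    obj m p →ₗ[K] obj b q →ₗ[K] obj n r
  equivar : ∀ {m b n m' b' n' : ℕ} {p q r : ℤ} {i : Fin m} (e : Slot m b n i) {i' : Fin m'}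
    (e' : Slot m' b' n' i') (σ : Fin m ≃ Fin m') (τ : Fin b ≃ Fin b') (ρ : Fin n ≃ Fin n')
    (_ : e.Equivar e' σ τ ρ) (h : p + q = r) (x : obj m p) (y : obj b q),
    map ρ (comp i e h x y) = comp i' e' h (map σ x) (map τ y)
  assoc_seq : ∀ {m b c n s t : ℕ} {p q r pq qr w : ℤ} {i : Fin m} (e : Slot m b n i) {j : Fin b}
    (e' : Slot n c s (e (.inr j))) (f : Slot m t s i) (f' : Slot b c t j)
    (_ : e.Seq e' f f') (h₁ : p + q = pq) (h₂ : pq + r = w) (h₃ : q + r = qr) (h₄ : p + qr = w)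
    (x : obj m p) (y : obj b q) (z : obj c r),
    comp _ e' h₂ (comp i e h₁ x y) z = comp i f h₄ x (comp j f' h₃ y z)
  assoc_par : ∀ {m b c n n' s : ℕ} {p q r pq pr w : ℤ} {i j : Fin m} (hij : i ≠ j)
    (e : Slot m b n i) (e' : Slot n c s (e (.inl ⟨j, hij.symm⟩))) (g : Slot m c n' j)
    (g' : Slot n' b s (g (.inl ⟨i, hij⟩)))
    (_ : Slot.Par hij e e' g g') (h₁ : p + q = pq) (h₂ : pq + r = w) (h₃ : p + r = pr)
    (h₄ : pr + q = w) (x : obj m p) (y : obj b q) (z : obj c r),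
    comp _ e' h₂ (comp i e h₁ x y) z = (-1 : K) ^ (q * r) • comp _ g' h₄ (comp j g h₃ x z) y
  one_comp : ∀ {b n : ℕ} {q : ℤ} (i : Fin 1) (e : Slot 1 b n i) (σ : Fin b ≃ Fin n)
    (_ : ∀ k, σ k = e (.inr k)) (y : obj b q), comp i e (zero_add q) one y = map σ y
  comp_one : ∀ {m n : ℕ} {p : ℤ} (i : Fin m) (e : Slot m 1 n i) (σ : Fin m ≃ Fin n)
    (_ : σ i = e (.inr 0)) (_ : ∀ j : {j // j ≠ i}, σ j = e (.inl j)) (x : obj m p),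
    comp i e (add_zero p) x one = map σ x

/-- Write `P n i` for the component of arity `n` and degree `i`. -/
instance : CoeFun (Operad K) (fun _ => ℕ → ℤ → Type u) := ⟨fun P => P.obj⟩

namespace Operad

/-- A morphism of graded operads. -/
@[ext] structure Hom (P Q : Operad K) extends SMod.Hom P.toSMod Q.toSMod where
  map_one : app P.one = Q.one
  map_comp : ∀ {m b n : ℕ} {p q r : ℤ} (i : Fin m) (e : Slot m b n i) (h : p + q = r)
    (x : P m p) (y : P b q), app (P.comp i e h x y) = Q.comp i e h (app x) (app y)

/-- The identity morphism. -/
def Hom.id (P : Operad K) : Hom P P where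
  app := LinearMap.id
  naturality _ _ := rfl
  map_one := rfl
  map_comp _ _ _ _ _ := rfl

/-- The composite `g ∘ f`. -/
def Hom.trans {P Q R : Operad K} (f : Hom P Q) (g : Hom Q R) : Hom P R where
  app := g.app ∘ₗ f.app
  naturality σ x := by simp [f.naturality, g.naturality]
  map_one := by simp [f.map_one, g.map_one]
  map_comp i e h x y := by simp [f.map_comp, g.map_comp]

end Operad

/-! ### The free graded operad

The free operad `𝕋 V` (the tree module) is built as the terms in the operad operations on elements
of `V`, modulo the operad relations and the linearity of everything. -/

namespace Free

/-- Formal terms in the operad operations with leaves in `V`. -/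
inductive Pre (V : SMod K) : ℕ → ℤ → Type u
  | gen {n : ℕ} {i : ℤ} (x : V n i) : Pre V n i
  | one : Pre V 1 0
  | map {m n : ℕ} {i : ℤ} (σ : Fin m ≃ Fin n) (x : Pre V m i) : Pre V n i
  | comp {m b n : ℕ} {p q r : ℤ} (i : Fin m) (e : Slot m b n i) (h : p + q = r)
      (x : Pre V m p) (y : Pre V b q) : Pre V n r
  | zero {n : ℕ} {i : ℤ} : Pre V n i
  | add {n : ℕ} {i : ℤ} (x y : Pre V n i) : Pre V n i
  | smul {n : ℕ} {i : ℤ} (c : K) (x : Pre V n i) : Pre V n i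

open Pre

/-- The congruence generated by the module relations, by the linearity and equivariance of the
inclusion of `V`, and by the operad relations. -/
inductive Rel (V : SMod K) : ∀ {n : ℕ} {i : ℤ}, Pre V n i → Pre V n i → Prop
  | refl {n i} (x : Pre V n i) : Rel V x x
  | symm {n i} {x y : Pre V n i} : Rel V x y → Rel V y x
  | trans {n i} {x y z : Pre V n i} : Rel V x y → Rel V y z → Rel V x z
  | map_congr {m n i} (σ : Fin m ≃ Fin n) {x y : Pre V m i} :
      Rel V x y → Rel V (map σ x) (map σ y)
  | comp_congr {m b n p q r} (i : Fin m) (e : Slot m b n i) (h : p + q = r)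
      {x x' : Pre V m p} {y y' : Pre V b q} :
      Rel V x x' → Rel V y y' → Rel V (comp i e h x y) (comp i e h x' y')
  | add_congr {n i} {x x' y y' : Pre V n i} :
      Rel V x x' → Rel V y y' → Rel V (add x y) (add x' y')
  | smul_congr {n i} (c : K) {x x' : Pre V n i} : Rel V x x' → Rel V (smul c x) (smul c x')
  | add_assoc {n i} (x y z : Pre V n i) : Rel V (add (add x y) z) (add x (add y z))
  | add_comm {n i} (x y : Pre V n i) : Rel V (add x y) (add y x)
  | zero_add {n i} (x : Pre V n i) : Rel V (add zero x) x
  | neg_add {n i} (x : Pre V n i) : Rel V (add (smul (-1) x) x) zero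
  | smul_add {n i} (c : K) (x y : Pre V n i) : Rel V (smul c (add x y)) (add (smul c x) (smul c y))
  | add_smul {n i} (c d : K) (x : Pre V n i) : Rel V (smul (c + d) x) (add (smul c x) (smul d x))
  | mul_smul {n i} (c d : K) (x : Pre V n i) : Rel V (smul (c * d) x) (smul c (smul d x))
  | one_smul {n i} (x : Pre V n i) : Rel V (smul 1 x) x
  | zero_smul {n i} (x : Pre V n i) : Rel V (smul 0 x) zero
  | smul_zero {n i} (c : K) : Rel V (smul c (zero : Pre V n i)) zero
  | gen_add {n i} (x y : V n i) : Rel V (gen (x + y)) (add (gen x) (gen y))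
  | gen_smul {n i} (c : K) (x : V n i) : Rel V (gen (c • x)) (smul c (gen x))
  | gen_map {m n i} (σ : Fin m ≃ Fin n) (x : V m i) : Rel V (gen (V.map σ x)) (map σ (gen x))
  | map_add {m n i} (σ : Fin m ≃ Fin n) (x y : Pre V m i) :
      Rel V (map σ (add x y)) (add (map σ x) (map σ y))
  | map_smul {m n i} (σ : Fin m ≃ Fin n) (c : K) (x : Pre V m i) :
      Rel V (map σ (smul c x)) (smul c (map σ x))
  | map_refl {n i} (x : Pre V n i) : Rel V (map (Equiv.refl _) x) x
  | map_trans {l m n i} (σ : Fin l ≃ Fin m) (τ : Fin m ≃ Fin n) (x : Pre V l i) :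
      Rel V (map (σ.trans τ) x) (map τ (map σ x))
  | comp_add_left {m b n p q r} (i : Fin m) (e : Slot m b n i) (h : p + q = r)
      (x x' : Pre V m p) (y : Pre V b q) :
      Rel V (comp i e h (add x x') y) (add (comp i e h x y) (comp i e h x' y))
  | comp_smul_left {m b n p q r} (i : Fin m) (e : Slot m b n i) (h : p + q = r)
      (c : K) (x : Pre V m p) (y : Pre V b q) :
      Rel V (comp i e h (smul c x) y) (smul c (comp i e h x y))
  | comp_add_right {m b n p q r} (i : Fin m) (e : Slot m b n i) (h : p + q = r)
      (x : Pre V m p) (y y' : Pre V b q) :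
      Rel V (comp i e h x (add y y')) (add (comp i e h x y) (comp i e h x y'))
  | comp_smul_right {m b n p q r} (i : Fin m) (e : Slot m b n i) (h : p + q = r)
      (c : K) (x : Pre V m p) (y : Pre V b q) :
      Rel V (comp i e h x (smul c y)) (smul c (comp i e h x y))
  | equivar {m b n m' b' n' : ℕ} {p q r : ℤ} {i : Fin m} (e : Slot m b n i) {i' : Fin m'}
      (e' : Slot m' b' n' i') (σ : Fin m ≃ Fin m') (τ : Fin b ≃ Fin b') (ρ : Fin n ≃ Fin n')
      (_ : e.Equivar e' σ τ ρ) (h : p + q = r) (x : Pre V m p) (y : Pre V b q) :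
      Rel V (map ρ (comp i e h x y)) (comp i' e' h (map σ x) (map τ y))
  | assoc_seq {m b c n s t : ℕ} {p q r pq qr w : ℤ} {i : Fin m} (e : Slot m b n i) {j : Fin b}
      (e' : Slot n c s (e (.inr j))) (f : Slot m t s i) (f' : Slot b c t j)
      (_ : e.Seq e' f f') (h₁ : p + q = pq) (h₂ : pq + r = w) (h₃ : q + r = qr) (h₄ : p + qr = w)
      (x : Pre V m p) (y : Pre V b q) (z : Pre V c r) :
      Rel V (comp _ e' h₂ (comp i e h₁ x y) z) (comp i f h₄ x (comp j f' h₃ y z))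
  | assoc_par {m b c n n' s : ℕ} {p q r pq pr w : ℤ} {i j : Fin m} (hij : i ≠ j)
      (e : Slot m b n i) (e' : Slot n c s (e (.inl ⟨j, hij.symm⟩))) (g : Slot m c n' j)
      (g' : Slot n' b s (g (.inl ⟨i, hij⟩)))
      (_ : Slot.Par hij e e' g g') (h₁ : p + q = pq) (h₂ : pq + r = w) (h₃ : p + r = pr)
      (h₄ : pr + q = w) (x : Pre V m p) (y : Pre V b q) (z : Pre V c r) :
      Rel V (comp _ e' h₂ (comp i e h₁ x y) z)
        (smul ((-1 : K) ^ (q * r)) (comp _ g' h₄ (comp j g h₃ x z) y))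
  | one_comp {b n : ℕ} {q : ℤ} (i : Fin 1) (e : Slot 1 b n i) (σ : Fin b ≃ Fin n)
      (_ : ∀ k, σ k = e (.inr k)) (y : Pre V b q) :
      Rel V (comp i e (Int.zero_add q) one y) (map σ y)
  | comp_one {m n : ℕ} {p : ℤ} (i : Fin m) (e : Slot m 1 n i) (σ : Fin m ≃ Fin n)
      (_ : σ i = e (.inr 0)) (_ : ∀ j : {j // j ≠ i}, σ j = e (.inl j)) (x : Pre V m p) :
      Rel V (comp i e (Int.add_zero p) x one) (map σ x)

/-- The congruence as a setoid. -/
instance setoid (V : SMod K) (n : ℕ) (i : ℤ) : Setoid (Pre V n i) :=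
  ⟨Rel V, .refl, .symm, .trans⟩

/-- Terms modulo the congruence. -/
def Carrier (V : SMod K) (n : ℕ) (i : ℤ) : Type u := Quotient (setoid V n i)

instance (V : SMod K) (n : ℕ) (i : ℤ) : Add (Carrier V n i) :=
  ⟨Quotient.map₂ add fun _ _ h _ _ h' => .add_congr h h'⟩

instance (V : SMod K) (n : ℕ) (i : ℤ) : Zero (Carrier V n i) := ⟨Quotient.mk _ zero⟩

instance (V : SMod K) (n : ℕ) (i : ℤ) : Neg (Carrier V n i) :=
  ⟨Quotient.map (smul (-1)) fun _ _ h => .smul_congr _ h⟩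

instance (V : SMod K) (n : ℕ) (i : ℤ) : AddCommGroup (Carrier V n i) where
  add_assoc := by rintro ⟨x⟩ ⟨y⟩ ⟨z⟩; exact Quotient.sound (.add_assoc x y z)
  add_comm := by rintro ⟨x⟩ ⟨y⟩; exact Quotient.sound (.add_comm x y)
  zero_add := by rintro ⟨x⟩; exact Quotient.sound (.zero_add x)
  add_zero := by rintro ⟨x⟩; exact Quotient.sound (.trans (.add_comm _ _) (.zero_add x))
  neg_add_cancel := by rintro ⟨x⟩; exact Quotient.sound (.neg_add x)
  nsmul := nsmulRec
  zsmul := zsmulRec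

instance (V : SMod K) (n : ℕ) (i : ℤ) : Module K (Carrier V n i) where
  smul c := Quotient.map (smul c) fun _ _ h => .smul_congr c h
  one_smul := by rintro ⟨x⟩; exact Quotient.sound (.one_smul x)
  mul_smul := by rintro c d ⟨x⟩; exact Quotient.sound (.mul_smul c d x)
  smul_zero := fun c => Quotient.sound (.smul_zero c)
  smul_add := by rintro c ⟨x⟩ ⟨y⟩; exact Quotient.sound (.smul_add c x y)
  add_smul := by rintro c d ⟨x⟩; exact Quotient.sound (.add_smul c d x)
  zero_smul := by rintro ⟨x⟩; exact Quotient.sound (.zero_smul x)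

end Free

open Free in
/-- The free graded operad `𝕋 V` on a graded `𝕊`-module `V`; it is left adjoint to the forgetful
functor by `Free.lift` and `Free.hom_ext`. -/
def free (V : SMod K) : Operad K where
  obj := Carrier V
  map σ :=
    { toFun := Quotient.map (Pre.map σ) fun _ _ h => .map_congr σ h
      map_add' := by rintro ⟨x⟩ ⟨y⟩; exact Quotient.sound (.map_add σ x y)
      map_smul' := by rintro c ⟨x⟩; exact Quotient.sound (.map_smul σ c x) }
  map_refl := by rintro n i ⟨x⟩; exact Quotient.sound (.map_refl x)
  map_trans := by rintro l m n i σ τ ⟨x⟩; exact Quotient.sound (.map_trans σ τ x)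
  one := Quotient.mk _ .one
  comp i e h := LinearMap.mk₂ K
    (Quotient.map₂ (Pre.comp i e h) fun _ _ hx _ _ hy => .comp_congr i e h hx hy)
    (by rintro ⟨x⟩ ⟨x'⟩ ⟨y⟩; exact Quotient.sound (.comp_add_left i e h x x' y))
    (by rintro c ⟨x⟩ ⟨y⟩; exact Quotient.sound (.comp_smul_left i e h c x y))
    (by rintro ⟨x⟩ ⟨y⟩ ⟨y'⟩; exact Quotient.sound (.comp_add_right i e h x y y'))
    (by rintro c ⟨x⟩ ⟨y⟩; exact Quotient.sound (.comp_smul_right i e h c x y))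
  equivar := by
    rintro m b n m' b' n' p q r i e i' e' σ τ ρ H h ⟨x⟩ ⟨y⟩
    exact Quotient.sound (.equivar e e' σ τ ρ H h x y)
  assoc_seq := by
    rintro m b c n s t p q r pq qr w i e j e' f f' H h₁ h₂ h₃ h₄ ⟨x⟩ ⟨y⟩ ⟨z⟩
    exact Quotient.sound (.assoc_seq e e' f f' H h₁ h₂ h₃ h₄ x y z)
  assoc_par := by
    rintro m b c n n' s p q r pq pr w i j hij e e' g g' H h₁ h₂ h₃ h₄ ⟨x⟩ ⟨y⟩ ⟨z⟩
    exact Quotient.sound (.assoc_par hij e e' g g' H h₁ h₂ h₃ h₄ x y z)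
  one_comp := by rintro b n q i e σ H ⟨y⟩; exact Quotient.sound (.one_comp i e σ H y)
  comp_one := by rintro m n p i e σ H H' ⟨x⟩; exact Quotient.sound (.comp_one i e σ H H' x)

namespace Free

/-- The inclusion of generators. -/
def gen (V : SMod K) : SMod.Hom V (free V).toSMod where
  app :=
    { toFun := fun x => Quotient.mk _ (.gen x)
      map_add' := fun x y => Quotient.sound (.gen_add x y)
      map_smul' := fun c x => Quotient.sound (.gen_smul c x) }
  naturality σ x := Quotient.sound (.gen_map σ x)

/-- Evaluation of a term in an operad. -/
def Pre.eval {V : SMod K} {P : Operad K} (f : SMod.Hom V P.toSMod) :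
    ∀ {n : ℕ} {i : ℤ}, Pre V n i → P n i
  | _, _, .gen x => f.app x
  | _, _, .one => P.one
  | _, _, .map σ x => P.map σ (x.eval f)
  | _, _, .comp i e h x y => P.comp i e h (x.eval f) (y.eval f)
  | _, _, .zero => 0
  | _, _, .add x y => x.eval f + y.eval f
  | _, _, .smul c x => c • x.eval f

theorem Rel.eval {V : SMod K} {P : Operad K} (f : SMod.Hom V P.toSMod) {n : ℕ} {i : ℤ}
    {x y : Pre V n i} (h : Rel V x y) : x.eval f = y.eval f := by
  induction h with
  | refl => rfl
  | symm _ ih => exact ih.symm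
  | trans _ _ ih ih' => exact ih.trans ih'
  | map_congr _ _ ih => simp [Pre.eval, ih]
  | comp_congr _ _ _ _ _ ih ih' => simp [Pre.eval, ih, ih']
  | add_congr _ _ ih ih' => simp [Pre.eval, ih, ih']
  | smul_congr _ _ ih => simp [Pre.eval, ih]
  | add_assoc => exact _root_.add_assoc _ _ _
  | add_comm => exact _root_.add_comm _ _
  | zero_add => exact _root_.zero_add _
  | neg_add => simp [Pre.eval]
  | smul_add => exact _root_.smul_add _ _ _
  | add_smul => exact _root_.add_smul _ _ _
  | mul_smul => exact SemigroupAction.mul_smul _ _ _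
  | one_smul => exact _root_.one_smul _ _
  | zero_smul => exact _root_.zero_smul _ _
  | smul_zero => exact _root_.smul_zero _
  | gen_add => simp [Pre.eval]
  | gen_smul => simp [Pre.eval]
  | gen_map => simp [Pre.eval, f.naturality]
  | map_add => simp [Pre.eval]
  | map_smul => simp [Pre.eval]
  | map_refl => exact P.map_refl _
  | map_trans => exact P.map_trans _ _ _
  | comp_add_left => simp [Pre.eval]
  | comp_smul_left => simp [Pre.eval]
  | comp_add_right => simp [Pre.eval]
  | comp_smul_right => simp [Pre.eval]
  | equivar e e' σ τ ρ H h x y => exact P.equivar e e' σ τ ρ H h _ _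
  | assoc_seq e e' f f' H h₁ h₂ h₃ h₄ => exact P.assoc_seq e e' f f' H h₁ h₂ h₃ h₄ _ _ _
  | assoc_par hij e e' g g' H h₁ h₂ h₃ h₄ => exact P.assoc_par hij e e' g g' H h₁ h₂ h₃ h₄ _ _ _
  | one_comp i e σ H => exact P.one_comp i e σ H _
  | comp_one i e σ H H' => exact P.comp_one i e σ H H' _

/-- The morphism of operads `𝕋 V → P` that extends `f : V → P`. -/
def lift {V : SMod K} {P : Operad K} (f : SMod.Hom V P.toSMod) : Operad.Hom (free V) P where
  app :=
    { toFun := Quotient.lift (Pre.eval f) fun _ _ h => Rel.eval f h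
      map_add' := by rintro ⟨x⟩ ⟨y⟩; rfl
      map_smul' := by rintro c ⟨x⟩; rfl }
  naturality := by rintro m n i σ ⟨x⟩; rfl
  map_one := rfl
  map_comp := by rintro m b n p q r i e h ⟨x⟩ ⟨y⟩; rfl

@[simp] theorem lift_gen {V : SMod K} {P : Operad K} (f : SMod.Hom V P.toSMod) {n : ℕ} {i : ℤ}
    (x : V n i) : (lift f).app ((gen V).app x) = f.app x := rfl

/-- Induction on elements of a free operad. -/
theorem induction {V : SMod K} {motive : ∀ {n : ℕ} {i : ℤ}, free V n i → Prop}
    (hgen : ∀ {n i} (x : V n i), motive ((gen V).app x))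
    (hone : motive (free V).one)
    (hmap : ∀ {m n i} (σ : Fin m ≃ Fin n) (x : free V m i), motive x → motive ((free V).map σ x))
    (hcomp : ∀ {m b n p q r} (i : Fin m) (e : Slot m b n i) (h : p + q = r)
      (x : free V m p) (y : free V b q), motive x → motive y → motive ((free V).comp i e h x y))
    (hzero : ∀ {n i}, motive (0 : free V n i))
    (hadd : ∀ {n i} (x y : free V n i), motive x → motive y → motive (x + y))
    (hsmul : ∀ {n i} (c : K) (x : free V n i), motive x → motive (c • x))
    {n : ℕ} {i : ℤ} (x : free V n i) : motive x := by
  have key : ∀ {n i} (t : Pre V n i), motive (Quotient.mk _ t : free V n i) := by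
    intro n i t
    induction t with
    | gen x => exact hgen x
    | one => exact hone
    | map σ x ih => exact hmap σ _ ih
    | comp i e h x y ih ih' => exact hcomp i e h _ _ ih ih'
    | zero => exact hzero
    | add x y ih ih' => exact hadd _ _ ih ih'
    | smul c x ih => exact hsmul c _ ih
  exact Quotient.ind key x

/-- Two operad morphisms out of a free operad that agree on generators are equal. -/
theorem hom_ext {V : SMod K} {P : Operad K} {f g : Operad.Hom (free V) P}
    (h : ∀ {n i} (x : V n i), f.app ((gen V).app x) = g.app ((gen V).app x))
    {n : ℕ} {i : ℤ} (x : free V n i) : f.app x = g.app x := by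
  induction x using induction with
  | hgen x => exact h x
  | hone => rw [f.map_one, g.map_one]
  | hmap σ x ih => rw [f.naturality, g.naturality, ih]
  | hcomp i e hh x y ih ih' => rw [f.map_comp, g.map_comp, ih, ih']
  | hzero => simp
  | hadd x y ih ih' => simp [ih, ih']
  | hsmul c x ih => simp [ih]

end Free

theorem neg_one_zpow_congr {a b : ℤ} (h : Even (a - b)) : (-1 : K) ^ a = (-1 : K) ^ b := by
  have h1 : (-1 : K) ^ (a - b) = 1 := h.neg_one_zpow
  rwa [zpow_sub₀ (by simp), div_eq_one_iff_eq (zpow_ne_zero _ (by simp))] at h1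

theorem neg_one_zpow_mul (a b : ℤ) : (-1 : K) ^ a * (-1 : K) ^ b = (-1 : K) ^ (a + b) :=
  (zpow_add₀ (by simp) a b).symm

/-! ### Dual numbers and derivations -/

namespace Operad

/-- The operad `P ⊕ P η` of dual numbers over `P`, with `η` of degree `k` and `η² = 0`, where `η` is
moved to the left: `(x₁ + η x₂) ∘ᵢ (y₁ + η y₂) = x₁ ∘ᵢ y₁ + η (x₂ ∘ᵢ y₁ + (-1)^{k |x₁|} x₁ ∘ᵢ y₂)`.
Morphisms into it are derivations along morphisms into `P`. -/
def dual (k : ℤ) (P : Operad K) : Operad K where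
  obj n i := P n i × P n (i - k)
  map σ := (P.map σ).prodMap (P.map σ)
  map_refl x := by simp [P.map_refl]
  map_trans σ τ x := by simp [P.map_trans]
  one := (P.one, 0)
  comp {m b n p q r} i e h := LinearMap.mk₂ K
    (fun x y => (P.comp i e h x.1 y.1,
      P.comp i e (by omega : p - k + q = r - k) x.2 y.1 +
        (-1 : K) ^ (k * p) • P.comp i e (by omega : p + (q - k) = r - k) x.1 y.2))
    (by intro x x' y; ext <;> simp; abel)
    (by intro c x y; ext <;> simp [smul_comm c])
    (by intro x y y'; ext <;> simp; abel)
    (by intro c x y; ext <;> simp [smul_comm c])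
  equivar e i' e' σ τ ρ H h x y := by
    ext <;> simp [P.equivar e e' σ τ ρ H]
  assoc_seq {m b c n s t p q r pq qr w i} e {j} e' f f' H h₁ h₂ h₃ h₄ x y z := by
    subst h₁ h₃
    ext
    · exact P.assoc_seq e e' f f' H _ _ _ _ _ _ _
    · simp only [LinearMap.mk₂_apply, map_add, LinearMap.add_apply, map_smul, LinearMap.smul_apply,
        smul_add, smul_smul, add_assoc]
      rw [P.assoc_seq e e' f f' H _ _ rfl (by omega),
        P.assoc_seq e e' f f' H _ _ (by omega : q - k + r = q + r - k) (by omega),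
        P.assoc_seq e e' f f' H _ _ (by omega : q + (r - k) = q + r - k) (by omega),
        neg_one_zpow_mul, mul_add]
  assoc_par {m b c n n' s p q r pq pr w i j} hij e e' g g' H h₁ h₂ h₃ h₄ x y z := by
    subst h₁ h₃
    ext
    · exact P.assoc_par hij e e' g g' H _ _ _ _ _ _ _
    · simp only [LinearMap.mk₂_apply, map_add, LinearMap.add_apply, map_smul, LinearMap.smul_apply,
        smul_add, smul_smul, add_assoc, Prod.smul_snd]
      rw [P.assoc_par hij e e' g g' H _ _ (by omega : p - k + r = p + r - k) (by omega),
        P.assoc_par hij e e' g g' H _ _ rfl (by omega),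
        P.assoc_par hij e e' g g' H _ _ (by omega : p + (r - k) = p + r - k) (by omega),
        smul_smul, smul_smul, neg_one_zpow_mul, neg_one_zpow_mul, neg_one_zpow_mul,
        neg_one_zpow_mul,
        neg_one_zpow_congr (a := k * p + (q - k) * r) (b := q * r + k * (p + r)) ⟨-(k * r), by ring⟩,
        neg_one_zpow_congr (a := k * (p + q) + q * (r - k)) (b := q * r + k * p) ⟨0, by ring⟩]
      abel
  one_comp i e σ H y := by
    ext
    · exact P.one_comp i e σ H _
    · simpa using P.one_comp i e σ H _
  comp_one i e σ H H' x := by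
    ext
    · exact P.comp_one i e σ H H' _
    · simpa using P.comp_one i e σ H H' _

end Operad

namespace SMod

/-- Transport along an equality of degrees. -/
def cast (V : SMod K) {n : ℕ} {i j : ℤ} (h : i = j) : V n i →ₗ[K] V n j := h ▸ LinearMap.id

@[simp] theorem cast_rfl (V : SMod K) {n : ℕ} {i : ℤ} (x : V n i) : V.cast rfl x = x := rfl

theorem map_cast (V : SMod K) {m n : ℕ} {i j : ℤ} (h : i = j) (σ : Fin m ≃ Fin n) (x : V m i) :
    V.cast h (V.map σ x) = V.map σ (V.cast h x) := by
  subst h; rfl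

namespace Hom

/-- The composite `g ∘ f`. -/
def trans {U V W : SMod K} (f : Hom U V) (g : Hom V W) : Hom U W where
  app := g.app ∘ₗ f.app
  naturality σ x := by simp [f.naturality, g.naturality]

/-- The inclusion of the first summand. -/
def inl (V W : SMod K) : Hom V (V.prod W) where
  app := LinearMap.inl K _ _
  naturality σ _ := Prod.ext rfl (map_zero (W.map σ)).symm

/-- The inclusion of the second summand. -/
def inr (V W : SMod K) : Hom W (V.prod W) where
  app := LinearMap.inr K _ _
  naturality σ _ := Prod.ext (map_zero (V.map σ)).symm rfl

/-- The direct sum of two morphisms. -/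
def prodMap {V W V' W' : SMod K} (f : Hom V V') (g : Hom W W') : Hom (V.prod W) (V'.prod W') where
  app := f.app.prodMap g.app
  naturality σ x := Prod.ext (f.naturality σ x.1) (g.naturality σ x.2)

/-- The morphism `(x, y) ↦ f x + g y`. -/
def coprod {V W U : SMod K} (f : Hom V U) (g : Hom W U) : Hom (V.prod W) U where
  app := f.app.coprod g.app
  naturality σ x := by
    change f.app (V.map σ x.1) + g.app (W.map σ x.2) = U.map σ (f.app x.1 + g.app x.2)
    rw [f.naturality, g.naturality, map_add]

/-- A morphism as a homogeneous map of degree `0`. -/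
def toDeg {V W : SMod K} (f : Hom V W) : DegHom 0 V W where
  app h := f.app ∘ₗ V.cast (by omega)
  naturality h σ x := by simp [map_cast, f.naturality]

end Hom

namespace DegHom

/-- The zero map. -/
instance (k : ℤ) (V W : SMod K) : Zero (DegHom k V W) := ⟨⟨fun _ => 0, by simp⟩⟩

/-- The direct sum of two homogeneous maps. -/
def prodMap {k : ℤ} {V W V' W' : SMod K} (f : DegHom k V V') (g : DegHom k W W') :
    DegHom k (V.prod W) (V'.prod W') where
  app h := (f.app h).prodMap (g.app h)
  naturality h σ x := Prod.ext (f.naturality h σ x.1) (g.naturality h σ x.2)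

/-- The homogeneous map `(x, y) ↦ f x + g y`. -/
def coprod {k : ℤ} {V W U : SMod K} (f : DegHom k V U) (g : DegHom k W U) :
    DegHom k (V.prod W) U where
  app h := (f.app h).coprod (g.app h)
  naturality h σ x := by
    change f.app h (V.map σ x.1) + g.app h (W.map σ x.2) = U.map σ (f.app h x.1 + g.app h x.2)
    rw [f.naturality, g.naturality, map_add]

/-- Composition with a morphism of the target. -/
def comp {k : ℤ} {U V W : SMod K} (f : DegHom k U V) (g : Hom V W) : DegHom k U W where
  app h := g.app ∘ₗ f.app h
  naturality h σ x := by simp [f.naturality, g.naturality]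

/-- Composition with a morphism of the source. -/
def precomp {k : ℤ} {U V W : SMod K} (f : Hom U V) (g : DegHom k V W) : DegHom k U W where
  app h := g.app h ∘ₗ f.app
  naturality h σ x := by simp [f.naturality, g.naturality]

@[simp] theorem zero_app {k : ℤ} {V W : SMod K} {n : ℕ} {i j : ℤ} (h : i = j + k) (x : V n i) :
    (0 : DegHom k V W).app h x = 0 := rfl

@[simp] theorem coprod_app {k : ℤ} {V W U : SMod K} (f : DegHom k V U) (g : DegHom k W U)
    {n : ℕ} {i j : ℤ} (h : i = j + k) (x : V.prod W n i) :
    (f.coprod g).app h x = f.app h x.1 + g.app h x.2 := rfl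

end DegHom

@[simp] theorem Hom.coprod_app {V W U : SMod K} (f : Hom V U) (g : Hom W U)
    {n : ℕ} {i : ℤ} (x : V.prod W n i) :
    (f.coprod g).app x = f.app x.1 + g.app x.2 := rfl

/-- The extension by zero, to all arities and degrees, of a linear form on the component of arity `1`
and degree `k`. -/
def extend (V : SMod K) (k : ℤ) (f : V 1 k →ₗ[K] K) (n : ℕ) (i : ℤ) : V n i →ₗ[K] K :=
  if h : n = 1 ∧ i = k then by
    obtain ⟨h₁, h₂⟩ := h
    subst h₁ h₂
    exact f
  else 0

theorem eq_of_equiv {m n : ℕ} (σ : Fin m ≃ Fin n) : m = n := by simpa using Fintype.card_congr σ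

theorem map_one_eq (V : SMod K) {i : ℤ} (σ : Fin 1 ≃ Fin 1) (x : V 1 i) : V.map σ x = x := by
  rw [Subsingleton.elim σ (Equiv.refl _), V.map_refl]

theorem extend_map (V : SMod K) {k : ℤ} (f : V 1 k →ₗ[K] K) {m n : ℕ} {i : ℤ}
    (σ : Fin m ≃ Fin n) (x : V m i) : V.extend k f n i (V.map σ x) = V.extend k f m i x := by
  obtain rfl := eq_of_equiv σ
  by_cases h : m = 1 ∧ i = k
  · obtain ⟨rfl, rfl⟩ := h
    rw [map_one_eq]
  · simp [extend, h]

end SMod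

namespace SMod

/-- The given element of arity `1` and degree `0` if `n = 1` and `i = 0`, and zero otherwise. -/
def elemAt (V : SMod K) (x : V 1 0) (n : ℕ) (i : ℤ) : V n i :=
  if h : n = 1 ∧ i = 0 then by
    obtain ⟨h₁, h₂⟩ := h
    subst h₁ h₂
    exact x
  else 0

theorem elemAt_one (V : SMod K) (x : V 1 0) : V.elemAt x 1 0 = x := by
  rw [elemAt, dif_pos ⟨rfl, rfl⟩]

theorem map_elemAt (V : SMod K) (x : V 1 0) {m n : ℕ} {i : ℤ} (σ : Fin m ≃ Fin n) :
    V.map σ (V.elemAt x m i) = V.elemAt x n i := by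
  obtain rfl := eq_of_equiv σ
  by_cases h : m = 1 ∧ i = 0
  · obtain ⟨rfl, rfl⟩ := h
    rw [map_one_eq]
  · simp [elemAt, h]

end SMod

namespace Operad

/-- The unit of `P` if `n = 1` and `i = 0`, and zero otherwise. -/
def oneAt (P : Operad K) (n : ℕ) (i : ℤ) : P n i := P.elemAt P.one n i

theorem oneAt_one (P : Operad K) : P.oneAt 1 0 = P.one := P.elemAt_one _

theorem map_oneAt (P : Operad K) {m n : ℕ} {i : ℤ} (σ : Fin m ≃ Fin n) :
    P.map σ (P.oneAt m i) = P.oneAt n i := P.map_elemAt _ σ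

theorem oneAt_of_not (P : Operad K) {n : ℕ} {i : ℤ} (h : ¬(n = 1 ∧ i = 0)) : P.oneAt n i = 0 := by
  simp [oneAt, SMod.elemAt, h]

theorem Hom.map_oneAt {P Q : Operad K} (F : Hom P Q) (n : ℕ) (i : ℤ) :
    F.app (P.oneAt n i) = Q.oneAt n i := by
  by_cases h : n = 1 ∧ i = 0
  · obtain ⟨rfl, rfl⟩ := h
    rw [oneAt_one, oneAt_one, F.map_one]
  · simp [oneAt_of_not _ h]

/-- The homogeneous map `x ↦ f(x) 1` into an operad given by a linear form on `V 1 k`. -/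
def scalar {V : SMod K} {k : ℤ} (f : V 1 k →ₗ[K] K) (P : Operad K) :
    SMod.DegHom k V P.toSMod where
  app {n i j} _ := (V.extend k f n i).smulRight (P.oneAt n j)
  naturality h σ x := by simp [SMod.extend_map, P.map_oneAt]

/-- The morphism `x ↦ f(x) 1` into an operad given by a linear form on `V 1 0`. -/
def scalarHom {V : SMod K} (f : V 1 0 →ₗ[K] K) (P : Operad K) : SMod.Hom V P.toSMod where
  app {n i} := (V.extend 0 f n i).smulRight (P.oneAt n i)
  naturality σ x := by simp [SMod.extend_map, P.map_oneAt]

theorem scalarHom_app {V : SMod K} (f : V 1 0 →ₗ[K] K) (P : Operad K) {n : ℕ} {i : ℤ} (x : V n i) :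
    (scalarHom f P).app x = V.extend 0 f n i x • P.oneAt n i := rfl

theorem scalar_app {V : SMod K} {k : ℤ} (f : V 1 k →ₗ[K] K) (P : Operad K) {n : ℕ} {i j : ℤ}
    (h : i = j + k) (x : V n i) :
    (scalar f P).app h x = V.extend k f n i x • P.oneAt n j := rfl

/-- The morphism `x ↦ E(x) + η f(x)` into the dual numbers. -/
def dualHom {V : SMod K} {P : Operad K} {k : ℤ} (E : SMod.Hom V P.toSMod)
    (f : SMod.DegHom k V P.toSMod) : SMod.Hom V (P.dual k).toSMod where
  app {n i} := E.app.prod (f.app (by omega))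
  naturality σ x := Prod.ext (E.naturality σ x) (f.naturality _ σ x)

end Operad

/-- A homogeneous map into `P`, seen in the dual numbers `P ⊕ P η`. -/
def SMod.DegHom.inclDual {V : SMod K} {P : Operad K} {l : ℤ} (g : SMod.DegHom l V P.toSMod) (k : ℤ) :
    SMod.DegHom l V (P.dual k).toSMod where
  app h := (g.app h).prod 0
  naturality h σ x := Prod.ext (g.naturality h σ x) (map_zero (P.map σ)).symm

namespace Operad

/-- The projection `P ⊕ P η → P`. -/
def dualFst (k : ℤ) (P : Operad K) : Hom (P.dual k) P where
  app := LinearMap.fst K _ _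
  naturality _ _ := rfl
  map_one := rfl
  map_comp _ _ _ _ _ := rfl

/-- The dual numbers are functorial. -/
def Hom.mapDual (l : ℤ) {P Q : Operad K} (F : Hom P Q) : Hom (P.dual l) (Q.dual l) where
  app := F.app.prodMap F.app
  naturality σ x := Prod.ext (F.naturality σ x.1) (F.naturality σ x.2)
  map_one := Prod.ext F.map_one (map_zero F.app)
  map_comp {m b n p q r} i e h x y := by
    refine Prod.ext (F.map_comp i e h x.1 y.1) ?_
    change F.app (P.comp i e _ x.2 y.1 + (-1 : K) ^ (l * p) • P.comp i e _ x.1 y.2) = _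
    rw [map_add, map_smul, F.map_comp, F.map_comp]
    rfl

end Operad

namespace Free

open Operad

variable {V : SMod K} {P : Operad K} {k l : ℤ}

/-- The map `D : 𝕋 V → P` of degree `-k` that extends `f : V → P` and is a derivation along the
morphism `E : 𝕋 V → P` that extends `E : V → P`:
`D (x ∘ᵢ y) = D x ∘ᵢ E y + (-1)^{k |x|} E x ∘ᵢ D y` (see `derivation_gen` and `derivation_comp`). -/
def derivation (E : SMod.Hom V P.toSMod) (f : SMod.DegHom k V P.toSMod) :
    SMod.DegHom k (free V).toSMod P.toSMod where
  app {n i j} h := P.cast (by omega) ∘ₗ LinearMap.snd K (P n i) (P n (i - k)) ∘ₗ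
    (lift (dualHom E f)).app
  naturality h σ x := by
    change P.cast _ ((lift (dualHom E f)).app ((free V).map σ x)).2 = _
    rw [(lift (dualHom E f)).naturality]
    exact P.map_cast _ σ _

/-- The map `𝕋 V → P` that sends a tree labelled by elements of `V` to the sum, over all ordered pairs
of distinct vertices, of the trees obtained by applying `f` to the first vertex of the pair, `g` to
the second one and `E` to all the others, and composing in `P`, with the Koszul sign for applying
`f` and `g` in this order (see `biderivation_comp`). It is the coefficient of `η' η` in the morphism
that extends `E + η f + η' g`. -/
def biderivation (E : SMod.Hom V P.toSMod) (f : SMod.DegHom k V P.toSMod)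
    (g : SMod.DegHom l V P.toSMod) : SMod.DegHom (k + l) (free V).toSMod P.toSMod where
  app {n i j} h := P.cast (by omega) ∘ₗ LinearMap.snd K (P n (i - l)) (P n (i - l - k)) ∘ₗ
    LinearMap.snd K (P n i × P n (i - k)) (P n (i - l) × P n (i - l - k)) ∘ₗ
    (lift (dualHom (dualHom E f) (g.inclDual k))).app
  naturality h σ x := by
    change P.cast _ ((lift (dualHom (dualHom E f) (g.inclDual k))).app ((free V).map σ x)).2.2 = _
    rw [(lift (dualHom (dualHom E f) (g.inclDual k))).naturality]
    exact P.map_cast _ σ _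

theorem lift_dualHom_fst (E : SMod.Hom V P.toSMod) (f : SMod.DegHom k V P.toSMod) {n : ℕ} {i : ℤ}
    (x : free V n i) : ((lift (dualHom E f)).app x).1 = (lift E).app x :=
  hom_ext (f := (lift (dualHom E f)).trans (dualFst k P)) (g := lift E) (fun _ => rfl) x

theorem lift_dualHom_snd (E : SMod.Hom V P.toSMod) (f : SMod.DegHom k V P.toSMod) {n : ℕ} {i : ℤ}
    (x : free V n i) :
    ((lift (dualHom E f)).app x).2 = (derivation E f).app (by omega : i = i - k + k) x := rfl

@[simp] theorem derivation_gen (E : SMod.Hom V P.toSMod) (f : SMod.DegHom k V P.toSMod) {n : ℕ}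
    {i j : ℤ} (h : i = j + k) (x : V n i) :
    (derivation E f).app h ((gen V).app x) = f.app h x := by
  obtain rfl : j = i - k := by omega
  rfl

theorem derivation_one (E : SMod.Hom V P.toSMod) (f : SMod.DegHom k V P.toSMod)
    {j : ℤ} (h : 0 = j + k) : (derivation E f).app h (free V).one = 0 := by
  obtain rfl : j = 0 - k := by omega
  rfl

theorem derivation_comp (E : SMod.Hom V P.toSMod) (f : SMod.DegHom k V P.toSMod)
    {m b n : ℕ} {p q r p' q' r' : ℤ} (i : Fin m) (e : Slot m b n i) (h : p + q = r)
    (hp : p = p' + k) (hq : q = q' + k) (hr : r = r' + k) (x : free V m p) (y : free V b q) :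
    (derivation E f).app hr ((free V).comp i e h x y) =
      P.comp i e (by omega) ((derivation E f).app hp x) ((lift E).app y) +
      (-1 : K) ^ (k * p) • P.comp i e (by omega) ((lift E).app x) ((derivation E f).app hq y) := by
  obtain rfl : r' = r - k := by omega
  obtain rfl : p' = p - k := by omega
  obtain rfl : q' = q - k := by omega
  rw [← lift_dualHom_snd, ← lift_dualHom_snd, ← lift_dualHom_snd, (lift (dualHom E f)).map_comp,
    ← lift_dualHom_fst E f, ← lift_dualHom_fst E f]
  rfl

section

variable (E : SMod.Hom V P.toSMod) (f : SMod.DegHom k V P.toSMod) (g : SMod.DegHom l V P.toSMod)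

theorem lift_dualHom₂_fst {n : ℕ} {i : ℤ} (x : free V n i) :
    ((lift (dualHom (dualHom E f) (g.inclDual k))).app x).1 = (lift (dualHom E f)).app x :=
  lift_dualHom_fst _ _ x

theorem lift_dualHom₂_snd_fst {n : ℕ} {i : ℤ} (x : free V n i) :
    ((lift (dualHom (dualHom E f) (g.inclDual k))).app x).2.1 =
      (derivation E g).app (by omega : i = i - l + l) x := by
  have := hom_ext (f := (lift (dualHom (dualHom E f) (g.inclDual k))).trans
    ((dualFst k P).mapDual l)) (g := lift (dualHom E g)) (fun _ => rfl) x
  exact congrArg Prod.snd this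

theorem lift_dualHom₂_snd_snd {n : ℕ} {i : ℤ} (x : free V n i) :
    ((lift (dualHom (dualHom E f) (g.inclDual k))).app x).2.2 =
      (biderivation E f g).app (by omega : i = i - l - k + (k + l)) x := rfl

@[simp] theorem biderivation_gen {n : ℕ}
    {i j : ℤ} (h : i = j + (k + l)) (x : V n i) :
    (biderivation E f g).app h ((gen V).app x) = 0 := by
  obtain rfl : j = i - l - k := by omega
  rfl

theorem biderivation_one {j : ℤ} (h : 0 = j + (k + l)) :
    (biderivation E f g).app h (free V).one = 0 := by
  obtain rfl : j = 0 - l - k := by omega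
  rfl

theorem biderivation_comp
    {m b n : ℕ} {p q r p' q' r' p₁ p₂ q₁ q₂ : ℤ} (i : Fin m) (e : Slot m b n i) (h : p + q = r)
    (hp : p = p' + (k + l)) (hq : q = q' + (k + l)) (hr : r = r' + (k + l))
    (hp₁ : p = p₁ + k) (hp₂ : p = p₂ + l) (hq₁ : q = q₁ + k) (hq₂ : q = q₂ + l)
    (x : free V m p) (y : free V b q) :
    (biderivation E f g).app hr ((free V).comp i e h x y) =
      P.comp i e (by omega) ((biderivation E f g).app hp x) ((lift E).app y) +
      (-1 : K) ^ (k * p₂) • P.comp i e (by omega) ((derivation E g).app hp₂ x)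
        ((derivation E f).app hq₁ y) +
      (-1 : K) ^ (l * p) • (P.comp i e (by omega) ((derivation E f).app hp₁ x)
        ((derivation E g).app hq₂ y) +
      (-1 : K) ^ (k * p) • P.comp i e (by omega) ((lift E).app x)
        ((biderivation E f g).app hq y)) := by
  obtain rfl : r' = r - l - k := by omega
  obtain rfl : p' = p - l - k := by omega
  obtain rfl : q' = q - l - k := by omega
  obtain rfl : p₁ = p - k := by omega
  obtain rfl : p₂ = p - l := by omega
  obtain rfl : q₁ = q - k := by omega
  obtain rfl : q₂ = q - l := by omega
  rw [← lift_dualHom₂_snd_snd, ← lift_dualHom₂_snd_snd, ← lift_dualHom₂_snd_snd,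
    ← lift_dualHom₂_snd_fst E f g, ← lift_dualHom₂_snd_fst E f g,
    ← lift_dualHom_snd, ← lift_dualHom_snd, ← lift_dualHom_fst E f, ← lift_dualHom_fst E f,
    ← lift_dualHom₂_fst E f g, ← lift_dualHom₂_fst E f g, Operad.Hom.map_comp]
  rfl
end

end Free

/-! ### Cooperads -/

open Free Operad

/-- The trees with two levels, in the free operad on `V ⊕ W`, with the root labelled by `A ⊆ V`
and vertices labelled by `B ⊆ W` grafted onto some of the inputs of the root; the set records the
inputs that come from the root and are still free. -/
inductive TwoLevel {V W : SMod K} (A : ∀ n i, Submodule K (V n i)) (B : ∀ n i, Submodule K (W n i)) :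
    ∀ {n : ℕ} {i : ℤ}, Set (Fin n) → free (V.prod W) n i → Prop
  | root {n : ℕ} {i : ℤ} (v : V n i) (hv : v ∈ A n i) :
      TwoLevel A B Set.univ ((gen (V.prod W)).app ((SMod.Hom.inl V W).app v))
  | graft {m b n : ℕ} {p q r : ℤ} {S : Set (Fin m)} {t : free (V.prod W) m p}
      (ht : TwoLevel A B S t) (i : Fin m) (hi : i ∈ S) (e : Slot m b n i) (h : p + q = r)
      (w : W b q) (hw : w ∈ B b q) :
      TwoLevel A B {k | ∃ j : {j // j ≠ i}, j.1 ∈ S ∧ e (.inl j) = k}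
        ((free (V.prod W)).comp i e h t ((gen (V.prod W)).app ((SMod.Hom.inr V W).app w)))

/-- The composite product `A ∘ B ⊆ V ∘ W` of two families of subspaces, where `V ∘ W` is realised
inside the free operad on `V ⊕ W` as the span of the trees with two levels, all of whose root inputs
carry a vertex of the second level. (It is `A ∘ B` as soon as `A` and `B` are `𝕊`-submodules.) -/
def composite {V W : SMod K} (A : ∀ n i, Submodule K (V n i)) (B : ∀ n i, Submodule K (W n i))
    (n : ℕ) (i : ℤ) : Submodule K (free (V.prod W) n i) :=
  Submodule.span K {t | TwoLevel A B ∅ t}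

/-- The convolution `γ (f ∘ g) Δ` of two morphisms into an operad `P`, for `Δ : C → C ∘ C`. -/
def conv {C : SMod K} {P : Operad K} (Δ : SMod.Hom C (free (C.prod C)).toSMod)
    (f g : SMod.Hom C P.toSMod) : SMod.Hom C P.toSMod :=
  Δ.trans (lift (f.coprod g)).toHom

/-- A graded cooperad, i.e. a comonoid `(C, Δ, ε)` for the composite product, with
`Δ : C → C ∘ C ⊆ 𝕋 (C ⊕ C)`. The counit axioms are `(ε ∘ Id) Δ = Id = (Id ∘ ε) Δ` and coassociativity
is `(Δ ∘ Id) Δ = (Id ∘ Δ) Δ` in `C ∘ C ∘ C ⊆ 𝕋 (C ⊕ (C ⊕ C))`. -/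
structure Cooperad (K : Type u) [Field K] extends SMod K where
  decomp : SMod.Hom toSMod (free (toSMod.prod toSMod)).toSMod
  decomp_mem : ∀ {n : ℕ} {i : ℤ} (x : obj n i),
    decomp.app x ∈ composite (fun _ _ => ⊤) (fun _ _ => ⊤) n i
  counit : obj 1 0 →ₗ[K] K
  counit_left : conv decomp (scalarHom counit (free toSMod)) (gen toSMod) = gen toSMod
  counit_right : conv decomp (gen toSMod) (scalarHom counit (free toSMod)) = gen toSMod
  coassoc :
    letI ι := gen (toSMod.prod (toSMod.prod toSMod))
    letI ι₁ := (SMod.Hom.inl toSMod (toSMod.prod toSMod)).trans ι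
    letI ι₂ := ((SMod.Hom.inl toSMod toSMod).trans (SMod.Hom.inr toSMod _)).trans ι
    letI ι₃ := ((SMod.Hom.inr toSMod toSMod).trans (SMod.Hom.inr toSMod _)).trans ι
    conv decomp (conv decomp ι₁ ι₂) ι₃ = conv decomp ι₁ (conv decomp ι₂ ι₃)

/-- Write `C n i` for the component of arity `n` and degree `i`. -/
instance : CoeFun (Cooperad K) (fun _ => ℕ → ℤ → Type u) := ⟨fun C => C.obj⟩

namespace Cooperad
variable (C : Cooperad K) {P : Operad K} {k l : ℤ}

/-- The morphism `C → I → P` given by the counit of `C` and the unit of `P`. -/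
def counitHom (P : Operad K) : SMod.Hom C.toSMod P.toSMod := scalarHom C.counit P

/-- The infinitesimal convolution `γ (f ⊗ g) Δ₍₁₎`, where `Δ₍₁₎ x = ∑ x₁ ⊗ x₂` is the infinitesimal
decomposition of `x`, the image of `Δ x` under `Id ∘ (ε; Id)`, and
`(f ⊗ g) (x₁ ⊗ x₂) = (-1)^{l |x₁|} f x₁ ⊗ g x₂` for `g` of degree `-l`. In terms of the trees with two
levels that make up `Δ x`: `f` is applied to the root, `g` to one vertex of the second level, and
the counit to all the others. -/
def infConv (f : SMod.DegHom k C.toSMod P.toSMod) (g : SMod.DegHom l C.toSMod P.toSMod) :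
    SMod.DegHom (k + l) C.toSMod P.toSMod :=
  .precomp C.decomp
    (biderivation ((C.counitHom P).coprod (C.counitHom P)) (f.coprod 0) (SMod.DegHom.coprod 0 g))

end Cooperad

/-- A coaugmented cooperad: a cooperad with a group-like element `1` of arity `1` and degree `0`. -/
structure CoaugCooperad (K : Type u) [Field K] extends Cooperad K where
  coaug : obj 1 0
  counit_coaug : counit coaug = 1
  decomp_coaug : ∀ (i : Fin 1) (e : Slot 1 1 1 i),
    decomp.app coaug = (free (toSMod.prod toSMod)).comp i e (add_zero 0)
      ((gen (toSMod.prod toSMod)).app ((SMod.Hom.inl toSMod toSMod).app coaug))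
      ((gen (toSMod.prod toSMod)).app ((SMod.Hom.inr toSMod toSMod).app coaug))

/-- Write `C n i` for the component of arity `n` and degree `i`. -/
instance : CoeFun (CoaugCooperad K) (fun _ => ℕ → ℤ → Type u) := ⟨fun C => C.obj⟩

namespace CoaugCooperad
variable (C : CoaugCooperad K)

/-- The image of the coaugmentation `I → C`. -/
def unitPart (n : ℕ) (i : ℤ) : Submodule K (C n i) := Submodule.span K {C.elemAt C.coaug n i}

/-- The coradical type filtration that measures the process of successive decomposition: `F 0 = I`,
and `x` is in `F (r + 1)` when `Δ x`, apart from its trivial parts in `I ∘ C` and `C ∘ I`, is in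
`F r ∘ F r`. -/
def corad : ℕ → ∀ n i, Submodule K (C n i)
  | 0 => C.unitPart
  | r + 1 => fun n i => (composite (corad r) (corad r) n i ⊔
      composite C.unitPart (fun _ _ => ⊤) n i ⊔
      composite (fun _ _ => ⊤) C.unitPart n i).comap C.decomp.app

/-- The process of successive decomposition ends on every element. -/
def IsConilpotent : Prop := ∀ {n : ℕ} {i : ℤ} (x : C n i), ∃ r, x ∈ C.corad r n i

end CoaugCooperad

/-- A curved cooperad: a coaugmented graded cooperad with a coderivation `d` of degree `-1`
(`Δ d = (d ∘ Id + Id ∘' d) Δ` and `d 1 = 0`) and a curvature `θ : C(1) → K` of degree `-2` such that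
`θ d = 0` and `d² = (θ ⊗ Id - Id ⊗ θ) Δ₂`. The last equation is stated through the (injective)
inclusion of `C` into its free operad; its right hand side does not change when the terms `1 ⊗ x`
and `x ⊗ 1` are included in `Δ₂ x`, because their contributions cancel. -/
structure CurvedCooperad (K : Type u) [Field K] extends CoaugCooperad K where
  d : SMod.DegHom 1 toSMod toSMod
  decomp_d : ∀ {n : ℕ} {i j : ℤ} (h : i = j + 1) (x : obj n i),
    decomp.app (d.app h x) =
      (derivation (gen _) ((d.prodMap d).comp (gen _))).app h (decomp.app x)
  d_coaug : d.app (by norm_num : (0 : ℤ) = -1 + 1) coaug = 0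
  curv : obj 1 2 →ₗ[K] K
  curv_d : ∀ x : obj 1 3, curv (d.app (by norm_num : (3 : ℤ) = 2 + 1) x) = 0
  d_d : ∀ {n : ℕ} {i j k : ℤ} (h : i = j + 1) (h' : j = k + 1) (x : obj n i),
    (gen toSMod).app (d.app h' (d.app h x)) =
      (toCooperad.infConv (scalar curv (free toSMod)) (gen toSMod).toDeg).app (by omega) x -
      (toCooperad.infConv (gen toSMod).toDeg (scalar curv (free toSMod))).app (by omega) x

/-- Write `C n i` for the component of arity `n` and degree `i`. -/
instance : CoeFun (CurvedCooperad K) (fun _ => ℕ → ℤ → Type u) := ⟨fun C => C.obj⟩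

/-- A curved conilpotent cooperad. -/
structure CurvedConilpotentCooperad (K : Type u) [Field K] extends CurvedCooperad K where
  conilpotent : toCoaugCooperad.IsConilpotent

/-- Write `C n i` for the component of arity `n` and degree `i`. -/
instance : CoeFun (CurvedConilpotentCooperad K) (fun _ => ℕ → ℤ → Type u) := ⟨fun C => C.obj⟩

/-- A morphism of curved cooperads: a morphism of coaugmented cooperads that commutes with the
coderivations and the curvatures. -/
structure CurvedCooperad.Hom (C D : CurvedCooperad K) extends SMod.Hom C.toSMod D.toSMod where
  map_decomp : ∀ {n : ℕ} {i : ℤ} (x : C n i),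
    D.decomp.app (app x) = (lift ((toHom.prodMap toHom).trans (gen _))).app (C.decomp.app x)
  map_counit : ∀ x : C 1 0, D.counit (app x) = C.counit x
  map_coaug : app C.coaug = D.coaug
  map_d : ∀ {n : ℕ} {i j : ℤ} (h : i = j + 1) (x : C n i), app (C.d.app h x) = D.d.app h (app x)
  map_curv : ∀ x : C 1 2, D.curv (app x) = C.curv x

/-! ### Differential graded operads and their cofibrations -/

/-- A dg operad: a graded operad with a derivation `d` of degree `-1` and of square zero. -/
structure DGOperad (K : Type u) [Field K] extends Operad K where
  d : SMod.DegHom 1 toSMod toSMod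
  d_d : ∀ {n : ℕ} {i j k : ℤ} (h : i = j + 1) (h' : j = k + 1) (x : obj n i),
    d.app h' (d.app h x) = 0
  leibniz : ∀ {m b n : ℕ} {p q r p' q' r' : ℤ} (i : Fin m) (e : Slot m b n i) (h : p + q = r)
    (hp : p = p' + 1) (hq : q = q' + 1) (hr : r = r' + 1) (x : obj m p) (y : obj b q),
    d.app hr (comp i e h x y) = comp i e (by omega) (d.app hp x) y +
      (-1 : K) ^ p • comp i e (by omega) x (d.app hq y)

/-- Write `P n i` for the component of arity `n` and degree `i`. -/
instance : CoeFun (DGOperad K) (fun _ => ℕ → ℤ → Type u) := ⟨fun P => P.obj⟩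

namespace DGOperad

/-- A morphism of dg operads. -/
structure Hom (P Q : DGOperad K) extends
    toOperadHom : Operad.Hom P.toOperad Q.toOperad where
  map_d : ∀ {n : ℕ} {i j : ℤ} (h : i = j + 1) (x : P n i), app (P.d.app h x) = Q.d.app h (app x)

/-- The composite `g ∘ f`. -/
def Hom.trans {P Q R : DGOperad K} (f : Hom P Q) (g : Hom Q R) : Hom P R where
  toOperadHom := f.toOperadHom.trans g.toOperadHom
  map_d h x := by
    change g.app (f.app _) = R.d.app h (g.app (f.app x))
    rw [f.map_d, g.map_d]

/-- The fibrations of dg operads are the componentwise surjections. -/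
def Hom.IsFibration {P Q : DGOperad K} (f : Hom P Q) : Prop :=
  ∀ (n : ℕ) (i : ℤ), Function.Surjective (f.app (n := n) (i := i))

/-- The cycles of arity `n` and degree `i`. -/
def cycles (P : DGOperad K) (n : ℕ) (i : ℤ) : Submodule K (P n i) :=
  LinearMap.ker (P.d.app (by omega : i = i - 1 + 1))

/-- The boundaries of arity `n` and degree `i`. -/
def boundaries (P : DGOperad K) (n : ℕ) (i : ℤ) : Submodule K (P n i) :=
  LinearMap.range (P.d.app (n := n) (rfl : i + 1 = i + 1))

/-- The homology of arity `n` and degree `i`. -/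
abbrev Homology (P : DGOperad K) (n : ℕ) (i : ℤ) : Type u :=
  P.cycles n i ⧸ (P.boundaries n i).submoduleOf (P.cycles n i)

/-- The map induced on cycles. -/
def Hom.mapCycles {P Q : DGOperad K} (f : Hom P Q) (n : ℕ) (i : ℤ) :
    P.cycles n i →ₗ[K] Q.cycles n i :=
  f.app.restrict (fun x hx => by
    rw [cycles, LinearMap.mem_ker] at hx ⊢
    rw [← f.map_d, hx, map_zero])

/-- The map induced on homology. -/
def Hom.mapHomology {P Q : DGOperad K} (f : Hom P Q) (n : ℕ) (i : ℤ) :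
    P.Homology n i →ₗ[K] Q.Homology n i :=
  Submodule.mapQ _ _ (f.mapCycles n i) (by
    rintro ⟨x, hx⟩ ⟨y, hy⟩
    exact ⟨f.app y, (f.map_d rfl y).symm.trans (congrArg f.app hy)⟩)

/-- The weak equivalences of dg operads are the componentwise quasi-isomorphisms. -/
def Hom.IsWeakEquivalence {P Q : DGOperad K} (f : Hom P Q) : Prop :=
  ∀ (n : ℕ) (i : ℤ), Function.Bijective (f.mapHomology n i)

/-- The cofibrations of dg operads: the morphisms with the left lifting property with respect to
all the acyclic fibrations, i.e. the componentwise surjective quasi-isomorphisms. -/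
def Hom.IsCofibration {P Q : DGOperad K} (f : Hom P Q) : Prop :=
  ∀ (E F : DGOperad K) (p : Hom E F), p.IsFibration → p.IsWeakEquivalence →
    ∀ (a : Hom P E) (b : Hom Q F), a.trans p = f.trans b →
      ∃ l : Hom Q E, f.trans l = a ∧ l.trans p = b

end DGOperad

theorem SMod.Hom.ext' {V W : SMod K} {f g : SMod.Hom V W}
    (h : ∀ {n : ℕ} {i : ℤ} (x : V n i), f.app x = g.app x) : f = g := by
  apply SMod.Hom.ext
  funext n i
  exact LinearMap.ext h

theorem Free.app_lift {V : SMod K} {P Q : Operad K} (f : SMod.Hom V P.toSMod) (F : Hom P Q)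
    {n : ℕ} {i : ℤ} (x : free V n i) :
    F.app ((lift f).app x) = (lift (f.trans F.toHom)).app x :=
  hom_ext (f := (lift f).trans F) (g := lift (f.trans F.toHom)) (fun _ => rfl) x

theorem app_conv {C : SMod K} (Δ : SMod.Hom C (free (C.prod C)).toSMod) {P Q : Operad K}
    (f g : SMod.Hom C P.toSMod) (F : Hom P Q) :
    (conv Δ f g).trans F.toHom = conv Δ (f.trans F.toHom) (g.trans F.toHom) := by
  refine SMod.Hom.ext' fun x => ?_
  refine (Free.app_lift _ F _).trans ?_
  refine congrArg (fun φ => (lift φ).app (Δ.app x)) (SMod.Hom.ext' fun y => ?_)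
  exact map_add F.app _ _

theorem scalarHom_trans {V : SMod K} (f : V 1 0 →ₗ[K] K) {P Q : Operad K} (F : Hom P Q) :
    (scalarHom f P).trans F.toHom = scalarHom f Q := by
  refine SMod.Hom.ext' fun x => ?_
  change F.app (V.extend 0 f _ _ x • P.oneAt _ _) = V.extend 0 f _ _ x • Q.oneAt _ _
  rw [map_smul, F.map_oneAt]

namespace Cooperad
variable (C : Cooperad K) {P : Operad K} {k l : ℤ}

theorem conv_counit_left (φ : SMod.Hom C.toSMod P.toSMod) :
    conv C.decomp (C.counitHom P) φ = φ := by
  have := congrArg (fun ψ => SMod.Hom.trans ψ (lift φ).toHom) C.counit_left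
  simp only [app_conv, scalarHom_trans] at this
  exact this

theorem conv_counit_right (φ : SMod.Hom C.toSMod P.toSMod) :
    conv C.decomp φ (C.counitHom P) = φ := by
  have := congrArg (fun ψ => SMod.Hom.trans ψ (lift φ).toHom) C.counit_right
  simp only [app_conv, scalarHom_trans] at this
  exact this

theorem conv_assoc (φ₁ φ₂ φ₃ : SMod.Hom C.toSMod P.toSMod) :
    conv C.decomp (conv C.decomp φ₁ φ₂) φ₃ = conv C.decomp φ₁ (conv C.decomp φ₂ φ₃) := by
  have := congrArg (fun ψ => SMod.Hom.trans ψ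
    (lift (φ₁.coprod (φ₂.coprod φ₃))).toHom) C.coassoc
  simp only [app_conv] at this
  have h₁ : ((SMod.Hom.inl C.toSMod (C.toSMod.prod C.toSMod)).trans (gen _)).trans
      (lift (φ₁.coprod (φ₂.coprod φ₃))).toHom = φ₁ := SMod.Hom.ext' fun x => by
    change φ₁.app x + (φ₂.app 0 + φ₃.app 0) = _
    simp
  have h₂ : (((SMod.Hom.inl C.toSMod C.toSMod).trans (SMod.Hom.inr C.toSMod _)).trans
      (gen _)).trans (lift (φ₁.coprod (φ₂.coprod φ₃))).toHom = φ₂ := SMod.Hom.ext' fun x => by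
    change φ₁.app 0 + (φ₂.app x + φ₃.app 0) = _
    simp
  have h₃ : (((SMod.Hom.inr C.toSMod C.toSMod).trans (SMod.Hom.inr C.toSMod _)).trans
      (gen _)).trans (lift (φ₁.coprod (φ₂.coprod φ₃))).toHom = φ₃ := SMod.Hom.ext' fun x => by
    change φ₁.app 0 + (φ₂.app 0 + φ₃.app x) = _
    simp
  rwa [h₁, h₂, h₃] at this

theorem oneAt_dual (n : ℕ) (i : ℤ) : (P.dual k).oneAt n i = (P.oneAt n i, 0) := by
  by_cases h : n = 1 ∧ i = 0
  · obtain ⟨rfl, rfl⟩ := h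
    rw [oneAt_one, oneAt_one]; rfl
  · rw [oneAt_of_not _ h, oneAt_of_not _ h]; rfl

/-- The morphism `C ⊕ C → P` given by the counit on both summands. -/
abbrev E₀ (P : Operad K) : SMod.Hom (C.toSMod.prod C.toSMod) P.toSMod :=
  (C.counitHom P).coprod (C.counitHom P)

theorem lift_E₀ {n : ℕ} {i : ℤ} (x : C n i) :
    (lift (C.E₀ P)).app (C.decomp.app x) = (C.counitHom P).app x :=
  congrArg (fun φ => SMod.Hom.app φ x) (C.conv_counit_left (C.counitHom P))

theorem dualHom_counit {n : ℕ} {i : ℤ} (x : C.obj n i) : (C.counitHom (P.dual k)).app x = ((C.counitHom P).app x, 0) := by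
  rw [counitHom, scalarHom_app, oneAt_dual]
  exact Prod.ext rfl (smul_zero _)

theorem derivation_left (f : SMod.DegHom k C.toSMod P.toSMod) {n : ℕ} {i j : ℤ} (h : i = j + k)
    (x : C n i) : (derivation (C.E₀ P) (f.coprod 0)).app h (C.decomp.app x) = f.app h x := by
  obtain rfl : j = i - k := by omega
  have := C.conv_counit_right (dualHom (C.counitHom P) f)
  have h2 := congrArg (fun φ : SMod.Hom C.toSMod (P.dual k).toSMod => (φ.app x).2) this
  refine Eq.trans ?_ h2
  rw [← lift_dualHom_snd]
  refine congrArg (fun φ : SMod.Hom _ (P.dual k).toSMod =>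
    ((lift φ).app (C.decomp.app x)).2) (SMod.Hom.ext' fun y => ?_)
  refine Eq.trans ?_ (congrArg (_ + ·) (C.dualHom_counit y.2).symm)
  exact Prod.ext rfl rfl

theorem derivation_right (f : SMod.DegHom k C.toSMod P.toSMod) {n : ℕ} {i j : ℤ} (h : i = j + k)
    (x : C n i) :
    (derivation (C.E₀ P) (SMod.DegHom.coprod 0 f)).app h (C.decomp.app x) = f.app h x := by
  obtain rfl : j = i - k := by omega
  have := C.conv_counit_left (dualHom (C.counitHom P) f)
  have h2 := congrArg (fun φ : SMod.Hom C.toSMod (P.dual k).toSMod => (φ.app x).2) this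
  refine Eq.trans ?_ h2
  rw [← lift_dualHom_snd]
  refine congrArg (fun φ : SMod.Hom _ (P.dual k).toSMod =>
    ((lift φ).app (C.decomp.app x)).2) (SMod.Hom.ext' fun y => ?_)
  refine Eq.trans ?_ (congrArg (· + _) (C.dualHom_counit y.1).symm)
  exact Prod.ext rfl rfl

end Cooperad

section
variable {V : SMod K} {P : Operad K} {k l : ℤ}

/-- `f ↦ derivation E f` is additive. -/
theorem Free.derivation_sub (E : SMod.Hom V P.toSMod) {f f₁ f₂ : SMod.DegHom k V P.toSMod}
    (hf : ∀ {n : ℕ} {i j : ℤ} (h : i = j + k) (x : V n i), f.app h x = f₁.app h x - f₂.app h x)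
    {n : ℕ} {i j : ℤ} (h : i = j + k) (x : free V n i) :
    (derivation E f).app h x = (derivation E f₁).app h x - (derivation E f₂).app h x := by
  induction x using Free.induction generalizing j with
  | hgen x => simp [hf]
  | hone => simp [derivation_one]
  | hmap σ x ih => simp [SMod.DegHom.naturality, ih]
  | @hcomp _ _ _ p q r i e hh x y ih ih' =>
    rw [derivation_comp E f i e hh (p' := p - k) (q' := q - k) (by omega) (by omega) h,
      derivation_comp E f₁ i e hh (p' := p - k) (q' := q - k) (by omega) (by omega) h,
      derivation_comp E f₂ i e hh (p' := p - k) (q' := q - k) (by omega) (by omega) h, ih, ih']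
    simp only [map_sub, LinearMap.sub_apply, smul_sub]
    abel
  | hzero => simp
  | hadd x y ih ih' => simp [ih, ih']; abel
  | hsmul c x ih => simp [ih, smul_sub]

theorem Free.biderivation_sub_left (E : SMod.Hom V P.toSMod) {f f₁ f₂ : SMod.DegHom k V P.toSMod}
    (g : SMod.DegHom l V P.toSMod)
    (hf : ∀ {n : ℕ} {i j : ℤ} (h : i = j + k) (x : V n i), f.app h x = f₁.app h x - f₂.app h x)
    {n : ℕ} {i j : ℤ} (h : i = j + (k + l)) (x : free V n i) :
    (biderivation E f g).app h x =
      (biderivation E f₁ g).app h x - (biderivation E f₂ g).app h x := by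
  induction x using Free.induction generalizing j with
  | hgen x => simp
  | hone => simp [biderivation_one]
  | hmap σ x ih => simp [SMod.DegHom.naturality, ih]
  | @hcomp _ _ _ p q r i e hh x y ih ih' =>
    have H := fun φ : SMod.DegHom k V P.toSMod => biderivation_comp E φ g i e hh
      (p' := p - (k + l)) (q' := q - (k + l)) (p₁ := p - k) (q₁ := q - k) (p₂ := p - l)
      (q₂ := q - l) (by omega) (by omega) h (by omega) (by omega) (by omega) (by omega) x y
    rw [H, H, H, ih, ih', derivation_sub E hf, derivation_sub E hf]
    simp only [map_sub, LinearMap.sub_apply, smul_sub, smul_add]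
    abel
  | hzero => simp
  | hadd x y ih ih' => simp [ih, ih']; abel
  | hsmul c x ih => simp [ih, smul_sub]

theorem Free.biderivation_sub_right (E : SMod.Hom V P.toSMod) (f : SMod.DegHom k V P.toSMod)
    {g g₁ g₂ : SMod.DegHom l V P.toSMod}
    (hg : ∀ {n : ℕ} {i j : ℤ} (h : i = j + l) (x : V n i), g.app h x = g₁.app h x - g₂.app h x)
    {n : ℕ} {i j : ℤ} (h : i = j + (k + l)) (x : free V n i) :
    (biderivation E f g).app h x =
      (biderivation E f g₁).app h x - (biderivation E f g₂).app h x := by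
  induction x using Free.induction generalizing j with
  | hgen x => simp
  | hone => simp [biderivation_one]
  | hmap σ x ih => simp [SMod.DegHom.naturality, ih]
  | @hcomp _ _ _ p q r i e hh x y ih ih' =>
    have H := fun φ : SMod.DegHom l V P.toSMod => biderivation_comp E f φ i e hh
      (p' := p - (k + l)) (q' := q - (k + l)) (p₁ := p - k) (q₁ := q - k) (p₂ := p - l)
      (q₂ := q - l) (by omega) (by omega) h (by omega) (by omega) (by omega) (by omega) x y
    rw [H, H, H, ih, ih', derivation_sub E hg, derivation_sub E hg]
    simp only [map_sub, LinearMap.sub_apply, smul_sub, smul_add]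
    abel
  | hzero => simp
  | hadd x y ih ih' => simp [ih, ih']; abel
  | hsmul c x ih => simp [ih, smul_sub]

end

namespace Cooperad
variable (C : Cooperad K) {P : Operad K} {k l : ℤ}

theorem infConv_sub_left {f f₁ f₂ : SMod.DegHom k C.toSMod P.toSMod}
    (g : SMod.DegHom l C.toSMod P.toSMod)
    (hf : ∀ {n : ℕ} {i j : ℤ} (h : i = j + k) (x : C n i), f.app h x = f₁.app h x - f₂.app h x)
    {n : ℕ} {i j : ℤ} (h : i = j + (k + l)) (x : C n i) :
    (C.infConv f g).app h x = (C.infConv f₁ g).app h x - (C.infConv f₂ g).app h x :=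
  biderivation_sub_left _ _ (fun h x => by simp [hf]) h _

theorem infConv_sub_right (f : SMod.DegHom k C.toSMod P.toSMod)
    {g g₁ g₂ : SMod.DegHom l C.toSMod P.toSMod}
    (hg : ∀ {n : ℕ} {i j : ℤ} (h : i = j + l) (x : C n i), g.app h x = g₁.app h x - g₂.app h x)
    {n : ℕ} {i j : ℤ} (h : i = j + (k + l)) (x : C n i) :
    (C.infConv f g).app h x = (C.infConv f g₁).app h x - (C.infConv f g₂).app h x :=
  biderivation_sub_right _ _ (fun h x => by simp [hg]) h _

end Cooperad

/-! Derivations of a free operad applied to derivations and biderivations. -/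

section L1
variable {V W : SMod K} {P : Operad K}

theorem Free.derivation_lift_zero (E : SMod.Hom V (free W).toSMod) (F : SMod.Hom W P.toSMod)
    (D : SMod.DegHom 1 W P.toSMod)
    (h0 : ∀ {n : ℕ} {i j : ℤ} (h : i = j + 1) (x : V n i), (derivation F D).app h (E.app x) = 0)
    {n : ℕ} {i j : ℤ} (h : i = j + 1) (x : free V n i) :
    (derivation F D).app h ((lift E).app x) = 0 := by
  induction x using Free.induction generalizing j with
  | hgen x => simp [h0]
  | hone => rw [(lift E).map_one, derivation_one]
  | hmap σ x ih => rw [(lift E).naturality, SMod.DegHom.naturality, ih, map_zero]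
  | @hcomp _ _ _ p q r i e hh x y ih ih' =>
    rw [(lift E).map_comp, derivation_comp F D i e hh (p' := p - 1) (q' := q - 1) (by omega)
      (by omega) h, ih, ih']
    simp
  | hzero => simp
  | hadd x y ih ih' => simp [ih, ih']
  | hsmul c x ih => simp [ih]

variable {k l : ℤ}

theorem Free.lift_derivation (E : SMod.Hom V (free W).toSMod) {E' : SMod.Hom V P.toSMod}
    (F : SMod.Hom W P.toSMod) (hE : E.trans (lift F).toHom = E')
    (f : SMod.DegHom k V (free W).toSMod) (f' : SMod.DegHom k V P.toSMod)
    (hf : ∀ {n : ℕ} {i j : ℤ} (h : i = j + k) (x : V n i), (lift F).app (f.app h x) = f'.app h x)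
    {n : ℕ} {i j : ℤ} (h : i = j + k) (x : free V n i) :
    (lift F).app ((derivation E f).app h x) = (derivation E' f').app h x := by
  subst hE
  induction x using Free.induction generalizing j with
  | hgen x => simp [hf]
  | hone => rw [derivation_one, derivation_one, map_zero]
  | hmap σ x ih => rw [SMod.DegHom.naturality, SMod.DegHom.naturality, (lift F).naturality, ih]
  | @hcomp _ _ _ p q r i e hh x y ih ih' =>
    rw [derivation_comp E f i e hh (p' := p - k) (q' := q - k) (by omega) (by omega) h,
      derivation_comp _ f' i e hh (p' := p - k) (q' := q - k) (by omega) (by omega) h,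
      map_add, map_smul, (lift F).map_comp, (lift F).map_comp, ih, ih', app_lift, app_lift]
  | hzero => simp
  | hadd x y ih ih' => simp [ih, ih']
  | hsmul c x ih => simp [ih]

theorem Free.derivation_derivation (E : SMod.Hom V (free W).toSMod) {E' : SMod.Hom V P.toSMod}
    (F : SMod.Hom W P.toSMod) (hE : E.trans (lift F).toHom = E') (D : SMod.DegHom 1 W P.toSMod)
    (h0 : ∀ {n : ℕ} {i j : ℤ} (h : i = j + 1) (x : V n i), (derivation F D).app h (E.app x) = 0)
    (f : SMod.DegHom k V (free W).toSMod) (f₁ : SMod.DegHom (k + 1) V P.toSMod)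
    (hf₁ : ∀ {n : ℕ} {i j s : ℤ} (h : i = j + k) (h' : j = s + 1) (x : V n i),
      (derivation F D).app h' (f.app h x) = f₁.app (by omega) x)
    {n : ℕ} {i j s : ℤ} (h : i = j + k) (h' : j = s + 1) (x : free V n i) :
    (derivation F D).app h' ((derivation E f).app h x) =
      (derivation E' f₁).app (by omega) x := by
  subst hE
  induction x using Free.induction generalizing j s with
  | hgen x => simp [hf₁]
  | hone => simp [derivation_one]
  | hmap σ x ih => rw [SMod.DegHom.naturality, SMod.DegHom.naturality, SMod.DegHom.naturality, ih]
  | @hcomp _ _ _ p q r i e hh x y ih ih' =>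
    rw [derivation_comp E f i e hh (p' := p - k) (q' := q - k) (by omega) (by omega) h,
      derivation_comp _ f₁ i e hh (p' := p - k - 1) (q' := q - k - 1) (by omega) (by omega) _,
      map_add, map_smul,
      derivation_comp F D i e (p' := p - k - 1) (q' := q - 1) _ (by omega) (by omega) h',
      derivation_comp F D i e (p' := p - 1) (q' := q - k - 1) _ (by omega) (by omega) h', ih, ih',
      derivation_lift_zero E F D h0, derivation_lift_zero E F D h0, app_lift, app_lift]
    simp only [map_zero, LinearMap.zero_apply, smul_zero, add_zero, zero_add, smul_smul,
      neg_one_zpow_mul]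
    rw [show k * p + 1 * p = (k + 1) * p by ring]
  | hzero => simp
  | hadd x y ih ih' => simp [ih, ih']
  | hsmul c x ih => simp [ih]

theorem Free.derivation_biderivation (E : SMod.Hom V (free W).toSMod) {E' : SMod.Hom V P.toSMod}
    (F : SMod.Hom W P.toSMod) (hE : E.trans (lift F).toHom = E') (D : SMod.DegHom 1 W P.toSMod)
    (h0 : ∀ {n : ℕ} {i j : ℤ} (h : i = j + 1) (x : V n i), (derivation F D).app h (E.app x) = 0)
    (f : SMod.DegHom k V (free W).toSMod) (f' : SMod.DegHom k V P.toSMod)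
    (hf : ∀ {n : ℕ} {i j : ℤ} (h : i = j + k) (x : V n i), (lift F).app (f.app h x) = f'.app h x)
    (g : SMod.DegHom l V (free W).toSMod) (g' : SMod.DegHom l V P.toSMod)
    (hg : ∀ {n : ℕ} {i j : ℤ} (h : i = j + l) (x : V n i), (lift F).app (g.app h x) = g'.app h x)
    (f₁ : SMod.DegHom (k + 1) V P.toSMod)
    (hf₁ : ∀ {n : ℕ} {i j s : ℤ} (h : i = j + k) (h' : j = s + 1) (x : V n i),
      (derivation F D).app h' (f.app h x) = f₁.app (by omega) x)
    (g₁ : SMod.DegHom (l + 1) V P.toSMod)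
    (hg₁ : ∀ {n : ℕ} {i j s : ℤ} (h : i = j + l) (h' : j = s + 1) (x : V n i),
      (derivation F D).app h' (g.app h x) = g₁.app (by omega) x)
    {n : ℕ} {i j s : ℤ} (h : i = j + (k + l)) (h' : j = s + 1) (x : free V n i) :
    (derivation F D).app h' ((biderivation E f g).app h x) =
      (biderivation E' f₁ g').app (by omega) x +
        (-1 : K) ^ k • (biderivation E' f' g₁).app (by omega) x := by
  subst hE
  induction x using Free.induction generalizing j s with
  | hgen x => simp
  | hone => simp [biderivation_one]
  | hmap σ x ih =>
    simp only [SMod.DegHom.naturality, ih, map_add, map_smul]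
  | @hcomp _ _ _ p q r i e hh x y ih ih' =>
    rw [biderivation_comp E f g i e hh
        (p' := p - (k + l)) (q' := q - (k + l)) (p₁ := p - k) (q₁ := q - k) (p₂ := p - l)
        (q₂ := q - l) (by omega) (by omega) h (by omega) (by omega) (by omega) (by omega) x y,
      biderivation_comp _ f₁ g' i e hh
        (p' := p - (k + l) - 1) (q' := q - (k + l) - 1) (p₁ := p - k - 1) (q₁ := q - k - 1)
        (p₂ := p - l) (q₂ := q - l) (by omega) (by omega) _ (by omega) (by omega) (by omega)
        (by omega) x y,
      biderivation_comp _ f' g₁ i e hh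
        (p' := p - (k + l) - 1) (q' := q - (k + l) - 1) (p₁ := p - k) (q₁ := q - k)
        (p₂ := p - l - 1) (q₂ := q - l - 1) (by omega) (by omega) _ (by omega) (by omega)
        (by omega) (by omega) x y]
    simp only [map_add, map_smul]
    rw [derivation_comp F D i e (p' := p - (k + l) - 1) (q' := q - 1) _ (by omega) (by omega) h',
      derivation_comp F D i e (p' := p - l - 1) (q' := q - k - 1) _ (by omega) (by omega) h',
      derivation_comp F D i e (p' := p - k - 1) (q' := q - l - 1) _ (by omega) (by omega) h',
      derivation_comp F D i e (p' := p - 1) (q' := q - (k + l) - 1) _ (by omega) (by omega) h',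
      ih, ih', derivation_lift_zero E F D h0, derivation_lift_zero E F D h0,
      derivation_derivation E F rfl D h0 f f₁ hf₁, derivation_derivation E F rfl D h0 f f₁ hf₁,
      derivation_derivation E F rfl D h0 g g₁ hg₁, derivation_derivation E F rfl D h0 g g₁ hg₁,
      lift_derivation E F rfl f f' hf, lift_derivation E F rfl f f' hf,
      lift_derivation E F rfl g g' hg, lift_derivation E F rfl g g' hg, app_lift, app_lift]
    simp only [map_add, map_smul, LinearMap.add_apply, LinearMap.smul_apply,
      map_zero, LinearMap.zero_apply, smul_zero, add_zero, zero_add, smul_smul,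
      neg_one_zpow_mul, smul_add, one_mul]
    rw [neg_one_zpow_congr (a := (k + 1) * (p - l)) (b := k * (p - l) + (p - l)) ⟨0, by ring⟩,
      neg_one_zpow_congr (a := k + k * (p - l - 1)) (b := k * (p - l)) ⟨0, by ring⟩,
      neg_one_zpow_congr (a := k + (l + 1) * p) (b := l * p + (p - k)) ⟨k, by ring⟩,
      neg_one_zpow_congr (a := l * p + (k + 1) * p) (b := l * p + (k * p + p)) ⟨0, by ring⟩,
      neg_one_zpow_congr (a := k + ((l + 1) * p + k * p)) (b := l * p + (k + (k * p + p)))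
        ⟨0, by ring⟩]
    abel_nf
  | hzero => simp
  | hadd x y ih ih' => simp [ih, ih']; abel
  | hsmul c x ih =>
    simp only [map_smul, ih, smul_add]
    rw [smul_comm c]

end L1

section L3
variable {V : SMod K} {P : Operad K} {k l : ℤ}

theorem Free.lift_derivation_gen (d : SMod.DegHom 1 V V) (E : SMod.Hom V P.toSMod)
    (h0 : ∀ {n : ℕ} {i j : ℤ} (h : i = j + 1) (x : V n i), E.app (d.app h x) = 0)
    {n : ℕ} {i j : ℤ} (h : i = j + 1) (x : free V n i) :
    (lift E).app ((derivation (gen V) (d.comp (gen V))).app h x) = 0 := by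
  induction x using Free.induction generalizing j with
  | hgen x => rw [derivation_gen]; exact h0 h x
  | hone => simp [derivation_one]
  | hmap σ x ih => rw [SMod.DegHom.naturality, (lift E).naturality, ih, map_zero]
  | @hcomp _ _ _ p q r i e hh x y ih ih' =>
    rw [derivation_comp _ _ i e hh (p' := p - 1) (q' := q - 1) (by omega) (by omega) h,
      map_add, map_smul, (lift E).map_comp, (lift E).map_comp, ih, ih']
    simp
  | hzero => simp
  | hadd x y ih ih' => simp [ih, ih']
  | hsmul c x ih => simp [ih]

theorem Free.lift_gen_id {n : ℕ} {i : ℤ} (x : free V n i) : (lift (gen V)).app x = x :=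
  hom_ext (f := lift (gen V)) (g := Hom.id (free V)) (fun _ => rfl) x

theorem Free.derivation_derivation_gen (d : SMod.DegHom 1 V V) (E : SMod.Hom V P.toSMod)
    (h0 : ∀ {n : ℕ} {i j : ℤ} (h : i = j + 1) (x : V n i), E.app (d.app h x) = 0)
    (f : SMod.DegHom k V P.toSMod) (f₁ : SMod.DegHom (k + 1) V P.toSMod)
    (hf₁ : ∀ {n : ℕ} {i j s : ℤ} (h : i = j + 1) (h' : j = s + k) (x : V n i),
      f.app h' (d.app h x) = f₁.app (by omega) x)
    {n : ℕ} {i j s : ℤ} (h : i = j + 1) (h' : j = s + k) (x : free V n i) :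
    (derivation E f).app h' ((derivation (gen V) (d.comp (gen V))).app h x) =
      (derivation E f₁).app (by omega) x := by
  induction x using Free.induction generalizing j s with
  | hgen x =>
    rw [derivation_gen, derivation_gen]
    exact (derivation_gen _ _ _ _).trans (hf₁ h h' x)
  | hone => simp [derivation_one]
  | hmap σ x ih => rw [SMod.DegHom.naturality, SMod.DegHom.naturality, SMod.DegHom.naturality, ih]
  | @hcomp _ _ _ p q r i e hh x y ih ih' =>
    rw [derivation_comp _ _ i e hh (p' := p - 1) (q' := q - 1) (by omega) (by omega) h,
      derivation_comp _ f₁ i e hh (p' := p - k - 1) (q' := q - k - 1) (by omega) (by omega) _,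
      map_add, map_smul,
      derivation_comp E f i e (p' := p - k - 1) (q' := q - k) _ (by omega) (by omega) h',
      derivation_comp E f i e (p' := p - k) (q' := q - k - 1) _ (by omega) (by omega) h', ih, ih',
      lift_derivation_gen d E h0, lift_derivation_gen d E h0, lift_gen_id, lift_gen_id]
    simp only [map_zero, LinearMap.zero_apply, smul_zero, add_zero, zero_add, smul_smul,
      neg_one_zpow_mul]
    rw [show 1 * p + k * p = (k + 1) * p by ring]
  | hzero => simp
  | hadd x y ih ih' => simp [ih, ih']
  | hsmul c x ih => simp [ih]

theorem Free.biderivation_derivation_gen (d : SMod.DegHom 1 V V) (E : SMod.Hom V P.toSMod)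
    (h0 : ∀ {n : ℕ} {i j : ℤ} (h : i = j + 1) (x : V n i), E.app (d.app h x) = 0)
    (f : SMod.DegHom k V P.toSMod) (f₁ : SMod.DegHom (k + 1) V P.toSMod)
    (hf₁ : ∀ {n : ℕ} {i j s : ℤ} (h : i = j + 1) (h' : j = s + k) (x : V n i),
      f.app h' (d.app h x) = f₁.app (by omega) x)
    (g : SMod.DegHom l V P.toSMod) (g₁ : SMod.DegHom (l + 1) V P.toSMod)
    (hg₁ : ∀ {n : ℕ} {i j s : ℤ} (h : i = j + 1) (h' : j = s + l) (x : V n i),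
      g.app h' (d.app h x) = g₁.app (by omega) x)
    {n : ℕ} {i j s : ℤ} (h : i = j + 1) (h' : j = s + (k + l)) (x : free V n i) :
    (biderivation E f g).app h' ((derivation (gen V) (d.comp (gen V))).app h x) =
      (-1 : K) ^ l • (biderivation E f₁ g).app (by omega) x +
        (biderivation E f g₁).app (by omega) x := by
  induction x using Free.induction generalizing j s with
  | hgen x =>
    rw [derivation_gen, biderivation_gen, biderivation_gen, smul_zero, add_zero]
    exact biderivation_gen _ _ _ _ _
  | hone => simp [derivation_one, biderivation_one]
  | hmap σ x ih =>
    simp only [SMod.DegHom.naturality, ih, map_add, map_smul]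
  | @hcomp _ _ _ p q r i e hh x y ih ih' =>
    rw [derivation_comp _ _ i e hh (p' := p - 1) (q' := q - 1) (by omega) (by omega) h,
      biderivation_comp _ f₁ g i e hh
        (p' := p - (k + l) - 1) (q' := q - (k + l) - 1) (p₁ := p - k - 1) (q₁ := q - k - 1)
        (p₂ := p - l) (q₂ := q - l) (by omega) (by omega) _ (by omega) (by omega) (by omega)
        (by omega) x y,
      biderivation_comp _ f g₁ i e hh
        (p' := p - (k + l) - 1) (q' := q - (k + l) - 1) (p₁ := p - k) (q₁ := q - k)
        (p₂ := p - l - 1) (q₂ := q - l - 1) (by omega) (by omega) _ (by omega) (by omega)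
        (by omega) (by omega) x y]
    rw [map_add, map_smul,
      biderivation_comp E f g i e _
        (p' := p - (k + l) - 1) (q' := q - (k + l)) (p₁ := p - k - 1) (q₁ := q - k)
        (p₂ := p - l - 1) (q₂ := q - l) (by omega) (by omega) h' (by omega) (by omega) (by omega)
        (by omega),
      biderivation_comp E f g i e _
        (p' := p - (k + l)) (q' := q - (k + l) - 1) (p₁ := p - k) (q₁ := q - k - 1)
        (p₂ := p - l) (q₂ := q - l - 1) (by omega) (by omega) h' (by omega) (by omega) (by omega)
        (by omega),
      ih, ih', lift_derivation_gen d E h0, lift_derivation_gen d E h0, lift_gen_id, lift_gen_id,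
      derivation_derivation_gen d E h0 f f₁ hf₁, derivation_derivation_gen d E h0 f f₁ hf₁,
      derivation_derivation_gen d E h0 g g₁ hg₁, derivation_derivation_gen d E h0 g g₁ hg₁]
    simp only [map_add, map_smul, LinearMap.add_apply, LinearMap.smul_apply,
      map_zero, LinearMap.zero_apply, smul_zero, add_zero, zero_add, smul_smul,
      neg_one_zpow_mul, smul_add, one_mul]
    rw [neg_one_zpow_congr (a := l + (k + 1) * (p - l)) (b := p + k * (p - l)) ⟨0, by ring⟩,
      neg_one_zpow_congr (a := l * (p - 1)) (b := l + l * p) ⟨-l, by ring⟩,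
      neg_one_zpow_congr (a := k * (p - l - 1)) (b := k * (p - 1 - l)) ⟨0, by ring⟩,
      neg_one_zpow_congr (a := (l + 1) * p) (b := p + l * p) ⟨0, by ring⟩,
      neg_one_zpow_congr (a := (l + 1) * p + k * p) (b := p + (l * p + k * p)) ⟨0, by ring⟩,
      neg_one_zpow_congr (a := l + (l * p + (k + 1) * p)) (b := p + (l * p + (k * p + l)))
        ⟨0, by ring⟩]
    abel_nf
  | hzero => simp
  | hadd x y ih ih' => simp [ih, ih']; abel
  | hsmul c x ih =>
    simp only [map_smul, ih, smul_add]
    rw [smul_comm c]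

end L3

namespace Operad
variable {P : Operad K} {k : ℤ}

/-- The product in the threefold dual numbers, written out. -/
theorem triple_comp {P : Operad K} {m b n : ℕ} {p q r : ℤ} (i : Fin m) (e : Slot m b n i)
    (h : p + q = r)
    (a₀ : P m p) (a₁ a₂ a₃ : P m (p - 1)) (a₁₂ a₁₃ a₂₃ : P m (p - 1 - 1)) (a : P m (p - 1 - 1 - 1))
    (b₀ : P b q) (b₁ b₂ b₃ : P b (q - 1)) (b₁₂ b₁₃ b₂₃ : P b (q - 1 - 1)) (b' : P b (q - 1 - 1 - 1)) :
    (((P.dual 1).dual 1).dual 1).comp i e h (((a₀, a₁), (a₂, a₁₂)), ((a₃, a₁₃), (a₂₃, a)))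
      (((b₀, b₁), (b₂, b₁₂)), ((b₃, b₁₃), (b₂₃, b'))) =
    (((P.comp i e h a₀ b₀,
      P.comp i e (by omega) a₁ b₀ + (-1 : K) ^ (1 * p) • P.comp i e (by omega) a₀ b₁),
     (P.comp i e (by omega) a₂ b₀ + (-1 : K) ^ (1 * p) • P.comp i e (by omega) a₀ b₂,
      (P.comp i e (by omega) a₁₂ b₀ + (-1 : K) ^ (1 * (p - 1)) • P.comp i e (by omega) a₂ b₁) +
      (-1 : K) ^ (1 * p) • (P.comp i e (by omega) a₁ b₂ +
        (-1 : K) ^ (1 * p) • P.comp i e (by omega) a₀ b₁₂))),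
     ((P.comp i e (by omega) a₃ b₀ + (-1 : K) ^ (1 * p) • P.comp i e (by omega) a₀ b₃,
      (P.comp i e (by omega) a₁₃ b₀ + (-1 : K) ^ (1 * (p - 1)) • P.comp i e (by omega) a₃ b₁) +
      (-1 : K) ^ (1 * p) • (P.comp i e (by omega) a₁ b₃ +
        (-1 : K) ^ (1 * p) • P.comp i e (by omega) a₀ b₁₃)),
     ((P.comp i e (by omega) a₂₃ b₀ + (-1 : K) ^ (1 * (p - 1)) • P.comp i e (by omega) a₃ b₂) +
      (-1 : K) ^ (1 * p) • (P.comp i e (by omega) a₂ b₃ +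
        (-1 : K) ^ (1 * p) • P.comp i e (by omega) a₀ b₂₃),
      ((P.comp i e (by omega) a b₀ + (-1 : K) ^ (1 * (p - 1 - 1)) • P.comp i e (by omega) a₂₃ b₁) +
       (-1 : K) ^ (1 * (p - 1)) • (P.comp i e (by omega) a₁₃ b₂ +
         (-1 : K) ^ (1 * (p - 1)) • P.comp i e (by omega) a₃ b₁₂)) +
      (-1 : K) ^ (1 * p) • ((P.comp i e (by omega) a₁₂ b₃ +
         (-1 : K) ^ (1 * (p - 1)) • P.comp i e (by omega) a₂ b₁₃) +
       (-1 : K) ^ (1 * p) • (P.comp i e (by omega) a₁ b₂₃ +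
         (-1 : K) ^ (1 * p) • P.comp i e (by omega) a₀ b'))))) := rfl

end Operad

namespace Cooperad
variable (C : Cooperad K) {P : Operad K} (α : SMod.DegHom 1 C.toSMod P.toSMod)

theorem assoc_left (N : Hom (free (C.toSMod.prod C.toSMod)) (((P.dual 1).dual 1).dual 1))
    (hN : ∀ {n : ℕ} {i : ℤ} (x : C.toSMod.prod C.toSMod n i), N.app ((gen _).app x) =
      ((((C.E₀ P).app x, α.app (by omega) x.1),
        (α.app (by omega) x.1, (C.infConv α α).app (by omega) x.1)),
      ((α.app (by omega) x.2, 0), (0, 0)))) {n : ℕ} {i : ℤ} (x : free (C.toSMod.prod C.toSMod) n i) :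
    N.app x = ((((lift (C.E₀ P)).app x,
        (derivation (C.E₀ P) (α.coprod 0)).app (by omega) x),
        ((derivation (C.E₀ P) (α.coprod 0)).app (by omega) x,
        (derivation (C.E₀ P) ((C.infConv α α).coprod 0)).app (by omega) x)),
      (((derivation (C.E₀ P) (SMod.DegHom.coprod 0 α)).app (by omega) x,
        (biderivation (C.E₀ P) (α.coprod 0) (SMod.DegHom.coprod 0 α)).app (by omega) x),
        ((biderivation (C.E₀ P) (α.coprod 0) (SMod.DegHom.coprod 0 α)).app (by omega) x,
        (biderivation (C.E₀ P) ((C.infConv α α).coprod 0) (SMod.DegHom.coprod 0 α)).app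
          (by omega) x))) := by
  induction x using Free.induction with
  | hgen x =>
    rw [hN]; simp; rfl
  | hone =>
    rw [N.map_one, (lift _).map_one]
    simp only [derivation_one, biderivation_one]
    rfl
  | hmap σ x ih =>
    rw [N.naturality, ih]
    simp only [SMod.DegHom.naturality]
    rw [(lift _).naturality]
    rfl
  | @hcomp _ _ _ p q r i e hh x y ih ih' =>
    have H1 : ∀ f : SMod.DegHom 1 (C.toSMod.prod C.toSMod) P.toSMod, _ := fun f =>
      derivation_comp (C.E₀ P) f i e hh (p' := p - 1) (q' := q - 1) (r' := r - 1) (by omega)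
        (by omega) (by omega) x y
    have H2 : ∀ f : SMod.DegHom (1 + 1) (C.toSMod.prod C.toSMod) P.toSMod, _ := fun f =>
      derivation_comp (C.E₀ P) f i e hh (p' := p - 1 - 1) (q' := q - 1 - 1) (r' := r - 1 - 1)
        (by omega) (by omega) (by omega) x y
    have H3 : ∀ f g : SMod.DegHom 1 (C.toSMod.prod C.toSMod) P.toSMod, _ := fun f g =>
      biderivation_comp (C.E₀ P) f g i e hh (p' := p - 1 - 1) (q' := q - 1 - 1) (r' := r - 1 - 1)
        (p₁ := p - 1) (p₂ := p - 1) (q₁ := q - 1) (q₂ := q - 1)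
        (by omega) (by omega) (by omega) (by omega) (by omega) (by omega) (by omega) x y
    have H4 : ∀ (f : SMod.DegHom (1 + 1) (C.toSMod.prod C.toSMod) P.toSMod)
        (g : SMod.DegHom 1 (C.toSMod.prod C.toSMod) P.toSMod), _ := fun f g =>
      biderivation_comp (C.E₀ P) f g i e hh (p' := p - 1 - 1 - 1) (q' := q - 1 - 1 - 1)
        (r' := r - 1 - 1 - 1) (p₁ := p - 1 - 1) (p₂ := p - 1) (q₁ := q - 1 - 1) (q₂ := q - 1)
        (by omega) (by omega) (by omega) (by omega) (by omega) (by omega) (by omega) x y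
    have s0 : (-1 : K) ^ (1 * p) * (-1 : K) ^ (1 * p) = 1 := by
      rw [neg_one_zpow_mul]; exact Even.neg_one_zpow ⟨1 * p, rfl⟩
    have s1 : (-1 : K) ^ (1 * (p - 1)) = - (-1 : K) ^ (1 * p) := by
      rw [one_mul, one_mul, zpow_sub_one₀ (by simp)]; simp
    have s2 : (-1 : K) ^ (1 * (p - 1 - 1)) = (-1 : K) ^ (1 * p) :=
      neg_one_zpow_congr ⟨-1, by ring⟩
    have s3 : (-1 : K) ^ ((1 + 1) * p) = 1 := Even.neg_one_zpow ⟨p, by ring⟩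
    have s4 : (-1 : K) ^ ((1 + 1) * (p - 1)) = 1 := Even.neg_one_zpow ⟨p - 1, by ring⟩
    rw [N.map_comp, ih, ih', (lift _).map_comp, H1, H1, H2, H3, H4]
    refine (triple_comp i e hh _ _ _ _ _ _ _ _ _ _ _ _ _ _ _ _).trans ?_
    refine Prod.ext (Prod.ext (Prod.ext ?_ ?_) (Prod.ext ?_ ?_))
      (Prod.ext (Prod.ext ?_ ?_) (Prod.ext ?_ ?_)) <;>
    (try simp only [s1, s2, s3, s4, smul_add, smul_smul, s0, one_smul, neg_smul, smul_neg, neg_mul,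
      neg_neg]) <;> (try abel)
  | hzero => simp only [map_zero]; rfl
  | hadd x y ih ih' => simp only [map_add, ih, ih']; rfl
  | hsmul c x ih => simp only [map_smul, ih]; rfl

theorem assoc_right (N : Hom (free (C.toSMod.prod C.toSMod)) (((P.dual 1).dual 1).dual 1))
    (hN : ∀ {n : ℕ} {i : ℤ} (x : C.toSMod.prod C.toSMod n i), N.app ((gen _).app x) =
      ((((C.E₀ P).app x, α.app (by omega) x.1), (α.app (by omega) x.2, 0)),
      ((α.app (by omega) x.2, 0), ((C.infConv α α).app (by omega) x.2, 0))))
    {n : ℕ} {i : ℤ} (x : free (C.toSMod.prod C.toSMod) n i) :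
    N.app x = ((((lift (C.E₀ P)).app x,
        (derivation (C.E₀ P) (α.coprod 0)).app (by omega) x),
        ((derivation (C.E₀ P) (SMod.DegHom.coprod 0 α)).app (by omega) x,
        (biderivation (C.E₀ P) (α.coprod 0) (SMod.DegHom.coprod 0 α)).app (by omega) x)),
      (((derivation (C.E₀ P) (SMod.DegHom.coprod 0 α)).app (by omega) x,
        (biderivation (C.E₀ P) (α.coprod 0) (SMod.DegHom.coprod 0 α)).app (by omega) x),
        ((derivation (C.E₀ P) (SMod.DegHom.coprod 0 (C.infConv α α))).app (by omega) x,
        (biderivation (C.E₀ P) (α.coprod 0) (SMod.DegHom.coprod 0 (C.infConv α α))).app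
          (by omega) x))) := by
  induction x using Free.induction with
  | hgen x =>
    rw [hN]; simp; rfl
  | hone =>
    rw [N.map_one, (lift _).map_one]
    simp only [derivation_one, biderivation_one]
    rfl
  | hmap σ x ih =>
    rw [N.naturality, ih]
    simp only [SMod.DegHom.naturality]
    rw [(lift _).naturality]
    rfl
  | @hcomp _ _ _ p q r i e hh x y ih ih' =>
    have H1 : ∀ f : SMod.DegHom 1 (C.toSMod.prod C.toSMod) P.toSMod, _ := fun f =>
      derivation_comp (C.E₀ P) f i e hh (p' := p - 1) (q' := q - 1) (r' := r - 1) (by omega)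
        (by omega) (by omega) x y
    have H2 : ∀ f : SMod.DegHom (1 + 1) (C.toSMod.prod C.toSMod) P.toSMod, _ := fun f =>
      derivation_comp (C.E₀ P) f i e hh (p' := p - 1 - 1) (q' := q - 1 - 1) (r' := r - 1 - 1)
        (by omega) (by omega) (by omega) x y
    have H3 : ∀ f g : SMod.DegHom 1 (C.toSMod.prod C.toSMod) P.toSMod, _ := fun f g =>
      biderivation_comp (C.E₀ P) f g i e hh (p' := p - 1 - 1) (q' := q - 1 - 1) (r' := r - 1 - 1)
        (p₁ := p - 1) (p₂ := p - 1) (q₁ := q - 1) (q₂ := q - 1)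
        (by omega) (by omega) (by omega) (by omega) (by omega) (by omega) (by omega) x y
    have H4 : ∀ (f : SMod.DegHom 1 (C.toSMod.prod C.toSMod) P.toSMod)
        (g : SMod.DegHom (1 + 1) (C.toSMod.prod C.toSMod) P.toSMod), _ := fun f g =>
      biderivation_comp (C.E₀ P) f g i e hh (p' := p - 1 - 1 - 1) (q' := q - 1 - 1 - 1)
        (r' := r - 1 - 1 - 1) (p₁ := p - 1) (p₂ := p - 1 - 1) (q₁ := q - 1) (q₂ := q - 1 - 1)
        (by omega) (by omega) (by omega) (by omega) (by omega) (by omega) (by omega) x y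
    have s0 : (-1 : K) ^ (1 * p) * (-1 : K) ^ (1 * p) = 1 := by
      rw [neg_one_zpow_mul]; exact Even.neg_one_zpow ⟨1 * p, rfl⟩
    have s1 : (-1 : K) ^ (1 * (p - 1)) = - (-1 : K) ^ (1 * p) := by
      rw [one_mul, one_mul, zpow_sub_one₀ (by simp)]; simp
    have s2 : (-1 : K) ^ (1 * (p - 1 - 1)) = (-1 : K) ^ (1 * p) :=
      neg_one_zpow_congr ⟨-1, by ring⟩
    have s3 : (-1 : K) ^ ((1 + 1) * p) = 1 := Even.neg_one_zpow ⟨p, by ring⟩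
    rw [N.map_comp, ih, ih', (lift _).map_comp, H1, H1, H2, H3, H4]
    refine (triple_comp i e hh _ _ _ _ _ _ _ _ _ _ _ _ _ _ _ _).trans ?_
    refine Prod.ext (Prod.ext (Prod.ext ?_ ?_) (Prod.ext ?_ ?_))
      (Prod.ext (Prod.ext ?_ ?_) (Prod.ext ?_ ?_)) <;>
    (try simp only [s1, s2, s3, smul_add, smul_smul, s0, one_smul, neg_smul, smul_neg, neg_mul,
      neg_neg, one_mul ((-1 : K) ^ (1 * p))]) <;> (try abel)
  | hzero => simp only [map_zero]; rfl
  | hadd x y ih ih' => simp only [map_add, ih, ih']; rfl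
  | hsmul c x ih => simp only [map_smul, ih]; rfl

end Cooperad

namespace Operad
/-- The inclusion `P → P ⊕ P η`. -/
def dualIncl (k : ℤ) (P : Operad K) : Hom P (P.dual k) where
  app := LinearMap.inl K _ _
  naturality σ _ := Prod.ext rfl (map_zero (P.map σ)).symm
  map_one := rfl
  map_comp i e h x y := by
    refine Prod.ext rfl ?_
    change 0 = P.comp i e _ 0 y + (-1 : K) ^ _ • P.comp i e _ x 0
    simp
end Operad

namespace Cooperad
variable (C : Cooperad K) {P : Operad K}

theorem infConv_assoc (α : SMod.DegHom 1 C.toSMod P.toSMod) {n : ℕ} {i j : ℤ}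
    (h : i = j + (1 + 1 + 1)) (h' : i = j + (1 + (1 + 1))) (x : C n i) :
    (C.infConv (C.infConv α α) α).app h x = (C.infConv α (C.infConv α α)).app h' x := by
  obtain rfl : j = i - 1 - 1 - 1 := by omega
  let E := C.counitHom P
  let φ₁ : SMod.Hom C.toSMod (((P.dual 1).dual 1).dual 1).toSMod :=
    dualHom (dualHom (dualHom E α) 0) 0
  let φ₂ : SMod.Hom C.toSMod (((P.dual 1).dual 1).dual 1).toSMod :=
    dualHom (dualHom (dualHom E 0) (α.inclDual 1)) 0
  let φ₃ : SMod.Hom C.toSMod (((P.dual 1).dual 1).dual 1).toSMod :=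
    dualHom (dualHom (dualHom E 0) 0) ((α.inclDual 1).inclDual 1)
  let ψ := dualHom (dualHom (C.E₀ P) (α.coprod 0)) ((SMod.DegHom.coprod 0 α).inclDual 1)
  have hψ {n : ℕ} {i : ℤ} (y : C n i) : (lift ψ).app (C.decomp.app y) =
      ((E.app y, α.app (by omega) y), (α.app (by omega) y, (C.infConv α α).app (by omega) y)) := by
    refine Prod.ext ?_ (Prod.ext ?_ ?_)
    · rw [lift_dualHom₂_fst]
      refine Prod.ext ?_ ?_
      · rw [lift_dualHom_fst]
        exact C.lift_E₀ y
      · rw [lift_dualHom_snd]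
        exact C.derivation_left α _ y
    · rw [lift_dualHom₂_snd_fst]
      exact C.derivation_right α _ y
    · rfl
  have h12 {n : ℕ} {i : ℤ} (y : C n i) : (conv C.decomp φ₁ φ₂).app y =
      (((E.app y, α.app (by omega) y), (α.app (by omega) y, (C.infConv α α).app (by omega) y)),
        ((0, 0), (0, 0))) := by
    have : φ₁.coprod φ₂ = ψ.trans (dualIncl 1 _).toHom := SMod.Hom.ext' fun z => by
      refine Prod.ext (Prod.ext (Prod.ext ?_ ?_) (Prod.ext ?_ ?_))
        (Prod.ext (Prod.ext ?_ ?_) (Prod.ext ?_ ?_)) <;>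
      first | rfl | exact add_zero _
    change (lift (φ₁.coprod φ₂)).app _ = _
    rw [this, ← Free.app_lift, hψ]
    rfl
  have h23 {n : ℕ} {i : ℤ} (y : C n i) : (conv C.decomp φ₂ φ₃).app y =
      (((E.app y, 0), (α.app (by omega) y, 0)),
        ((α.app (by omega) y, 0), ((C.infConv α α).app (by omega) y, 0))) := by
    have : φ₂.coprod φ₃ = ψ.trans (((dualIncl 1 P).mapDual 1).mapDual 1).toHom :=
        SMod.Hom.ext' fun z => by
      refine Prod.ext (Prod.ext (Prod.ext ?_ ?_) (Prod.ext ?_ ?_))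
        (Prod.ext (Prod.ext ?_ ?_) (Prod.ext ?_ ?_)) <;>
      first | rfl | exact add_zero _
    change (lift (φ₂.coprod φ₃)).app _ = _
    rw [this, ← Free.app_lift, hψ]
    rfl
  have key := congrArg (fun φ => SMod.Hom.app φ x) (C.conv_assoc φ₁ φ₂ φ₃)
  have hl := C.assoc_left α (lift ((conv C.decomp φ₁ φ₂).coprod φ₃)) (fun y => by
    rw [lift_gen]
    change (conv C.decomp φ₁ φ₂).app y.1 + φ₃.app y.2 = _
    rw [h12]
    refine Prod.ext (Prod.ext (Prod.ext ?_ ?_) (Prod.ext ?_ ?_))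
        (Prod.ext (Prod.ext ?_ ?_) (Prod.ext ?_ ?_)) <;>
      first | rfl | exact add_zero _ | exact zero_add _) (C.decomp.app x)
  have hr := C.assoc_right α (lift (φ₁.coprod (conv C.decomp φ₂ φ₃))) (fun y => by
    rw [lift_gen]
    change φ₁.app y.1 + (conv C.decomp φ₂ φ₃).app y.2 = _
    rw [h23]
    refine Prod.ext (Prod.ext (Prod.ext ?_ ?_) (Prod.ext ?_ ?_))
        (Prod.ext (Prod.ext ?_ ?_) (Prod.ext ?_ ?_)) <;>
      first | rfl | exact add_zero _ | exact zero_add _) (C.decomp.app x)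
  exact congrArg (fun t => t.2.2.2) (hl.symm.trans (key.trans hr))

end Cooperad

namespace CurvedCooperad
variable (C : CurvedCooperad K) {P : Operad K}

theorem counitHom_d {n : ℕ} {i j : ℤ} (h : i = j + 1) (x : C n i) :
    (C.counitHom P).app (C.d.app h x) = 0 := by
  let G := C.d.comp (C.counitHom P)
  have h1 : (C.counitHom P).app (C.d.app h x) =
      (derivation (C.E₀ P) (G.coprod G)).app h (C.decomp.app x) := by
    rw [← C.lift_E₀, C.decomp_d]
    exact Free.lift_derivation (gen _) (C.E₀ P) (SMod.Hom.ext' fun _ => rfl) _ _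
      (fun _ _ => rfl) h _
  have h2 := Free.derivation_sub (C.E₀ P) (f := SMod.DegHom.coprod 0 G) (f₁ := G.coprod G)
    (f₂ := G.coprod 0) (fun h x => by simp) h (C.decomp.app x)
  rw [C.derivation_left, C.derivation_right, ← h1] at h2
  change (C.counitHom P).app (C.d.app h x) = _ - (C.counitHom P).app (C.d.app h x) at h2
  rwa [sub_self] at h2

end CurvedCooperad

theorem SMod.cast_cast (V : SMod K) {n : ℕ} {i j k : ℤ} (h : i = j) (h' : j = k) (x : V n i) :
    V.cast h' (V.cast h x) = V.cast (h.trans h') x := by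
  subst h h'; rfl

theorem SMod.extend_cast (V : SMod K) {k : ℤ} (f : V 1 k →ₗ[K] K) {n : ℕ} {i j : ℤ} (h : i = j)
    (x : V n i) : V.extend k f n j (V.cast h x) = V.extend k f n i x := by
  subst h; rfl

theorem SMod.DegHom.app_cast {k : ℤ} {V W : SMod K} (f : DegHom k V W) {n : ℕ} {i i' j : ℤ}
    (h : i = i') (h' : i' = j + k) (x : V n i) :
    f.app h' (V.cast h x) = f.app (h.trans h') x := by
  subst h; rfl

theorem SMod.extend_self (V : SMod K) {k : ℤ} (f : V 1 k →ₗ[K] K) (x : V 1 k) :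
    V.extend k f 1 k x = f x := by
  rw [extend, dif_pos ⟨rfl, rfl⟩]

theorem SMod.extend_of_not (V : SMod K) {k : ℤ} (f : V 1 k →ₗ[K] K) {n : ℕ} {i : ℤ}
    (h : ¬(n = 1 ∧ i = k)) (x : V n i) : V.extend k f n i x = 0 := by
  simp [extend, h]

theorem SMod.elemAt_of_not (V : SMod K) (x : V 1 0) {n : ℕ} {i : ℤ} (h : ¬(n = 1 ∧ i = 0)) :
    V.elemAt x n i = 0 := by
  simp [elemAt, h]

namespace CoaugCooperad
variable (C : CoaugCooperad K)

/-- The projection of `C` onto the kernel `C̄` of the counit, along the coaugmentation. -/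
def proj : SMod.Hom C.toSMod C.toSMod where
  app {n i} := LinearMap.id - (C.extend 0 C.counit n i).smulRight (C.elemAt C.coaug n i)
  naturality σ x := by simp [SMod.extend_map, SMod.map_elemAt]

theorem proj_app {n : ℕ} {i : ℤ} (x : C n i) :
    C.proj.app x = x - C.extend 0 C.counit n i x • C.elemAt C.coaug n i := rfl

theorem counit_proj {n : ℕ} {i : ℤ} (x : C n i) :
    C.extend 0 C.counit n i (C.proj.app x) = 0 := by
  by_cases h : n = 1 ∧ i = 0
  · obtain ⟨rfl, rfl⟩ := h
    simp [proj_app, SMod.extend_self, SMod.elemAt_one, C.counit_coaug]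
  · rw [SMod.extend_of_not _ _ h]

/-- The desuspension `s⁻¹ C̄` of the kernel of the counit: `(s⁻¹ C̄)_j = C̄_{j+1}`. -/
def desusp : SMod K where
  obj n j := LinearMap.ker (C.extend 0 C.counit n (j + 1))
  map σ := (C.map σ).restrict fun x hx => by
    rw [LinearMap.mem_ker, SMod.extend_map]
    exact hx
  map_refl x := Subtype.ext (C.map_refl x.1)
  map_trans σ τ x := Subtype.ext (C.map_trans σ τ x.1)

/-- The map `C → C̄ → s⁻¹ C̄` of degree `-1`. -/
def sInv : SMod.DegHom 1 C.toSMod C.desusp where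
  app h := (C.proj.app ∘ₗ C.cast h).codRestrict _ fun x => C.counit_proj _
  naturality h σ x := Subtype.ext (by
    change C.proj.app (C.cast h (C.map σ x)) = C.map σ (C.proj.app (C.cast h x))
    rw [SMod.map_cast, C.proj.naturality])

/-- The map `α : C → C̄ → s⁻¹ C̄ → 𝕋 (s⁻¹ C̄)` of degree `-1`. -/
def twist : SMod.DegHom 1 C.toSMod (free C.desusp).toSMod := C.sInv.comp (gen _)

theorem sInv_coe {n : ℕ} {i : ℤ} (x : C.desusp n i) : C.sInv.app rfl x.1 = x := by
  refine Subtype.ext ?_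
  change C.proj.app x.1 = x.1
  rw [proj_app, show C.extend 0 C.counit n (i + 1) x.1 = 0 from x.2, zero_smul, sub_zero]

theorem twist_coe {n : ℕ} {i : ℤ} (x : C.desusp n i) :
    C.twist.app rfl x.1 = (gen _).app x := congrArg (gen _).app (C.sInv_coe x)

end CoaugCooperad

namespace CurvedCooperad
variable (C : CurvedCooperad K)

/-- The map `x ↦ θ(x) 1 - s⁻¹ d x - ∑ (-1)^{|x₁|} s⁻¹ x₁ ⊗ s⁻¹ x₂` from `C` to `𝕋 (s⁻¹ C̄)`. -/
def cobarFun : SMod.DegHom 2 C.toSMod (free C.desusp).toSMod where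
  app {n i j} h := (scalar C.curv (free C.desusp)).app h -
    C.twist.app (by omega : i - 1 = j + 1) ∘ₗ C.d.app (by omega : i = i - 1 + 1) -
    (C.infConv C.twist C.twist).app (by omega)
  naturality h σ x := by
    simp [SMod.DegHom.naturality]

/-- The map `s⁻¹ x ↦ θ(x) 1 - s⁻¹ d x - ∑ (-1)^{|x₁|} s⁻¹ x₁ ⊗ s⁻¹ x₂` from `s⁻¹ C̄` to
`𝕋 (s⁻¹ C̄)`. -/
def cobarGen : SMod.DegHom 1 C.desusp (free C.desusp).toSMod where
  app h := C.cobarFun.app (by omega) ∘ₗ Submodule.subtype _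
  naturality h σ x := C.cobarFun.naturality _ σ x.1

/-- The derivation of `𝕋 (s⁻¹ C̄)` that extends `cobarGen`. -/
def cobarDiff : SMod.DegHom 1 (free C.desusp).toSMod (free C.desusp).toSMod :=
  derivation (gen _) C.cobarGen

theorem cobarFun_app {n : ℕ} {i j s : ℤ} (h : i = s + 2) (h' : i = j + 1) (x : C n i) :
    C.cobarFun.app h x = (scalar C.curv (free C.desusp)).app h x -
      C.twist.app (by omega) (C.d.app h' x) - (C.infConv C.twist C.twist).app (by omega) x := by
  obtain rfl : j = i - 1 := by omega
  rfl

theorem cobarFun_coaug {i j : ℤ} (h : i = j + 2) {n : ℕ} :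
    C.cobarFun.app h (C.elemAt C.coaug n i) = 0 := by
  by_cases hn : n = 1 ∧ i = 0
  · obtain ⟨rfl, rfl⟩ := hn
    obtain rfl : j = -2 := by omega
    have ht : ∀ {s : ℤ} (h : 0 = s + 1), C.twist.app h C.coaug = 0 := fun {s} h => by
      obtain rfl : s = -1 := by omega
      have : C.sInv.app h C.coaug = 0 := Subtype.ext (by
        change C.proj.app C.coaug = 0
        rw [CoaugCooperad.proj_app, SMod.extend_self, SMod.elemAt_one, C.counit_coaug, one_smul,
          sub_self])
      exact (congrArg (gen _).app this).trans (map_zero _)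
    rw [cobarFun_app C h (by norm_num : (0 : ℤ) = -1 + 1), SMod.elemAt_one, C.d_coaug, map_zero,
      scalar_app, SMod.extend_of_not _ _ (by simp), zero_smul]
    let e : Slot 1 1 1 0 := Fintype.equivOfCardEq (by simp)
    have : (C.infConv C.twist C.twist).app (by norm_num : (0 : ℤ) = -2 + (1 + 1)) C.coaug = 0 := by
      change (biderivation (C.E₀ (free C.desusp)) (C.twist.coprod 0)
        (SMod.DegHom.coprod 0 C.twist)).app (by norm_num : (0 : ℤ) = -2 + (1 + 1))
        (C.decomp.app C.coaug) = 0
      rw [C.decomp_coaug (0 : Fin 1) e, biderivation_comp _ _ _ (0 : Fin 1) e _ (p' := -2) (q' := -2) (p₁ := -1)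
        (q₁ := -1) (p₂ := -1) (q₂ := -1) (by norm_num) (by norm_num) _ (by norm_num) (by norm_num)
        (by norm_num) (by norm_num)]
      have a1 := (derivation_gen (C.E₀ (free C.desusp)) (SMod.DegHom.coprod 0 C.twist)
        (by norm_num : (0 : ℤ) = -1 + 1) ((SMod.Hom.inl C.toSMod C.toSMod).app C.coaug)).trans
        ((zero_add _).trans (map_zero (C.twist.app (by norm_num : (0 : ℤ) = -1 + 1))))
      have a2 := (derivation_gen (C.E₀ (free C.desusp)) (C.twist.coprod 0)
        (by norm_num : (0 : ℤ) = -1 + 1) ((SMod.Hom.inl C.toSMod C.toSMod).app C.coaug)).trans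
        ((add_zero _).trans (ht _))
      have a3 := fun z : C.toSMod.prod C.toSMod 1 0 =>
        biderivation_gen (C.E₀ (free C.desusp)) (C.twist.coprod 0) (SMod.DegHom.coprod 0 C.twist)
        (by norm_num : (0 : ℤ) = -2 + (1 + 1)) z
      rw [a1, a2, a3, a3]
      simp
    simpa using this
  · rw [SMod.elemAt_of_not _ _ hn, map_zero]

theorem cobarDiff_twist {n : ℕ} {i j s : ℤ} (h : i = j + 1) (h' : j = s + 1) (x : C n i) :
    C.cobarDiff.app h' (C.twist.app h x) = C.cobarFun.app (by omega) x := by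
  subst h
  change (derivation _ _).app h' ((gen _).app (C.sInv.app rfl x)) = _
  rw [derivation_gen]
  change C.cobarFun.app _ (C.proj.app x) = _
  rw [CoaugCooperad.proj_app, map_sub, map_smul, cobarFun_coaug, smul_zero, sub_zero]

end CurvedCooperad

theorem Free.derivation_oneAt {V : SMod K} {P : Operad K} {k : ℤ} (E : SMod.Hom V P.toSMod)
    (f : SMod.DegHom k V P.toSMod) {n : ℕ} {i j : ℤ} (h : i = j + k) :
    (derivation E f).app h ((free V).oneAt n i) = 0 := by
  by_cases hn : n = 1 ∧ i = 0
  · obtain ⟨rfl, rfl⟩ := hn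
    rw [oneAt_one, derivation_one]
  · rw [oneAt_of_not _ hn, map_zero]

theorem Free.derivation_sq {V : SMod K} (f : SMod.DegHom 1 V (free V).toSMod)
    (hf : ∀ {n : ℕ} {i j k : ℤ} (h : i = j + 1) (h' : j = k + 1) (x : V n i),
      (derivation (gen V) f).app h' (f.app h x) = 0)
    {n : ℕ} {i j k : ℤ} (h : i = j + 1) (h' : j = k + 1) (x : free V n i) :
    (derivation (gen V) f).app h' ((derivation (gen V) f).app h x) = 0 := by
  induction x using Free.induction generalizing j k with
  | hgen x => rw [derivation_gen, hf]
  | hone => rw [derivation_one, map_zero]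
  | hmap σ x ih => rw [SMod.DegHom.naturality, SMod.DegHom.naturality, ih, map_zero]
  | @hcomp _ _ _ p q r i e hh x y ih ih' =>
    rw [derivation_comp _ f i e hh (p' := p - 1) (q' := q - 1) (by omega) (by omega) h,
      map_add, map_smul,
      derivation_comp _ f i e (p' := p - 1 - 1) (q' := q - 1) _ (by omega) (by omega) h',
      derivation_comp _ f i e (p' := p - 1) (q' := q - 1 - 1) _ (by omega) (by omega) h',
      ih, ih']
    simp only [lift_gen_id]
    have s1 : (-1 : K) ^ (1 * (p - 1)) = - (-1 : K) ^ (1 * p) := by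
      rw [one_mul, one_mul, zpow_sub_one₀ (by simp)]; simp
    rw [s1]
    simp
  | hzero => simp
  | hadd x y ih ih' => simp [ih, ih']
  | hsmul c x ih => simp [ih]

/-- A degree `-k` map is a degree `-l` map when `k = l`. -/
def SMod.DegHom.reindex {k l : ℤ} {V W : SMod K} (f : DegHom k V W) (h : k = l) :
    DegHom l V W where
  app h' := f.app (by omega)
  naturality _ := f.naturality _

namespace Cooperad
variable (C : Cooperad K) {P : Operad K} {k l m : ℤ}

theorem infConv_reindex_left (f : SMod.DegHom k C.toSMod P.toSMod) (h : k = m)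
    (g : SMod.DegHom l C.toSMod P.toSMod) {n : ℕ} {i j : ℤ} (h' : i = j + (m + l)) (x : C n i) :
    (C.infConv (f.reindex h) g).app h' x = (C.infConv f g).app (by omega) x := by
  subst h; rfl

theorem infConv_reindex_right (f : SMod.DegHom k C.toSMod P.toSMod)
    (g : SMod.DegHom l C.toSMod P.toSMod) (h : l = m)
    {n : ℕ} {i j : ℤ} (h' : i = j + (k + m)) (x : C n i) :
    (C.infConv f (g.reindex h)).app h' x = (C.infConv f g).app (by omega) x := by
  subst h; rfl

theorem infConv_zero_left (g : SMod.DegHom l C.toSMod P.toSMod) {n : ℕ} {i j : ℤ}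
    (h' : i = j + (k + l)) (x : C n i) :
    (C.infConv (0 : SMod.DegHom k C.toSMod P.toSMod) g).app h' x = 0 := by
  rw [C.infConv_sub_left (f := 0) (f₁ := 0) (f₂ := 0) g (fun _ _ => by simp), sub_self]

theorem infConv_zero_right (f : SMod.DegHom k C.toSMod P.toSMod) {n : ℕ} {i j : ℤ}
    (h' : i = j + (k + l)) (x : C n i) :
    (C.infConv f (0 : SMod.DegHom l C.toSMod P.toSMod)).app h' x = 0 := by
  rw [C.infConv_sub_right (g := 0) (g₁ := 0) (g₂ := 0) f (fun _ _ => by simp), sub_self]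

theorem E₀_app {n : ℕ} {i : ℤ} (x : C.toSMod.prod C.toSMod n i) :
    (C.E₀ P).app x = (C.counitHom P).app x.1 + (C.counitHom P).app x.2 := rfl

theorem counitHom_trans {Q : Operad K} (F : Hom P Q) {n : ℕ} {i : ℤ} (x : C n i) :
    F.app ((C.counitHom P).app x) = (C.counitHom Q).app x :=
  congrArg (fun φ => SMod.Hom.app φ x) (scalarHom_trans C.counit F)

theorem E₀_trans {Q : Operad K} (F : Hom P Q) : (C.E₀ P).trans F.toHom = C.E₀ Q :=
  SMod.Hom.ext' fun x => by
    change F.app ((C.E₀ P).app x) = _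
    rw [E₀_app, map_add, counitHom_trans, counitHom_trans, E₀_app]

theorem derivation_E₀ {V : SMod K} (E : SMod.Hom V P.toSMod)
    (f : SMod.DegHom k V P.toSMod) {n : ℕ} {i j : ℤ} (h : i = j + k)
    (x : C.toSMod.prod C.toSMod n i) :
    (derivation E f).app h ((C.E₀ (free V)).app x) = 0 := by
  have : ∀ y : C n i, (derivation E f).app h ((C.counitHom (free V)).app y) = 0 := fun y => by
    rw [Cooperad.counitHom, scalarHom_app, map_smul, derivation_oneAt, smul_zero]
  rw [E₀_app, map_add, this, this, add_zero]

/-- A derivation of degree `-1` of a free operad applied to an infinitesimal convolution. -/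
theorem derivation_infConv {V : SMod K} (F : SMod.Hom V P.toSMod) (D : SMod.DegHom 1 V P.toSMod)
    (f : SMod.DegHom k C.toSMod (free V).toSMod) (f' : SMod.DegHom k C.toSMod P.toSMod)
    (hf : ∀ {n : ℕ} {i j : ℤ} (h : i = j + k) (x : C n i), (lift F).app (f.app h x) = f'.app h x)
    (g : SMod.DegHom l C.toSMod (free V).toSMod) (g' : SMod.DegHom l C.toSMod P.toSMod)
    (hg : ∀ {n : ℕ} {i j : ℤ} (h : i = j + l) (x : C n i), (lift F).app (g.app h x) = g'.app h x)
    (f₁ : SMod.DegHom (k + 1) C.toSMod P.toSMod)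
    (hf₁ : ∀ {n : ℕ} {i j s : ℤ} (h : i = j + k) (h' : j = s + 1) (x : C n i),
      (derivation F D).app h' (f.app h x) = f₁.app (by omega) x)
    (g₁ : SMod.DegHom (l + 1) C.toSMod P.toSMod)
    (hg₁ : ∀ {n : ℕ} {i j s : ℤ} (h : i = j + l) (h' : j = s + 1) (x : C n i),
      (derivation F D).app h' (g.app h x) = g₁.app (by omega) x)
    {n : ℕ} {i j s : ℤ} (h : i = j + (k + l)) (h' : j = s + 1) (x : C n i) :
    (derivation F D).app h' ((C.infConv f g).app h x) =
      (C.infConv f₁ g').app (by omega) x +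
        (-1 : K) ^ k • (C.infConv f' g₁).app (by omega) x := by
  refine derivation_biderivation (C.E₀ (free V)) F
      (C.E₀_trans _) D (C.derivation_E₀ _ _)
      (f.coprod 0) (f'.coprod 0) ?_ (SMod.DegHom.coprod 0 g) (SMod.DegHom.coprod 0 g') ?_
      (f₁.coprod 0) ?_ (SMod.DegHom.coprod 0 g₁) ?_ h h' _ <;> intros <;>
    simp [hf, hg, hf₁, hg₁]

end Cooperad

namespace CurvedCooperad
variable (C : CurvedCooperad K)

/-- The map `α d`. -/
def twistD : SMod.DegHom (1 + 1) C.toSMod (free C.desusp).toSMod where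
  app {n i j} h := C.twist.app (by omega : i - 1 = j + 1) ∘ₗ C.d.app (by omega : i = i - 1 + 1)
  naturality h σ x := by simp [SMod.DegHom.naturality]

theorem twistD_app {n : ℕ} {i j s : ℤ} (h : i = s + (1 + 1)) (h' : i = j + 1) (x : C n i) :
    C.twistD.app h x = C.twist.app (by omega) (C.d.app h' x) := by
  obtain rfl : j = i - 1 := by omega
  rfl

/-- The curvature equation, transported along a degree `-1` map. -/
theorem twist_d_d {n : ℕ} {i j k s : ℤ} (h : i = j + 1) (h' : j = k + 1) (h'' : k = s + 1)
    (x : C n i) : C.twist.app h'' (C.d.app h' (C.d.app h x)) =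
      (C.infConv (scalar C.curv (free C.desusp)) C.twist).app (by omega) x -
      (C.infConv C.twist (scalar C.curv (free C.desusp))).app (by omega) x := by
  have h1 := congrArg ((derivation (C.counitHom (free C.desusp)) C.twist).app h'') (C.d_d h h' x)
  rw [derivation_gen] at h1
  have e1 : ∀ {n : ℕ} {i j : ℤ} (h : i = j + 2) (x : C n i),
      (lift (C.counitHom (free C.desusp))).app ((scalar C.curv (free C.toSMod)).app h x) =
        (scalar C.curv (free C.desusp)).app h x := fun h x => by
    rw [scalar_app, scalar_app, map_smul, Hom.map_oneAt]
  have e2 : ∀ {n : ℕ} {i j s : ℤ} (h : i = j + 2) (h' : j = s + 1) (x : C n i),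
      (derivation (C.counitHom (free C.desusp)) C.twist).app h'
        ((scalar C.curv (free C.toSMod)).app h x) = 0 := fun h h' x => by
    rw [scalar_app, map_smul, derivation_oneAt, smul_zero]
  have e3 : ∀ {n : ℕ} {i j : ℤ} (h : i = j + 0) (x : C n i),
      (lift (C.counitHom (free C.desusp))).app ((gen C.toSMod).toDeg.app h x) =
        (C.counitHom (free C.desusp)).toDeg.app h x := fun h x => rfl
  have e4 : ∀ {n : ℕ} {i j s : ℤ} (h : i = j + 0) (h' : j = s + 1) (x : C n i),
      (derivation (C.counitHom (free C.desusp)) C.twist).app h'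
        ((gen C.toSMod).toDeg.app h x) = (C.twist.reindex (zero_add 1).symm).app (by omega) x :=
      fun h h' x => by
    obtain rfl := h.trans (add_zero _)
    exact derivation_gen _ _ _ _
  rw [h1, map_sub,
    C.derivation_infConv _ _ _ _ e1 _ _ e3 0 (fun h h' x => e2 h h' x) _ e4,
    C.derivation_infConv _ _ _ _ e3 _ _ e1 _ e4 0 (fun h h' x => e2 h h' x)]
  rw [C.infConv_zero_left, C.infConv_zero_right, C.infConv_reindex_right, C.infConv_reindex_left]
  simp

theorem twist_infConv_d {n : ℕ} {i j s : ℤ} (h : i = j + 1) (h' : j = s + (1 + 1)) (x : C n i) :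
    (C.infConv C.twist C.twist).app h' (C.d.app h x) =
      (C.infConv C.twist C.twistD).app (by omega) x -
      (C.infConv C.twistD C.twist).app (by omega) x := by
  change (biderivation _ _ _).app h' (C.decomp.app (C.d.app h x)) = _
  rw [C.decomp_d]
  refine (biderivation_derivation_gen (C.d.prodMap C.d) (C.E₀ (free C.desusp)) ?_
    _ (C.twistD.coprod 0) ?_ _ (SMod.DegHom.coprod 0 C.twistD) ?_ h h' _).trans ?_
  · intro n i j h x
    exact (congrArg₂ (· + ·) (C.counitHom_d (P := free C.desusp) h x.1) (C.counitHom_d h x.2)).trans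
      (add_zero (0 : free C.desusp n j))
  · intro n i j s h h' x
    change C.twist.app h' (C.d.app h x.1) + 0 = C.twistD.app (by omega) x.1 + 0
    rw [C.twistD_app]
  · intro n i j s h h' x
    change 0 + C.twist.app h' (C.d.app h x.2) = 0 + C.twistD.app (by omega) x.2
    rw [C.twistD_app]
  · rw [zpow_one, neg_smul, one_smul, neg_add_eq_sub]
    rfl

theorem scalar_d {P : Operad K} {n : ℕ} {i j s : ℤ} (h : i = j + 1) (h' : j = s + 2) (x : C n i) :
    (scalar C.curv P).app h' (C.d.app h x) = 0 := by
  rw [scalar_app]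
  by_cases hn : n = 1 ∧ j = 2
  · obtain ⟨rfl, rfl⟩ := hn
    obtain rfl : i = 3 := by omega
    rw [SMod.extend_self, C.curv_d, zero_smul]
  · rw [SMod.extend_of_not _ _ hn, zero_smul]

theorem cobarDiff_infConv {n : ℕ} {i j s : ℤ} (h : i = j + (1 + 1)) (h' : j = s + 1) (x : C n i) :
    C.cobarDiff.app h' ((C.infConv C.twist C.twist).app h x) =
      ((C.infConv (scalar C.curv (free C.desusp)) C.twist).app (by omega) x -
      (C.infConv C.twistD C.twist).app (by omega) x) -
      ((C.infConv C.twist (scalar C.curv (free C.desusp))).app (by omega) x -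
      (C.infConv C.twist C.twistD).app (by omega) x) := by
  let θ : SMod.DegHom (1 + 1) C.toSMod (free C.desusp).toSMod :=
    (scalar C.curv (free C.desusp)).reindex (by norm_num)
  let q := C.infConv C.twist C.twist
  let A : SMod.DegHom (1 + 1) C.toSMod (free C.desusp).toSMod :=
    ⟨fun h => θ.app h - C.twistD.app h, fun h σ x => by
      simp only [LinearMap.sub_apply, SMod.DegHom.naturality, map_sub]⟩
  let B : SMod.DegHom (1 + 1) C.toSMod (free C.desusp).toSMod :=
    ⟨fun h => A.app h - q.app h, fun h σ x => by
      simp only [LinearMap.sub_apply, SMod.DegHom.naturality, map_sub]⟩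
  have hB : ∀ {n : ℕ} {i j s : ℤ} (h : i = j + 1) (h' : j = s + 1) (x : C n i),
      (derivation (gen _) C.cobarGen).app h' (C.twist.app h x) = B.app (by omega) x :=
    fun h h' x => by
      refine (C.cobarDiff_twist h h' x).trans ?_
      rw [C.cobarFun_app _ h]
      change _ = (θ.app _ x - C.twistD.app _ x) - q.app _ x
      rw [C.twistD_app _ h]
      rfl
  refine (C.derivation_infConv _ _ C.twist C.twist (fun _ _ => lift_gen_id _) C.twist C.twist
    (fun _ _ => lift_gen_id _) B hB B hB h h' x).trans ?_
  rw [C.infConv_sub_left _ (fun h x => (rfl : B.app h x = A.app h x - q.app h x)),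
    C.infConv_sub_left _ (fun h x => (rfl : A.app h x = θ.app h x - C.twistD.app h x)),
    C.infConv_sub_right _ (fun h x => (rfl : B.app h x = A.app h x - q.app h x)),
    C.infConv_sub_right _ (fun h x => (rfl : A.app h x = θ.app h x - C.twistD.app h x)),
    C.infConv_assoc C.twist (by omega) (by omega) x, C.infConv_reindex_left,
    C.infConv_reindex_right, zpow_one, neg_smul, one_smul]
  abel

theorem cobarDiff_cobarFun {n : ℕ} {i j k : ℤ} (h : i = j + 2) (h' : j = k + 1) (x : C n i) :
    C.cobarDiff.app h' (C.cobarFun.app h x) = 0 := by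
  have h1 : i = i - 1 + 1 := by omega
  have h2 : i - 1 = i - 1 - 1 + 1 := by omega
  rw [cobarFun_app C h h1, map_sub, map_sub, C.cobarDiff_infConv, C.cobarDiff_twist,
    cobarFun_app C _ h2, C.twist_d_d, C.twist_infConv_d, C.scalar_d, scalar_app, map_smul]
  have : C.cobarDiff.app h' ((free C.desusp).oneAt n j) = 0 := derivation_oneAt _ _ _
  rw [this]
  simp only [smul_zero]
  abel

theorem cobarDiff_comp {m b n : ℕ} {p q r p' q' r' : ℤ} (i : Fin m) (e : Slot m b n i)
    (h : p + q = r) (hp : p = p' + 1) (hq : q = q' + 1) (hr : r = r' + 1)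
    (x : free C.desusp m p) (y : free C.desusp b q) :
    C.cobarDiff.app hr ((free C.desusp).comp i e h x y) =
      (free C.desusp).comp i e (by omega) (C.cobarDiff.app hp x) y +
      (-1 : K) ^ p • (free C.desusp).comp i e (by omega) x (C.cobarDiff.app hq y) := by
  have := derivation_comp (gen _) C.cobarGen i e h hp hq hr x y
  rwa [lift_gen_id, lift_gen_id, one_mul] at this

end CurvedCooperad

/-- The cobar construction `Ω_u C = 𝕋 (s⁻¹ C̄)`, with the derivation
`s⁻¹ x ↦ θ(x) 1 - s⁻¹ d x - ∑ (-1)^{|x₁|} s⁻¹ x₁ ⊗ s⁻¹ x₂`. -/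
def cobar (C : CurvedCooperad K) : DGOperad K where
  toOperad := free C.desusp
  d := C.cobarDiff
  d_d h h' x := derivation_sq C.cobarGen (fun _ h' x => C.cobarDiff_cobarFun _ h' x.1) h h' x
  leibniz := C.cobarDiff_comp

section
variable {V W : SMod K} {P Q : Operad K} {k l : ℤ}

/-- An operad morphism commutes with biderivations. -/
theorem Free.app_biderivation (F : Hom P Q) (E : SMod.Hom V P.toSMod) (E' : SMod.Hom V Q.toSMod)
    (hE : ∀ {n : ℕ} {i : ℤ} (x : V n i), F.app (E.app x) = E'.app x)
    (f : SMod.DegHom k V P.toSMod) (f' : SMod.DegHom k V Q.toSMod)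
    (hf : ∀ {n : ℕ} {i j : ℤ} (h : i = j + k) (x : V n i), F.app (f.app h x) = f'.app h x)
    (g : SMod.DegHom l V P.toSMod) (g' : SMod.DegHom l V Q.toSMod)
    (hg : ∀ {n : ℕ} {i j : ℤ} (h : i = j + l) (x : V n i), F.app (g.app h x) = g'.app h x)
    {n : ℕ} {i j : ℤ} (h : i = j + (k + l)) (x : free V n i) :
    F.app ((biderivation E f g).app h x) = (biderivation E' f' g').app h x := by
  obtain rfl : j = i - l - k := by omega
  rw [← lift_dualHom₂_snd_snd, ← lift_dualHom₂_snd_snd]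
  have : (dualHom (dualHom E f) (g.inclDual k)).trans ((F.mapDual k).mapDual l).toHom =
      dualHom (dualHom E' f') (g'.inclDual k) := SMod.Hom.ext' fun x =>
    Prod.ext (Prod.ext (hE x) (hf _ x)) (Prod.ext (hg _ x) (map_zero F.app))
  rw [← this, ← Free.app_lift]
  rfl

/-- Biderivations and morphisms of generators. -/
theorem Free.biderivation_lift (φ : SMod.Hom V W) (E : SMod.Hom W P.toSMod) (E' : SMod.Hom V P.toSMod)
    (hE : ∀ {n : ℕ} {i : ℤ} (x : V n i), E.app (φ.app x) = E'.app x)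
    (f : SMod.DegHom k W P.toSMod) (g : SMod.DegHom l W P.toSMod)
    {n : ℕ} {i j : ℤ} (h : i = j + (k + l)) (x : free V n i) :
    (biderivation E f g).app h ((lift (φ.trans (gen W))).app x) =
      (biderivation E' (.precomp φ f) (.precomp φ g)).app h x := by
  obtain rfl : j = i - l - k := by omega
  rw [← lift_dualHom₂_snd_snd, ← lift_dualHom₂_snd_snd, Free.app_lift]
  have : (φ.trans (gen W)).trans (lift (dualHom (dualHom E f) (g.inclDual k))).toHom =
      dualHom (dualHom E' (.precomp φ f)) ((SMod.DegHom.precomp φ g).inclDual k) :=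
    SMod.Hom.ext' fun x => Prod.ext (Prod.ext (hE x) rfl) rfl
  rw [this]

end

namespace CurvedCooperad
variable {C D : CurvedCooperad K} (f : C.Hom D)

theorem Hom.extend_counit {n : ℕ} {i : ℤ} (x : C n i) :
    D.extend 0 D.counit n i (f.app x) = C.extend 0 C.counit n i x := by
  by_cases h : n = 1 ∧ i = 0
  · obtain ⟨rfl, rfl⟩ := h
    rw [SMod.extend_self, SMod.extend_self, f.map_counit]
  · rw [SMod.extend_of_not _ _ h, SMod.extend_of_not _ _ h]

theorem Hom.extend_curv {n : ℕ} {i : ℤ} (x : C n i) :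
    D.extend 2 D.curv n i (f.app x) = C.extend 2 C.curv n i x := by
  by_cases h : n = 1 ∧ i = 2
  · obtain ⟨rfl, rfl⟩ := h
    rw [SMod.extend_self, SMod.extend_self, f.map_curv]
  · rw [SMod.extend_of_not _ _ h, SMod.extend_of_not _ _ h]

theorem Hom.map_elemAt (n : ℕ) (i : ℤ) :
    f.app (C.elemAt C.coaug n i) = D.elemAt D.coaug n i := by
  by_cases h : n = 1 ∧ i = 0
  · obtain ⟨rfl, rfl⟩ := h
    rw [SMod.elemAt_one, SMod.elemAt_one, f.map_coaug]
  · rw [SMod.elemAt_of_not _ _ h, SMod.elemAt_of_not _ _ h, map_zero]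

/-- The morphism `s⁻¹ C̄ → s⁻¹ D̄` induced by `f`. -/
def Hom.desusp : SMod.Hom C.desusp D.desusp where
  app := f.app.restrict fun x hx => by
    rw [LinearMap.mem_ker, f.extend_counit]
    exact hx
  naturality σ x := Subtype.ext (f.naturality σ x.1)

/-- The morphism `𝕋 (s⁻¹ C̄) → 𝕋 (s⁻¹ D̄)` induced by `f`. -/
def Hom.cobarOperadHom : Operad.Hom (free C.desusp) (free D.desusp) :=
  lift (f.desusp.trans (gen _))

theorem Hom.cobar_twist {n : ℕ} {i j : ℤ} (h : i = j + 1) (x : C n i) :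
    f.cobarOperadHom.app (C.twist.app h x) = D.twist.app h (f.app x) := by
  subst h
  refine congrArg (gen D.desusp).app (Subtype.ext ?_)
  change f.app (C.proj.app x) = D.proj.app (f.app x)
  rw [CoaugCooperad.proj_app, CoaugCooperad.proj_app, map_sub, map_smul, f.extend_counit,
    f.map_elemAt]

theorem Hom.cobar_infConv {n : ℕ} {i j : ℤ} (h : i = j + (1 + 1)) (x : C n i) :
    f.cobarOperadHom.app ((C.infConv C.twist C.twist).app h x) =
      (D.infConv D.twist D.twist).app h (f.app x) := by
  have e1 : (C.infConv C.twist C.twist).app h x = (biderivation (C.E₀ (free C.desusp))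
    (C.twist.coprod 0) (SMod.DegHom.coprod 0 C.twist)).app h (C.decomp.app x) := rfl
  have e2 : (D.infConv D.twist D.twist).app h (f.app x) = (biderivation (D.E₀ (free D.desusp))
    (D.twist.coprod 0) (SMod.DegHom.coprod 0 D.twist)).app h (D.decomp.app (f.app x)) := rfl
  let A : SMod.DegHom 1 (C.toSMod.prod C.toSMod) (free D.desusp).toSMod :=
    .precomp (f.toHom.prodMap f.toHom) (D.twist.coprod 0)
  let B : SMod.DegHom 1 (C.toSMod.prod C.toSMod) (free D.desusp).toSMod :=
    .precomp (f.toHom.prodMap f.toHom) (SMod.DegHom.coprod 0 D.twist)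
  have hc : ∀ {n : ℕ} {i : ℤ} (y : C n i), (D.counitHom (free D.desusp)).app (f.app y) =
      (C.counitHom (free D.desusp)).app y := fun y => by
    rw [Cooperad.counitHom, Cooperad.counitHom, scalarHom_app, scalarHom_app, f.extend_counit]
  have h1 := biderivation_lift (f.toHom.prodMap f.toHom) (D.E₀ (free D.desusp))
    (C.E₀ (free D.desusp)) (fun x => congrArg₂ (· + ·) (hc x.1) (hc x.2)) (D.twist.coprod 0)
    (SMod.DegHom.coprod 0 D.twist) h (C.decomp.app x)
  have h2 := app_biderivation f.cobarOperadHom (C.E₀ (free C.desusp)) (C.E₀ (free D.desusp))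
    (fun x => congrArg (fun φ => SMod.Hom.app φ x) (C.E₀_trans f.cobarOperadHom))
    (C.twist.coprod 0) A
    (fun h x => by
      change f.cobarOperadHom.app (C.twist.app h x.1 + 0) = D.twist.app h (f.app x.1) + 0
      rw [add_zero, add_zero, f.cobar_twist])
    (SMod.DegHom.coprod 0 C.twist) B
    (fun h x => by
      change f.cobarOperadHom.app (0 + C.twist.app h x.2) = 0 + D.twist.app h (f.app x.2)
      rw [zero_add, zero_add, f.cobar_twist]) h (C.decomp.app x)
  rw [e1, e2, f.map_decomp, h1, h2]

theorem Hom.cobar_cobarFun {n : ℕ} {i j : ℤ} (h : i = j + 2) (x : C n i) :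
    f.cobarOperadHom.app (C.cobarFun.app h x) = D.cobarFun.app h (f.app x) := by
  have h1 : i = i - 1 + 1 := by omega
  rw [C.cobarFun_app h h1, D.cobarFun_app h h1, map_sub, map_sub, f.cobar_infConv, f.cobar_twist,
    f.map_d, scalar_app, scalar_app, map_smul, Operad.Hom.map_oneAt, f.extend_curv]

theorem Hom.cobar_diff {n : ℕ} {i j : ℤ} (h : i = j + 1) (x : free C.desusp n i) :
    f.cobarOperadHom.app (C.cobarDiff.app h x) = D.cobarDiff.app h (f.cobarOperadHom.app x) := by
  induction x using Free.induction generalizing j with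
  | hgen x =>
    change f.cobarOperadHom.app ((derivation (gen _) C.cobarGen).app h ((gen _).app x)) =
      (derivation (gen _) D.cobarGen).app h ((gen _).app (f.desusp.app x))
    rw [derivation_gen, derivation_gen]
    exact f.cobar_cobarFun _ x.1
  | hone =>
    rw [Operad.Hom.map_one]
    exact (congrArg _ (derivation_one _ _ _)).trans
      ((map_zero _).trans (derivation_one _ _ _).symm)
  | hmap σ x ih =>
    rw [SMod.DegHom.naturality, f.cobarOperadHom.naturality, ih, f.cobarOperadHom.naturality,
      SMod.DegHom.naturality]
  | @hcomp _ _ _ p q r i e hh x y ih ih' =>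
    rw [f.cobarOperadHom.map_comp,
      C.cobarDiff_comp i e hh (p' := p - 1) (q' := q - 1) (by omega) (by omega) h,
      D.cobarDiff_comp i e hh (p' := p - 1) (q' := q - 1) (by omega) (by omega) h,
      map_add, map_smul, f.cobarOperadHom.map_comp, f.cobarOperadHom.map_comp, ih, ih']
  | hzero => simp only [map_zero]
  | hadd x y ih ih' => simp only [map_add, ih, ih']
  | hsmul c x ih => simp only [map_smul, ih]

/-- The cobar construction on morphisms. -/
def Hom.cobarMap : DGOperad.Hom (cobar C) (cobar D) where
  toOperadHom := f.cobarOperadHom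
  map_d h x := f.cobar_diff h x

end CurvedCooperad

namespace CurvedConilpotentCooperad

/-- A morphism of curved conilpotent cooperads is a morphism of the underlying curved cooperads. -/
abbrev Hom (C D : CurvedConilpotentCooperad K) := CurvedCooperad.Hom C.toCurvedCooperad
  D.toCurvedCooperad

/-- The cofibrations of curved conilpotent cooperads are the morphisms whose image under the cobar
construction is a cofibration of dg operads. -/
def IsCofibration {C D : CurvedConilpotentCooperad K} (f : Hom C D) : Prop :=
  f.cobarMap.IsCofibration

end CurvedConilpotentCooperad

end OperadTheory

/-!
A cofibration `P → Q` of dg operads is always injective. Let `A` be the acyclic dg algebra spanned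
by `1` and by an element `η` of degree `1` with `dη = 1` and `η² = 0`. Then `P ⊗ A → 0` is an
acyclic fibration, so that the inclusion `P → P ⊗ A` extends to `Q`
(`DGOperad.Hom.IsCofibration.injective`). Since generators embed into a free operad
(`Free.gen_injective`, by mapping to a square-zero extension of the unit operad), a morphism `f`
of cooperads whose cobar construction is injective is injective on the kernels of the counits, and
these contain the kernel of `f`.

Conversely, let `f : C → D` be injective, and consider a lifting problem of `Ω f` against an
acyclic fibration `p : E → F`. In characteristic zero linear maps can be averaged over the
symmetric groups. This gives a filler `L : 𝕋 (s⁻¹ D̄) → E` that is a morphism of graded operads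
(`CurvedCooperad.exists_isFiller`), and an equivariant contracting homotopy `h` of the acyclic
complex `ker p` (`DGOperad.Hom.exists_homotopy`). The obstruction `o = d L - L d` is a derivation
along `L` with values in `ker p`, it vanishes on the image of `Ω C`, and `d o = - o d` because
`d² = 0`. Replace `L` by the morphism given by `L - h o` on generators. Suppose that `o` vanishes on
the desuspension of the part `F r` of the coradical filtration of `D`. For `x` in `F (r + 1)` the
quadratic part of `d (s⁻¹ x)` only involves `F r` (`CoaugCooperad.infConv_twist_mem`), so it is
neither seen by `o` nor changed by the replacement; up to it and to multiples of the unit,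
`d (s⁻¹ x)` is `- s⁻¹ (d x)`. Hence `d o (s⁻¹ x) = o (s⁻¹ (d x))`, and the new obstruction at `s⁻¹ x` is
`o (s⁻¹ x) - d h o (s⁻¹ x) - h o (s⁻¹ (d x)) = (1 - d h - h d) o (s⁻¹ x) = 0`
(`CurvedCooperad.SolvedUpTo.succ`). As `D` is conilpotent, iterating the replacement stabilises on
every element, and the limit is the desired filler of dg operads.
-/

namespace OperadTheory

open Free Operad

variable {K : Type u} [Field K]

/-! ### Generators of a free operad -/

/-- For `b = 1`, the numbering of the inputs of `x ∘ᵢ y`, read as a relabelling of those of `x`. -/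
def Slot.equivLeft {m n : ℕ} {i : Fin m} (e : Slot m 1 n i) : Fin m ≃ Fin n :=
  ((Equiv.sumCompl (· ≠ i)).symm.trans (Equiv.sumCongr (Equiv.refl _)
    (@Equiv.ofUnique _ _ ⟨⟨⟨i, not_not.2 rfl⟩⟩, fun j => Subtype.ext (not_not.1 j.2)⟩ _))).trans e

/-- For `m = 1`, the numbering of the inputs of `x ∘ᵢ y`, read as a relabelling of those of `y`. -/
def Slot.equivRight {b n : ℕ} {i : Fin 1} (e : Slot 1 b n i) : Fin b ≃ Fin n :=
  (@Equiv.emptySum {j : Fin 1 // j ≠ i} (Fin b) ⟨fun j => j.2 (Subsingleton.elim _ _)⟩).symm.trans e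

theorem Slot.equivLeft_self {m n : ℕ} {i : Fin m} (e : Slot m 1 n i) (k : Fin 1) :
    e.equivLeft i = e (.inr k) := by
  simp only [equivLeft, Equiv.trans_apply]
  rw [Equiv.sumCompl_symm_apply_of_neg (by simp)]
  exact congrArg (fun k => e (.inr k)) (Subsingleton.elim _ _)

theorem Slot.equivLeft_of_ne {m n : ℕ} {i : Fin m} (e : Slot m 1 n i) {j : Fin m} (hj : j ≠ i) :
    e.equivLeft j = e (.inl ⟨j, hj⟩) := by
  simp only [equivLeft, Equiv.trans_apply]
  rw [Equiv.sumCompl_symm_apply_of_pos (p := (· ≠ i)) hj]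
  rfl

theorem Slot.equivRight_apply {b n : ℕ} {i : Fin 1} (e : Slot 1 b n i) (k : Fin b) :
    e.equivRight k = e (.inr k) := rfl

namespace SMod
variable (V : SMod K)

/-- Relabelling, combined with transport along an equality of degrees. -/
def mapCast {m n : ℕ} {i j : ℤ} (σ : Fin m ≃ Fin n) (h : i = j) : V m i →ₗ[K] V n j :=
  V.cast h ∘ₗ V.map σ

theorem mapCast_rfl {m n : ℕ} {i : ℤ} (σ : Fin m ≃ Fin n) (x : V m i) :
    V.mapCast σ rfl x = V.map σ x := rfl

theorem mapCast_mapCast {l m n : ℕ} {i j k : ℤ} (σ : Fin l ≃ Fin m) (h : i = j)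
    (τ : Fin m ≃ Fin n) (h' : j = k) (x : V l i) :
    V.mapCast τ h' (V.mapCast σ h x) = V.mapCast (σ.trans τ) (h.trans h') x := by
  subst h h'
  exact (V.map_trans σ τ x).symm

/-- The action of a scalar operation `y` of arity `b` and degree `q` on `V` from the inside: zero
unless `b = 1` and `q = 0`. -/
def actLeft {m b n : ℕ} {p q r : ℤ} {i : Fin m} (e : Slot m b n i) (h : p + q = r) :
    V m p →ₗ[K] V n r :=
  if hb : b = 1 ∧ q = 0 then by
    obtain ⟨h₁, h₂⟩ := hb
    subst h₁ h₂
    exact V.mapCast e.equivLeft (by omega)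
  else 0

/-- The action of a scalar operation `x` of arity `m` and degree `p` on `V` from the outside: zero
unless `m = 1` and `p = 0`. -/
def actRight {m b n : ℕ} {p q r : ℤ} {i : Fin m} (e : Slot m b n i) (h : p + q = r) :
    V b q →ₗ[K] V n r :=
  if hm : m = 1 ∧ p = 0 then by
    obtain ⟨h₁, h₂⟩ := hm
    subst h₁ h₂
    exact V.mapCast e.equivRight (by omega)
  else 0

theorem actLeft_eq {m n : ℕ} {p r : ℤ} {i : Fin m} (e : Slot m 1 n i) (h : p + 0 = r) (x : V m p) :
    V.actLeft e h x = V.mapCast e.equivLeft (by omega) x := by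
  rw [actLeft, dif_pos ⟨rfl, rfl⟩]

theorem actRight_eq {b n : ℕ} {q r : ℤ} {i : Fin 1} (e : Slot 1 b n i) (h : 0 + q = r)
    (y : V b q) : V.actRight e h y = V.mapCast e.equivRight (by omega) y := by
  rw [actRight, dif_pos ⟨rfl, rfl⟩]

end SMod

/-- The values that the scalar part of an operation of arity `n` and degree `i` may take: all of `K`
for `n = 1` and `i = 0`, and only zero otherwise. -/
def scalarPart (K : Type u) [Field K] (n : ℕ) (i : ℤ) : Submodule K K where
  carrier := {c | c ≠ 0 → n = 1 ∧ i = 0}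
  add_mem' {c d} hc hd h := by
    by_contra hn
    exact h (by rw [not_not.1 (mt hc hn), not_not.1 (mt hd hn), add_zero])
  zero_mem' h := absurd rfl h
  smul_mem' a c hc h := hc (right_ne_zero_of_mul h)

theorem mul_mem_scalarPart {m b n : ℕ} {p q r : ℤ} {i : Fin m} (e : Slot m b n i) (h : p + q = r)
    (c : scalarPart K m p) (d : scalarPart K b q) : c.1 * d.1 ∈ scalarPart K n r := fun hcd => by
  obtain ⟨rfl, rfl⟩ := c.2 (left_ne_zero_of_mul hcd)
  obtain ⟨rfl, rfl⟩ := d.2 (right_ne_zero_of_mul hcd)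
  exact ⟨(SMod.eq_of_equiv e.equivLeft).symm, by omega⟩

/-- The square-zero extension `I ⊕ V` of the unit operad by a graded `𝕊`-module: scalars act on `V`
by multiplication, and all the compositions of two elements of `V` vanish. -/
def squareZero (V : SMod K) : Operad K where
  obj n i := scalarPart K n i × V n i
  map {m n i} σ := (Submodule.inclusion (by rw [SMod.eq_of_equiv σ])).prodMap (V.map σ)
  map_refl x := Prod.ext rfl (V.map_refl _)
  map_trans σ τ x := Prod.ext rfl (V.map_trans σ τ _)
  one := (⟨1, fun _ => ⟨rfl, rfl⟩⟩, 0)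
  comp {m b n p q r} i e h := LinearMap.mk₂ K
    (fun x y => (⟨x.1.1 * y.1.1, mul_mem_scalarPart e h x.1 y.1⟩,
      y.1.1 • V.actLeft e h x.2 + x.1.1 • V.actRight e h y.2))
    (by
      intro x x' y
      refine Prod.ext (Subtype.ext (add_mul _ _ _)) ?_
      simp only [Prod.fst_add, Prod.snd_add, Submodule.coe_add, map_add, smul_add, add_smul]
      abel)
    (by
      intro c x y
      refine Prod.ext (Subtype.ext (mul_assoc _ _ _)) ?_
      simp only [Prod.smul_fst, Prod.smul_snd, Submodule.coe_smul, map_smul, smul_add, smul_eq_mul,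
        smul_smul, mul_comm c])
    (by
      intro x y y'
      refine Prod.ext (Subtype.ext (mul_add _ _ _)) ?_
      simp only [Prod.fst_add, Prod.snd_add, Submodule.coe_add, map_add, smul_add, add_smul]
      abel)
    (by
      intro c x y
      refine Prod.ext (Subtype.ext (mul_left_comm _ _ _)) ?_
      simp only [Prod.smul_fst, Prod.smul_snd, Submodule.coe_smul, map_smul, smul_add, smul_eq_mul,
        smul_smul, mul_comm c])
  equivar {m b n m' b' n' p q r i} e i' e' σ τ ρ H h := by
    rintro ⟨⟨c, hc⟩, v⟩ ⟨⟨d, hd⟩, w⟩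
    obtain rfl := SMod.eq_of_equiv σ
    obtain rfl := SMod.eq_of_equiv τ
    obtain rfl := SMod.eq_of_equiv ρ
    obtain ⟨H₁, H₂, H₃⟩ := H
    refine Prod.ext (Subtype.ext rfl) ?_
    change V.map ρ (d • V.actLeft e h v + c • V.actRight e h w) =
      d • V.actLeft e' h (V.map σ v) + c • V.actRight e' h (V.map τ w)
    rw [map_add, map_smul, map_smul]
    congr 1
    · by_cases h0 : d = 0
      · simp [h0]
      obtain ⟨rfl, rfl⟩ := hd h0
      rw [V.actLeft_eq, V.actLeft_eq, ← V.mapCast_rfl, ← V.mapCast_rfl, V.mapCast_mapCast,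
        V.mapCast_mapCast]
      congr 3
      ext1 j
      simp only [Equiv.trans_apply]
      by_cases hj : j = i
      · subst hj
        rw [e.equivLeft_self 0, H₁, e'.equivLeft_self (τ 0), H₃]
      · have hj' : σ j ≠ i' := fun hh => hj (σ.injective (hh.trans H₁.symm))
        rw [e.equivLeft_of_ne hj, e'.equivLeft_of_ne hj']
        exact H₂ _ _ rfl
    · by_cases h0 : c = 0
      · simp [h0]
      obtain ⟨rfl, rfl⟩ := hc h0
      rw [V.actRight_eq, V.actRight_eq, ← V.mapCast_rfl, ← V.mapCast_rfl, V.mapCast_mapCast,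
        V.mapCast_mapCast]
      congr 3
      ext1 k
      exact H₃ k
  assoc_seq {m b c n s t p q r pq qr w i} e {j} e' f f' H h₁ h₂ h₃ h₄ := by
    rintro ⟨⟨c₁, hc₁⟩, v₁⟩ ⟨⟨c₂, hc₂⟩, v₂⟩ ⟨⟨c₃, hc₃⟩, v₃⟩
    obtain ⟨H₁, H₂, H₃⟩ := H
    refine Prod.ext (Subtype.ext (mul_assoc _ _ _)) ?_
    change c₃ • V.actLeft e' h₂ (c₂ • V.actLeft e h₁ v₁ + c₁ • V.actRight e h₁ v₂) +
      (c₁ * c₂) • V.actRight e' h₂ v₃ = (c₂ * c₃) • V.actLeft f h₄ v₁ +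
      c₁ • V.actRight f h₄ (c₃ • V.actLeft f' h₃ v₂ + c₂ • V.actRight f' h₃ v₃)
    simp only [map_add, map_smul, smul_add, smul_smul, add_assoc]
    congr 1
    · by_cases h0 : c₂ = 0
      · simp [h0]
      by_cases h0' : c₃ = 0
      · simp [h0']
      obtain ⟨rfl, rfl⟩ := hc₂ h0
      obtain ⟨rfl, rfl⟩ := hc₃ h0'
      obtain rfl := SMod.eq_of_equiv f'.equivLeft
      obtain rfl : qr = 0 := by omega
      rw [V.actLeft_eq, V.actLeft_eq, V.actLeft_eq, V.mapCast_mapCast, mul_comm]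
      congr 3
      ext1 k
      simp only [Equiv.trans_apply]
      by_cases hk : k = i
      · subst hk
        rw [e.equivLeft_self j, e'.equivLeft_self 0, f.equivLeft_self (f' (.inr 0)), H₃]
      · rw [e.equivLeft_of_ne hk, e'.equivLeft_of_ne (by simp), f.equivLeft_of_ne hk, H₁]
    congr 1
    · by_cases h0 : c₁ = 0
      · simp [h0]
      by_cases h0' : c₃ = 0
      · simp [h0']
      obtain ⟨rfl, rfl⟩ := hc₁ h0
      obtain ⟨rfl, rfl⟩ := hc₃ h0'
      rw [V.actLeft_eq, V.actRight_eq, V.actLeft_eq, V.actRight_eq, V.mapCast_mapCast,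
        V.mapCast_mapCast, mul_comm]
      congr 3
      ext1 k
      simp only [Equiv.trans_apply, Slot.equivRight_apply]
      by_cases hk : k = j
      · subst hk
        rw [e'.equivLeft_self 0, f'.equivLeft_self 0, H₃]
      · rw [f'.equivLeft_of_ne hk, e'.equivLeft_of_ne (by simpa using hk), ← H₂ ⟨k, hk⟩]
    · by_cases h0 : c₁ = 0
      · simp [h0]
      by_cases h0' : c₂ = 0
      · simp [h0']
      obtain ⟨rfl, rfl⟩ := hc₁ h0
      obtain ⟨rfl, rfl⟩ := hc₂ h0'
      obtain rfl := SMod.eq_of_equiv e.equivLeft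
      obtain rfl : pq = 0 := by omega
      rw [V.actRight_eq, V.actRight_eq, V.actRight_eq, V.mapCast_mapCast]
      congr 3
      ext1 k
      exact H₃ k
  assoc_par {m b c n n' s p q r pq pr w i j} hij e e' g g' H h₁ h₂ h₃ h₄ := by
    rintro ⟨⟨c₁, hc₁⟩, v₁⟩ ⟨⟨c₂, hc₂⟩, v₂⟩ ⟨⟨c₃, hc₃⟩, v₃⟩
    obtain ⟨H₁, H₂, H₃⟩ := H
    -- A scalar has only one input.
    have h0 : c₁ = 0 := by
      by_contra h0
      obtain ⟨rfl, rfl⟩ := hc₁ h0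
      exact hij (Subsingleton.elim _ _)
    subst h0
    refine Prod.ext (Subtype.ext ?_) ?_
    · change 0 * c₂ * c₃ = (-1 : K) ^ (q * r) • (0 * c₃ * c₂)
      simp
    change c₃ • V.actLeft e' h₂ (c₂ • V.actLeft e h₁ v₁ + (0 : K) • V.actRight e h₁ v₂) +
      (0 * c₂) • V.actRight e' h₂ v₃ = (-1 : K) ^ (q * r) • (c₂ • V.actLeft g' h₄
        (c₃ • V.actLeft g h₃ v₁ + (0 : K) • V.actRight g h₃ v₃) +
      (0 * c₃) • V.actRight g' h₄ v₂)
    simp only [zero_mul, zero_smul, add_zero, map_smul, smul_smul]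
    by_cases h0 : c₂ = 0
    · simp [h0]
    by_cases h0' : c₃ = 0
    · simp [h0']
    obtain ⟨rfl, rfl⟩ := hc₂ h0
    obtain ⟨rfl, rfl⟩ := hc₃ h0'
    rw [V.actLeft_eq, V.actLeft_eq, V.actLeft_eq, V.actLeft_eq, V.mapCast_mapCast,
      V.mapCast_mapCast, mul_zero, zpow_zero, one_mul, mul_comm]
    congr 3
    ext1 k
    simp only [Equiv.trans_apply]
    by_cases hk : k = i
    · subst hk
      rw [e.equivLeft_self 0, e'.equivLeft_of_ne (by simp), g.equivLeft_of_ne hij,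
        g'.equivLeft_self 0, H₂]
    by_cases hk' : k = j
    · subst hk'
      rw [e.equivLeft_of_ne hk, e'.equivLeft_self 0, g.equivLeft_self 0,
        g'.equivLeft_of_ne (by simp), H₃]
    · rw [e.equivLeft_of_ne hk, e'.equivLeft_of_ne (by simpa using hk'), g.equivLeft_of_ne hk',
        g'.equivLeft_of_ne (by simpa using hk), H₁ k hk hk']
  one_comp {b n q} i e σ H := by
    rintro ⟨⟨c, hc⟩, v⟩
    refine Prod.ext (Subtype.ext (one_mul c)) ?_
    change c • V.actLeft e _ 0 + (1 : K) • V.actRight e _ v = V.map σ v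
    rw [map_zero, smul_zero, zero_add, one_smul, V.actRight_eq, show e.equivRight = σ from
      Equiv.ext fun k => (H k).symm]
    rfl
  comp_one {m n p} i e σ H H' := by
    rintro ⟨⟨c, hc⟩, v⟩
    refine Prod.ext (Subtype.ext (mul_one c)) ?_
    change (1 : K) • V.actLeft e _ v + c • V.actRight e _ 0 = V.map σ v
    rw [map_zero, smul_zero, add_zero, one_smul, V.actLeft_eq, show e.equivLeft = σ from
      Equiv.ext fun k => by
        by_cases hk : k = i
        · subst hk
          rw [e.equivLeft_self 0, H]
        · rw [e.equivLeft_of_ne hk, H' ⟨k, hk⟩]]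
    rfl

theorem Free.gen_injective (V : SMod K) (n : ℕ) (i : ℤ) :
    Function.Injective ((gen V).app (n := n) (i := i)) := by
  let φ : SMod.Hom V (squareZero V).toSMod :=
    ⟨LinearMap.inr K _ _, fun σ x => Prod.ext (Subtype.ext rfl) rfl⟩
  exact fun x y h => congrArg (fun t => ((lift φ).app t).2) h

/-! ### Cofibrations are injective -/

theorem SMod.DegHom.cast_app {k : ℤ} {V W : SMod K} (f : DegHom k V W) {n : ℕ} {i j j' : ℤ}
    (h : i = j + k) (h' : j = j') (x : V n i) :
    W.cast h' (f.app h x) = f.app (h.trans (by rw [h'])) x := by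
  subst h'; rfl

namespace DGOperad

theorem Hom.ext_app {P Q : DGOperad K} {f g : Hom P Q}
    (h : ∀ {n : ℕ} {i : ℤ} (x : P n i), f.app x = g.app x) : f = g := by
  obtain ⟨⟨f, _, _⟩, _⟩ := f
  obtain ⟨⟨g, _, _⟩, _⟩ := g
  obtain rfl : f = g := SMod.Hom.ext' h
  rfl

theorem d_one (P : DGOperad K) {j : ℤ} (h : 0 = j + 1) : P.d.app h P.one = 0 := by
  let e : Slot 1 1 1 0 := Fintype.equivOfCardEq (by simp)
  have h1 : ∀ {q : ℤ} (y : P 1 q), P.comp 0 e (zero_add q) P.one y = y := fun y => by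
    rw [P.one_comp 0 e (Equiv.refl _) fun k => Subsingleton.elim _ _, P.map_refl]
  have h2 : ∀ {p : ℤ} (x : P 1 p), P.comp 0 e (add_zero p) x P.one = x := fun x => by
    rw [P.comp_one 0 e (Equiv.refl _) (Subsingleton.elim _ _) fun k => Subsingleton.elim _ _,
      P.map_refl]
  have := P.leibniz 0 e (zero_add 0) h h h P.one P.one
  rw [h1, h1, h2, zpow_zero, one_smul] at this
  exact left_eq_add.1 this

theorem d_oneAt (P : DGOperad K) {n : ℕ} {i j : ℤ} (h : i = j + 1) :
    P.d.app h (P.oneAt n i) = 0 := by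
  by_cases hn : n = 1 ∧ i = 0
  · obtain ⟨rfl, rfl⟩ := hn
    rw [oneAt_one, d_one]
  · rw [oneAt_of_not _ hn, map_zero]

/-- The dg operad with all components zero. -/
def terminal (K : Type u) [Field K] : DGOperad K where
  obj _ _ := PUnit
  map _ := 0
  map_refl _ := rfl
  map_trans := by intros; rfl
  one := 0
  comp _ _ _ := 0
  equivar := by intros; rfl
  assoc_seq := by intros; rfl
  assoc_par := by intros; rfl
  one_comp := by intros; rfl
  comp_one := by intros; rfl
  d := ⟨fun _ => 0, fun _ _ _ => rfl⟩
  d_d := by intros; rfl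
  leibniz := by intros; rfl

instance (n : ℕ) (i : ℤ) : Subsingleton (terminal K n i) :=
  inferInstanceAs (Subsingleton PUnit)

/-- The morphism to the zero operad. -/
def toTerminal (P : DGOperad K) : Hom P (terminal K) where
  app := 0
  naturality _ _ := Subsingleton.elim _ _
  map_one := Subsingleton.elim _ _
  map_comp _ _ _ _ _ := Subsingleton.elim _ _
  map_d _ _ := Subsingleton.elim _ _

/-- The dg operad `P ⊗ A`, where `A` is the dg algebra spanned by `1` and an element `η` of degree
`1` with `dη = 1` and `η² = 0`. It is the operad of dual numbers over `P` with the differential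
`d(x + η y) = d x + y - η d y`. -/
def cone (P : DGOperad K) : DGOperad K where
  toOperad := P.dual 1
  d :=
    { app := fun {n i j} h => LinearMap.prod
        (P.d.app h ∘ₗ LinearMap.fst K (P n i) (P n (i - 1)) +
          P.cast (by omega) ∘ₗ LinearMap.snd K (P n i) (P n (i - 1)))
        (-P.d.app (by omega) ∘ₗ LinearMap.snd K (P n i) (P n (i - 1)))
      naturality := fun {m n i j} h σ x => Prod.ext
        (by
          change P.d.app _ (P.map σ x.1) + P.cast _ (P.map σ x.2) =
            P.map σ (P.d.app _ x.1 + P.cast _ x.2)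
          rw [P.d.naturality, SMod.map_cast, map_add])
        (by
          change -P.d.app _ (P.map σ x.2) = P.map σ (-P.d.app _ x.2)
          rw [P.d.naturality, map_neg]) }
  d_d {n i j k} h h' x := by
    refine Prod.ext ?_ ?_
    · change P.d.app h' (P.d.app h x.1 + P.cast _ x.2) + P.cast _ (-P.d.app _ x.2) = 0
      rw [map_add, P.d_d, SMod.DegHom.app_cast, map_neg, SMod.DegHom.cast_app, zero_add,
        add_neg_cancel]
    · change -P.d.app _ (-P.d.app _ x.2) = 0
      rw [map_neg, P.d_d, neg_zero, neg_zero]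
  leibniz {m b n p q r p' q' r'} i e h hp hq hr x y := by
    obtain rfl : r' = r - 1 := by omega
    obtain rfl : p' = p - 1 := by omega
    obtain rfl : q' = q - 1 := by omega
    have s0 : (-1 : K) ^ p * (-1 : K) ^ p = 1 := by
      rw [neg_one_zpow_mul]; exact Even.neg_one_zpow ⟨p, rfl⟩
    have s1 : (-1 : K) ^ (p - 1) = -(-1 : K) ^ p := by
      rw [zpow_sub_one₀ (by simp)]; simp
    refine Prod.ext ?_ ?_
    · change P.d.app hr (P.comp i e h x.1 y.1) + (P.comp i e _ x.2 y.1 +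
          (-1 : K) ^ (1 * p) • P.comp i e _ x.1 y.2) =
        P.comp i e _ (P.d.app hp x.1 + x.2) y.1 +
          (-1 : K) ^ p • P.comp i e _ x.1 (P.d.app hq y.1 + y.2)
      rw [P.leibniz i e h hp hq hr, one_mul]
      simp only [map_add, LinearMap.add_apply, smul_add]
      abel
    · change -P.d.app _ (P.comp i e _ x.2 y.1 + (-1 : K) ^ (1 * p) • P.comp i e _ x.1 y.2) =
        (P.comp i e _ (-P.d.app _ x.2) y.1 +
          (-1 : K) ^ (1 * (p - 1)) • P.comp i e _ (P.d.app hp x.1 + x.2) y.2) +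
        (-1 : K) ^ p • (P.comp i e _ x.2 (P.d.app hq y.1 + y.2) +
          (-1 : K) ^ (1 * p) • P.comp i e _ x.1 (-P.d.app _ y.2))
      rw [map_add, map_smul, P.leibniz i e _ (p' := p - 1 - 1) (q' := q - 1) (by omega) hq,
        P.leibniz i e _ (p' := p - 1) (q' := q - 1 - 1) hp (by omega)]
      simp only [map_add, map_neg, LinearMap.add_apply, LinearMap.neg_apply, smul_add, one_mul,
        smul_smul, s0, s1, neg_smul, smul_neg, one_smul]
      abel

/-- The inclusion `P → P ⊗ A`. -/
def coneIncl (P : DGOperad K) : Hom P P.cone where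
  toOperadHom := dualIncl 1 P.toOperad
  map_d h x := Prod.ext
    (by
      change P.d.app h x = P.d.app h x + P.cast _ 0
      rw [map_zero, add_zero])
    (by
      change 0 = -P.d.app _ 0
      rw [map_zero, neg_zero])

theorem cone_acyclic (P : DGOperad K) (n : ℕ) (i : ℤ) :
    P.cone.cycles n i ≤ P.cone.boundaries n i := by
  rintro ⟨x, y⟩ hz
  have h1 : P.d.app (by omega : i = i - 1 + 1) x + y = 0 := congrArg Prod.fst hz
  refine ⟨(0, P.cast (by omega : i = i + 1 - 1) x), Prod.ext ?_ ?_⟩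
  · change P.d.app _ 0 + P.cast _ (P.cast _ x) = x
    rw [map_zero, zero_add, SMod.cast_cast]
    rfl
  · change -P.d.app _ (P.cast _ x) = y
    rw [SMod.DegHom.app_cast]
    exact neg_eq_of_add_eq_zero_right h1

theorem toTerminal_isWeakEquivalence (P : DGOperad K)
    (hP : ∀ n i, P.cycles n i ≤ P.boundaries n i) : P.toTerminal.IsWeakEquivalence := fun n i => by
  have h1 : Subsingleton (P.Homology n i) :=
    Submodule.Quotient.subsingleton_iff.2 (Submodule.submoduleOf_eq_top.2 (hP n i))
  have h2 : Subsingleton ((terminal K).Homology n i) :=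
    Submodule.Quotient.subsingleton_iff.2 (Submodule.submoduleOf_eq_top.2 fun _ _ =>
      ⟨0, Subsingleton.elim _ _⟩)
  exact ⟨fun _ _ _ => Subsingleton.elim _ _, fun y => ⟨0, Subsingleton.elim _ _⟩⟩

/-- A cofibration `f : P → Q` is injective: since `P ⊗ A` is acyclic, the inclusion `P → P ⊗ A`
extends along `f`. -/
theorem Hom.IsCofibration.injective {P Q : DGOperad K} {f : Hom P Q} (hf : f.IsCofibration)
    (n : ℕ) (i : ℤ) : Function.Injective (f.app (n := n) (i := i)) := by
  obtain ⟨l, hl, -⟩ := hf P.cone (terminal K) P.cone.toTerminal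
    (fun _ _ y => ⟨0, Subsingleton.elim _ _⟩) (toTerminal_isWeakEquivalence _ P.cone_acyclic)
    P.coneIncl Q.toTerminal
    (Hom.ext_app fun _ => Subsingleton.elim _ _)
  intro x y hxy
  have h : ∀ z : P n i, l.app (f.app z) = ((z, 0) : P n i × P n (i - 1)) := fun z =>
    congrArg (fun φ : Hom P P.cone => φ.app z) hl
  have := (h x).symm.trans ((congrArg l.app hxy).trans (h y))
  exact congrArg Prod.fst this

end DGOperad

theorem CurvedCooperad.Hom.injective_of_desusp {C D : CurvedCooperad K} (f : C.Hom D)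
    (hf : ∀ n i, Function.Injective (f.desusp.app (n := n) (i := i))) (n : ℕ) (i : ℤ) :
    Function.Injective (f.app (n := n) (i := i)) := by
  refine (injective_iff_map_eq_zero _).2 fun x hx => ?_
  obtain ⟨j, rfl⟩ : ∃ j, i = j + 1 := ⟨i - 1, by omega⟩
  have h0 : C.extend 0 C.counit n (j + 1) x = 0 := by rw [← f.extend_counit, hx, map_zero]
  exact congrArg Subtype.val ((injective_iff_map_eq_zero _).1 (hf n j) ⟨x, h0⟩ (Subtype.ext hx))

theorem CurvedConilpotentCooperad.IsCofibration.injective {C D : CurvedConilpotentCooperad K}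
    {f : Hom C D} (hf : IsCofibration f) (n : ℕ) (i : ℤ) :
    Function.Injective (f.app (n := n) (i := i)) := by
  refine f.injective_of_desusp (fun n i x y hxy => Free.gen_injective _ n i ?_) n i
  exact DGOperad.Hom.IsCofibration.injective hf n i (congrArg (gen D.desusp).app hxy)

/-! ### Infinitesimal decompositions and the coradical filtration -/

namespace Operad
variable (P : Operad K)

theorem comp_oneAt {m b n : ℕ} {p q r : ℤ} (i : Fin m) (e : Slot m b n i) (h : p + q = r)
    (x : P m p) : P.comp i e h x (P.oneAt b q) = P.actLeft e h x := by
  by_cases hb : b = 1 ∧ q = 0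
  · obtain ⟨rfl, rfl⟩ := hb
    obtain rfl : p = r := by omega
    rw [oneAt_one, P.actLeft_eq]
    exact P.comp_one i e e.equivLeft (e.equivLeft_self 0) (fun j => e.equivLeft_of_ne j.2) x
  · rw [oneAt_of_not _ hb, map_zero, SMod.actLeft, dif_neg hb, LinearMap.zero_apply]

end Operad

namespace Cooperad
variable {C : Cooperad K} {P : Operad K} {k l : ℤ}

/-- The span of the products `f y ∘ᵢ g z` with `y` in `A` and `z` in `B`. -/
def compSpan (f : SMod.DegHom k C.toSMod P.toSMod) (g : SMod.DegHom l C.toSMod P.toSMod)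
    (A B : ∀ n i, Submodule K (C n i)) (n : ℕ) (j : ℤ) : Submodule K (P n j) :=
  Submodule.span K {t | ∃ (m b : ℕ) (p q p' q' : ℤ) (i : Fin m) (e : Slot m b n i)
    (h : p' + q' = j) (hp : p = p' + k) (hq : q = q' + l) (y : C m p) (z : C b q),
    y ∈ A m p ∧ z ∈ B b q ∧ t = P.comp i e h (f.app hp y) (g.app hq z)}

variable {f : SMod.DegHom k C.toSMod P.toSMod} {g : SMod.DegHom l C.toSMod P.toSMod}
  {A B : ∀ n i, Submodule K (C n i)}

theorem coprod_zero_inr (C : Cooperad K) (f : SMod.DegHom k C.toSMod P.toSMod) {n : ℕ} {i j : ℤ}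
    (h : i = j + k) (x : C n i) :
    (f.coprod 0).app h ((SMod.Hom.inr C.toSMod C.toSMod).app x) = 0 :=
  (add_zero _).trans (map_zero (f.app h))

theorem zero_coprod_inr (C : Cooperad K) (f : SMod.DegHom k C.toSMod P.toSMod) {n : ℕ} {i j : ℤ}
    (h : i = j + k) (x : C n i) :
    (SMod.DegHom.coprod 0 f).app h ((SMod.Hom.inr C.toSMod C.toSMod).app x) = f.app h x :=
  zero_add _

theorem E₀_inr (C : Cooperad K) {n : ℕ} {i : ℤ} (x : C n i) :
    (C.E₀ P).app ((SMod.Hom.inr C.toSMod C.toSMod).app x) =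
      C.extend 0 C.counit n i x • P.oneAt n i := by
  change (C.counitHom P).app 0 + C.extend 0 C.counit n i x • P.oneAt n i = _
  rw [map_zero, zero_add]

/-- Relabelling the inputs of `x ∘ᵢ y` only changes the numbering in use. -/
theorem map_comp_eq {m b n n' : ℕ} {p q r : ℤ} (i : Fin m) (e : Slot m b n i) (h : p + q = r)
    (ρ : Fin n ≃ Fin n') (x : P m p) (y : P b q) :
    P.map ρ (P.comp i e h x y) = P.comp i (e.trans ρ) h x y := by
  rw [P.equivar e (e.trans ρ) (Equiv.refl _) (Equiv.refl _) ρ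
    ⟨rfl, fun j j' hj => congrArg (fun j => ρ (e (.inl j))) (Subtype.ext hj), fun _ => rfl⟩,
    P.map_refl, P.map_refl]

/-- Relabelling the inputs of the first factor of `x ∘ᵢ y` amounts to another numbering. -/
theorem comp_map_left_eq {m m' b n : ℕ} {p q r : ℤ} (σ : Fin m ≃ Fin m') (i : Fin m')
    (e : Slot m' b n i) (h : p + q = r) (x : P m p) (y : P b q) :
    ∃ (i' : Fin m) (e' : Slot m b n i'), P.comp i e h (P.map σ x) y = P.comp i' e' h x y := by
  refine ⟨σ.symm i, (Equiv.sumCongr (σ.subtypeEquiv fun j => ?_) (Equiv.refl _)).trans e, ?_⟩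
  · rw [not_iff_not, Equiv.eq_symm_apply]
  · refine (Eq.trans (P.map_refl _).symm ?_).symm
    rw [P.equivar _ e σ (Equiv.refl _) (Equiv.refl _), P.map_refl]
    refine ⟨by simp, fun j j' hj => ?_, fun _ => rfl⟩
    exact congrArg (fun j => e (.inl j)) (Subtype.ext hj)

theorem map_mem_compSpan {n n' : ℕ} {j : ℤ} (ρ : Fin n ≃ Fin n') {t : P n j}
    (ht : t ∈ compSpan f g A B n j) : P.map ρ t ∈ compSpan f g A B n' j := by
  induction ht using Submodule.span_induction with
  | mem t ht =>
    obtain ⟨m, b, p, q, p', q', i, e, h, hp, hq, y, z, hy, hz, rfl⟩ := ht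
    exact Submodule.subset_span ⟨m, b, p, q, p', q', i, _, h, hp, hq, y, z, hy, hz,
      map_comp_eq i e h ρ _ _⟩
  | zero => rw [map_zero]; exact zero_mem _
  | add x y _ _ hx hy => rw [map_add]; exact add_mem hx hy
  | smul c x _ hx => rw [map_smul]; exact Submodule.smul_mem _ _ hx

theorem actLeft_mem_compSpan {m b n : ℕ} {p q r : ℤ} {i : Fin m} (e : Slot m b n i) (h : p + q = r)
    {t : P m p} (ht : t ∈ compSpan f g A B m p) : P.actLeft e h t ∈ compSpan f g A B n r := by
  by_cases hb : b = 1 ∧ q = 0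
  · obtain ⟨rfl, rfl⟩ := hb
    obtain rfl : p = r := by omega
    rw [P.actLeft_eq]
    exact map_mem_compSpan _ ht
  · rw [SMod.actLeft, dif_neg hb]
    exact zero_mem _

/-- The contribution to `γ (f ∘ ε) Δ x` of a tree with two levels and root `y` is a multiple of
`f y`, up to relabelling. -/
theorem derivation_twoLevel {n : ℕ} {i : ℤ} {S : Set (Fin n)}
    {t : free (C.toSMod.prod C.toSMod) n i} (ht : TwoLevel A B S t) :
    ∃ (m : ℕ) (σ : Fin m ≃ Fin n) (y : C m i), y ∈ A m i ∧ ∃ c : K, ∀ {j : ℤ} (h : i = j + k),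
      (derivation (C.E₀ P) (f.coprod 0)).app h t = c • P.map σ (f.app h y) := by
  induction ht with
  | @root n i v hv =>
    refine ⟨n, Equiv.refl _, v, hv, 1, fun h => ?_⟩
    rw [derivation_gen, P.map_refl, one_smul]
    exact add_zero _
  | @graft m b n p q r S t ht i hi e h w hw ih =>
    obtain ⟨m', σ, y, hy, c, hc⟩ := ih
    have key : ∀ {j s : ℤ} (hr : r = j + k) (hs : s + q = j) (hp : p = s + k),
        (derivation (C.E₀ P) (f.coprod 0)).app hr
          ((free _).comp i e h t ((gen _).app ((SMod.Hom.inr C.toSMod C.toSMod).app w))) =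
        C.extend 0 C.counit b q w • P.actLeft e hs
          ((derivation (C.E₀ P) (f.coprod 0)).app hp t) := fun {j s} hr hs hp => by
      rw [derivation_comp _ _ i e h (p' := s) (q' := q - k) hp (by omega) hr,
        derivation_gen, lift_gen, C.coprod_zero_inr, C.E₀_inr, map_zero, smul_zero, add_zero,
        map_smul, P.comp_oneAt]
    by_cases hb : b = 1 ∧ q = 0
    · obtain ⟨rfl, rfl⟩ := hb
      obtain rfl : p = r := by omega
      refine ⟨m', σ.trans e.equivLeft, y, hy, C.extend 0 C.counit 1 0 w * c, fun {j} hr => ?_⟩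
      rw [key hr (add_zero j) hr, hc, map_smul, smul_smul, P.actLeft_eq, P.map_trans]
      rfl
    · refine ⟨n, Equiv.refl _, 0, zero_mem _, 0, fun {j} hr => ?_⟩
      rw [key (s := j - q) hr (by omega) (by omega), SMod.extend_of_not _ _ hb, zero_smul,
        zero_smul]

/-- The contribution to `γ (f ⊗ g) Δ₍₁₎ x` of a tree with two levels is a sum of products of the
value of `f` on the root with the values of `g` on the vertices of the second level. -/
theorem biderivation_twoLevel {n : ℕ} {i j : ℤ} {S : Set (Fin n)}
    {t : free (C.toSMod.prod C.toSMod) n i} (ht : TwoLevel A B S t) (h : i = j + (k + l)) :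
    (biderivation (C.E₀ P) (f.coprod 0) (SMod.DegHom.coprod 0 g)).app h t ∈
      compSpan f g A B n j := by
  induction ht generalizing j with
  | root v hv =>
    rw [biderivation_gen]
    exact zero_mem _
  | @graft m b n p q r S t ht i hi e hh w hw ih =>
    rw [biderivation_comp _ _ _ i e hh (p' := p - (k + l)) (q' := q - (k + l)) (p₁ := p - k)
      (q₁ := q - k) (p₂ := p - l) (q₂ := q - l) (by omega) (by omega) h (by omega) (by omega)
      (by omega) (by omega), derivation_gen, derivation_gen, lift_gen, biderivation_gen,
      C.coprod_zero_inr, C.E₀_inr, C.zero_coprod_inr, map_zero, map_zero, smul_zero, smul_zero,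
      add_zero, add_zero, map_smul, P.comp_oneAt]
    refine add_mem (Submodule.smul_mem _ _ (actLeft_mem_compSpan _ _ (ih _)))
      (Submodule.smul_mem _ _ ?_)
    obtain ⟨m', σ, y, hy, c, hc⟩ := derivation_twoLevel (P := P) (f := f) ht
    rw [hc, map_smul, LinearMap.smul_apply]
    obtain ⟨i', e', he⟩ := comp_map_left_eq σ i e (by omega : p - k + (q - l) = j)
      (f.app (by omega) y) (g.app (by omega) w)
    rw [he]
    exact Submodule.smul_mem _ _ (Submodule.subset_span ⟨_, _, _, _, _, _, i', e', _, _, _, y, w,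
      hy, hw, rfl⟩)

theorem biderivation_mem_compSpan {n : ℕ} {i j : ℤ} {t : free (C.toSMod.prod C.toSMod) n i}
    (ht : t ∈ composite A B n i) (h : i = j + (k + l)) :
    (biderivation (C.E₀ P) (f.coprod 0) (SMod.DegHom.coprod 0 g)).app h t ∈
      compSpan f g A B n j :=
  (Submodule.span_le (p := (compSpan f g A B n j).comap _)).2
    (fun _ ht => biderivation_twoLevel ht h) ht

theorem compSpan_le {n : ℕ} {j : ℤ} {N : Submodule K (P n j)}
    (H : ∀ {m b : ℕ} {p q p' q' : ℤ} (i : Fin m) (e : Slot m b n i)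
      (h : p' + q' = j) (hp : p = p' + k) (hq : q = q' + l) (y : C m p) (z : C b q),
      y ∈ A m p → z ∈ B b q → P.comp i e h (f.app hp y) (g.app hq z) ∈ N) :
    compSpan f g A B n j ≤ N := by
  refine Submodule.span_le.2 ?_
  rintro _ ⟨m, b, p, q, p', q', i, e, h, hp, hq, y, z, hy, hz, rfl⟩
  exact H i e h hp hq y z hy hz

end Cooperad

theorem TwoLevel.mono {V W : SMod K} {A A' : ∀ n i, Submodule K (V n i)}
    {B B' : ∀ n i, Submodule K (W n i)} (hA : ∀ n i, A n i ≤ A' n i) (hB : ∀ n i, B n i ≤ B' n i)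
    {n : ℕ} {i : ℤ} {S : Set (Fin n)} {t : free (V.prod W) n i} (ht : TwoLevel A B S t) :
    TwoLevel A' B' S t := by
  induction ht with
  | root v hv => exact .root v (hA _ _ hv)
  | graft ht i hi e h w hw ih => exact .graft ih i hi e h w (hB _ _ hw)

theorem composite_mono {V W : SMod K} {A A' : ∀ n i, Submodule K (V n i)}
    {B B' : ∀ n i, Submodule K (W n i)} (hA : ∀ n i, A n i ≤ A' n i) (hB : ∀ n i, B n i ≤ B' n i)
    (n : ℕ) (i : ℤ) : composite A B n i ≤ composite A' B' n i :=
  Submodule.span_mono fun _ ht => TwoLevel.mono hA hB ht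

namespace CoaugCooperad
variable (C : CoaugCooperad K)

theorem unitPart_le_corad_one (n : ℕ) (i : ℤ) : C.unitPart n i ≤ C.corad 1 n i := by
  rw [unitPart, Submodule.span_singleton_le_iff_mem]
  by_cases h : n = 1 ∧ i = 0
  · obtain ⟨rfl, rfl⟩ := h
    have h1 : C.coaug ∈ C.unitPart 1 0 := by
      rw [unitPart, C.elemAt_one]
      exact Submodule.mem_span_singleton_self _
    let e : Slot 1 1 1 0 := Fintype.equivOfCardEq (by simp)
    have h2 : C.decomp.app C.coaug ∈ composite C.unitPart (fun _ _ => ⊤) 1 0 := by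
      rw [C.decomp_coaug 0 e]
      refine Submodule.subset_span ?_
      have := (TwoLevel.root (B := fun n i => (⊤ : Submodule K (C n i))) _ h1).graft 0
        (Set.mem_univ _) e (add_zero 0) C.coaug Submodule.mem_top
      rw [Set.eq_empty_of_forall_notMem (s := {k | _})] at this
      · exact this
      · rintro k ⟨j, -, -⟩
        exact j.2 (Subsingleton.elim _ _)
    rw [C.elemAt_one]
    exact Submodule.mem_sup_left (Submodule.mem_sup_right h2)
  · rw [C.elemAt_of_not _ h]
    exact zero_mem _

theorem corad_le_succ (r : ℕ) (n : ℕ) (i : ℤ) : C.corad r n i ≤ C.corad (r + 1) n i := by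
  induction r generalizing n i with
  | zero => exact C.unitPart_le_corad_one n i
  | succ r ih =>
    exact Submodule.comap_mono (sup_le_sup_right (sup_le_sup_right (composite_mono ih ih n i) _) _)

theorem corad_mono (n : ℕ) (i : ℤ) : Monotone fun r => C.corad r n i :=
  monotone_nat_of_le_succ fun r => C.corad_le_succ r n i

theorem proj_elemAt {n : ℕ} {i : ℤ} : C.proj.app (C.elemAt C.coaug n i) = 0 := by
  by_cases h : n = 1 ∧ i = 0
  · obtain ⟨rfl, rfl⟩ := h
    rw [C.proj_app, C.extend_self, C.elemAt_one, C.counit_coaug, one_smul, sub_self]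
  · rw [C.elemAt_of_not _ h, map_zero]

theorem twist_unitPart {n : ℕ} {i j : ℤ} (h : i = j + 1) {x : C n i} (hx : x ∈ C.unitPart n i) :
    C.twist.app h x = 0 := by
  obtain ⟨c, rfl⟩ := Submodule.mem_span_singleton.1 hx
  subst h
  rw [map_smul]
  refine (congrArg (c • ·) ?_).trans (smul_zero c)
  exact (congrArg (gen _).app (Subtype.ext C.proj_elemAt)).trans (map_zero _)

/-- For `x` in `F (r + 1)`, the quadratic part of the differential of `s⁻¹ x` only involves
`F r`. -/
theorem infConv_twist_mem {r n : ℕ} {i j : ℤ} (h : i = j + (1 + 1)) {x : C n i}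
    (hx : x ∈ C.corad (r + 1) n i) : (C.infConv C.twist C.twist).app h x ∈
      Cooperad.compSpan C.twist C.twist (C.corad r) (C.corad r) n j := by
  obtain ⟨v, hv, z, hz, hvz⟩ := Submodule.mem_sup.1 hx
  obtain ⟨y, hy, w, hw, rfl⟩ := Submodule.mem_sup.1 hv
  change (biderivation _ _ _).app h (C.decomp.app x) ∈ _
  rw [← hvz, map_add, map_add]
  refine add_mem (add_mem (Cooperad.biderivation_mem_compSpan hy h) ?_) ?_
  · refine Cooperad.compSpan_le (fun i e hh hp hq y z hy hz => ?_)
      (Cooperad.biderivation_mem_compSpan hw h)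
    rw [C.twist_unitPart hp hy, map_zero]
    exact zero_mem _
  · refine Cooperad.compSpan_le (fun i e hh hp hq y z hy hz => ?_)
      (Cooperad.biderivation_mem_compSpan hz h)
    rw [C.twist_unitPart hq hz, map_zero]
    exact zero_mem _

end CoaugCooperad

/-! ### Equivariant maps and acyclic fibrations -/

namespace SMod

section Average
variable {V W : SMod K} {k : ℤ}

/-- The average of a family of linear maps over the symmetric groups. Only the members of the family
that lower the degree by `k` play a role. -/
def average (s : ∀ (n : ℕ) (i j : ℤ), V n i →ₗ[K] W n j) : DegHom k V W where
  app {n i j} _ := (n.factorial : K)⁻¹ •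
    ∑ σ : Equiv.Perm (Fin n), W.map σ ∘ₗ s n i j ∘ₗ V.map σ.symm
  naturality {m n i j} h τ x := by
    obtain rfl := eq_of_equiv τ
    simp only [LinearMap.smul_apply, LinearMap.sum_apply, LinearMap.comp_apply, map_smul, map_sum]
    congr 1
    refine (Fintype.sum_equiv (Equiv.mulLeft (τ : Equiv.Perm (Fin m))) _ _ fun σ => ?_).symm
    rw [← W.map_trans, ← V.map_trans]
    have hσ : τ.trans (Equiv.mulLeft (τ : Equiv.Perm (Fin m)) σ).symm = σ.symm := by
      ext1 a
      simp [Equiv.Perm.mul_def]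
    rw [hσ]
    rfl

/-- A linear condition that holds for all the conjugates of a map holds for their average. -/
theorem average_apply [CharZero K] (s : ∀ (n : ℕ) (i j : ℤ), V n i →ₗ[K] W n j) {n : ℕ} {i j : ℤ}
    (h : i = j + k) {M : Type*} [AddCommGroup M] [Module K M] (T : W n j →ₗ[K] M) (x : V n i)
    (y : M)
    (H : ∀ σ : Equiv.Perm (Fin n), T (W.map σ (s n i j (V.map σ.symm x))) = y) :
    T ((average s : DegHom k V W).app h x) = y := by
  change T ((n.factorial : K)⁻¹ • (∑ σ : Equiv.Perm (Fin n),
    W.map σ ∘ₗ s n i j ∘ₗ V.map σ.symm) x) = y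
  simp only [LinearMap.sum_apply, LinearMap.comp_apply, map_smul, map_sum, H, Finset.sum_const,
    Finset.card_univ, Fintype.card_perm, Fintype.card_fin]
  rw [← Nat.cast_smul_eq_nsmul K, smul_smul,
    inv_mul_cancel₀ (Nat.cast_ne_zero.2 n.factorial_ne_zero), one_smul]

theorem map_map_symm (V : SMod K) {m n : ℕ} {i : ℤ} (σ : Fin m ≃ Fin n) (x : V n i) :
    V.map σ (V.map σ.symm x) = x := by
  rw [← V.map_trans, Equiv.symm_trans_self, V.map_refl]

end Average

variable [CharZero K] {V W : SMod K}

theorem Hom.exists_section (p : Hom V W)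
    (hp : ∀ n i, Function.Surjective (p.app (n := n) (i := i))) :
    ∃ s : Hom W V, ∀ {n : ℕ} {i : ℤ} (y : W n i), p.app (s.app y) = y := by
  have h1 : ∀ n i j, ∃ s : W n i →ₗ[K] V n j, ∀ h : i = j, ∀ y, p.app (s y) = W.cast h y :=
    fun n i j => by
      by_cases h : i = j
      · subst h
        obtain ⟨s, hs⟩ := p.app.exists_rightInverse_of_surjective
          (LinearMap.range_eq_top.2 (hp n i))
        exact ⟨s, fun _ y => LinearMap.congr_fun hs y⟩
      · exact ⟨0, fun h' => absurd h' h⟩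
  choose s hs using h1
  let t : DegHom 0 W V := average s
  refine ⟨⟨t.app (add_zero _).symm, t.naturality _⟩, fun {n i} y => ?_⟩
  refine average_apply s (add_zero i).symm p.app y y fun σ => ?_
  rw [p.naturality, hs n i i rfl]
  exact W.map_map_symm σ y

theorem Hom.exists_retraction (f : Hom V W)
    (hf : ∀ n i, Function.Injective (f.app (n := n) (i := i))) :
    ∃ r : Hom W V, ∀ {n : ℕ} {i : ℤ} (x : V n i), r.app (f.app x) = x := by
  have h1 : ∀ n i j, ∃ s : W n i →ₗ[K] V n j, ∀ h : i = j, ∀ x, s (f.app x) = V.cast h x :=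
    fun n i j => by
      by_cases h : i = j
      · subst h
        obtain ⟨s, hs⟩ := f.app.exists_leftInverse_of_injective (LinearMap.ker_eq_bot.2 (hf n i))
        exact ⟨s, fun _ y => LinearMap.congr_fun hs y⟩
      · exact ⟨0, fun h' => absurd h' h⟩
  choose s hs using h1
  let t : DegHom 0 W V := average s
  refine ⟨⟨t.app (add_zero _).symm, t.naturality _⟩, fun {n i} x => ?_⟩
  refine average_apply s (add_zero i).symm LinearMap.id (f.app x) x fun σ => ?_
  rw [← f.naturality, hs n i i rfl]
  exact V.map_map_symm σ x

end SMod

namespace DGOperad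
variable {E F : DGOperad K} {p : Hom E F}

/-- The kernel of an acyclic fibration is acyclic. -/
theorem Hom.exists_d_eq_of_acyclic (hp : p.IsFibration) (hp' : p.IsWeakEquivalence) {n : ℕ} {i : ℤ}
    (z : E n (i + 1)) (hz : p.app z = 0) (hd : E.d.app rfl z = 0) :
    ∃ w : E n (i + 1 + 1), p.app w = 0 ∧ E.d.app rfl w = z := by
  have hc : ∀ {j : ℤ} (h : i + 1 = j + 1), E.d.app h z = 0 := fun {j} h => by
    obtain rfl : j = i := by omega
    exact hd
  -- The class of `z` is trivial in the homology of `F`, so that `z` is a boundary in `E`.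
  have h1 : (Submodule.Quotient.mk ⟨z, hc _⟩ : E.Homology n (i + 1)) = 0 :=
    (hp' n (i + 1)).1 (by
      rw [map_zero]
      refine (Submodule.Quotient.mk_eq_zero _).2 ⟨0, ?_⟩
      rw [map_zero]
      exact hz.symm)
  have h1' := (Submodule.Quotient.mk_eq_zero _).1 h1
  obtain ⟨e, he⟩ : z ∈ E.boundaries n (i + 1) := h1'
  -- The image of `e` is a cycle, homologous to the image of a cycle `c` of `E`.
  have h2 : ∀ {j : ℤ} (h : i + 1 + 1 = j + 1), F.d.app h (p.app e) = 0 := fun {j} h => by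
    obtain rfl : j = i + 1 := by omega
    rw [← p.map_d, he, hz]
  obtain ⟨c, hc⟩ := (hp' n (i + 1 + 1)).2 (Submodule.Quotient.mk ⟨p.app e, h2 _⟩)
  obtain ⟨⟨c, hcc⟩, rfl⟩ := Submodule.Quotient.mk_surjective _ c
  obtain ⟨g, hg⟩ := (Submodule.Quotient.eq _).1 hc
  obtain ⟨g, rfl⟩ := hp n _ g
  have hg' : F.d.app rfl (p.app g) = p.app c - p.app e := hg
  have hcc' : E.d.app rfl c = 0 := by
    have : ∀ {j : ℤ} (h : i + 1 + 1 = j + 1) (_ : j = i + 1), E.d.app h c = 0 → E.d.app rfl c = 0 :=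
      fun {j} h h' => by subst h'; exact id
    exact this _ (by omega) hcc
  refine ⟨e - c + E.d.app rfl g, ?_, ?_⟩
  · rw [map_add, map_sub, p.map_d, hg']
    abel
  · rw [map_add, map_sub, E.d_d, hcc', sub_zero, add_zero]
    exact he

/-- The kernel of an acyclic fibration has an equivariant contracting homotopy. -/
theorem Hom.exists_homotopy [CharZero K] (hp : p.IsFibration) (hp' : p.IsWeakEquivalence) :
    ∃ h : SMod.DegHom (-1) E.toSMod E.toSMod, ∀ {n : ℕ} {i j k : ℤ} (h₁ : i = j + -1)
      (h₂ : j = i + 1) (h₃ : i = k + 1) (h₄ : k = i + -1) (z : E n i), p.app z = 0 →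
        p.app (h.app h₁ z) = 0 ∧
        E.d.app h₂ (h.app h₁ z) + h.app h₄ (E.d.app h₃ z) = z := by
  have h1 : ∀ n i j, ∃ s : E n i →ₗ[K] E n j, ∀ (k : ℤ) (h : j = i + 1) (h' : i = k + 1)
      (z : E n i), p.app z = 0 → E.d.app h' z = 0 → p.app (s z) = 0 ∧ E.d.app h (s z) = z :=
      fun n i j => by
    by_cases h : j = i + 1
    · subst h
      obtain ⟨i, rfl⟩ : ∃ i', i = i' + 1 := ⟨i - 1, by omega⟩
      let Z := LinearMap.ker (p.app (n := n) (i := i + 1)) ⊓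
        LinearMap.ker (E.d.app (n := n) (rfl : i + 1 = i + 1))
      let Y := (LinearMap.ker (p.app (n := n) (i := i + 1 + 1))) ⊓
        Z.comap (E.d.app (n := n) rfl)
      let d : Y →ₗ[K] Z := (E.d.app rfl).restrict fun x hx => hx.2
      have hd : Function.Surjective d := by
        rintro ⟨z, hz, hz'⟩
        obtain ⟨w, hw, hw'⟩ := exists_d_eq_of_acyclic hp hp' z hz hz'
        exact ⟨⟨w, hw, by
          change E.d.app rfl w ∈ Z
          rw [hw']; exact ⟨hz, hz'⟩⟩, Subtype.ext hw'⟩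
      obtain ⟨t, ht⟩ := d.exists_rightInverse_of_surjective (LinearMap.range_eq_top.2 hd)
      obtain ⟨s, hs⟩ := LinearMap.exists_extend (Y.subtype ∘ₗ t)
      refine ⟨s, fun k _ h' z hz hz' => ?_⟩
      obtain rfl : k = i := by omega
      have e1 : s z = (t ⟨z, hz, hz'⟩).1 := LinearMap.congr_fun hs ⟨z, hz, hz'⟩
      rw [e1]
      exact ⟨(t ⟨z, hz, hz'⟩).2.1, congrArg Subtype.val (LinearMap.congr_fun ht ⟨z, hz, hz'⟩)⟩
    · exact ⟨0, fun k h' => absurd h' h⟩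
  choose s hs using h1
  let t : SMod.DegHom (-1) E.toSMod E.toSMod := SMod.average s
  have ht : ∀ {n : ℕ} {i j k : ℤ} (h₁ : i = j + -1) (h₂ : j = i + 1) (h₃ : i = k + 1) (z : E n i),
      p.app z = 0 → E.d.app h₃ z = 0 → p.app (t.app h₁ z) = 0 ∧ E.d.app h₂ (t.app h₁ z) = z := by
    intro n i j k h₁ h₂ h₃ z hz hz'
    have hσ : ∀ σ : Equiv.Perm (Fin n), _ := fun σ => hs n i j k h₂ h₃ (E.map σ.symm z)
      (by rw [p.naturality, hz, map_zero]) (by rw [E.d.naturality, hz', map_zero])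
    constructor
    · refine SMod.average_apply s _ p.app z 0 fun σ => ?_
      rw [p.naturality, (hσ σ).1, map_zero]
    · refine SMod.average_apply s _ (E.d.app h₂) z z fun σ => ?_
      rw [E.d.naturality, (hσ σ).2]
      exact E.map_map_symm σ z
  -- The map `t` sends a cycle to a primitive; `h z = t (z - t (d z))` is a homotopy.
  let h : SMod.DegHom (-1) E.toSMod E.toSMod :=
    { app := fun {n i j} h => t.app h ∘ₗ
        (LinearMap.id - t.app (by omega) ∘ₗ E.d.app (by omega : i = i - 1 + 1))
      naturality := fun h σ x => by
        simp only [LinearMap.comp_apply, LinearMap.sub_apply, LinearMap.id_apply,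
          SMod.DegHom.naturality, map_sub] }
  refine ⟨h, fun {n i j k} h₁ h₂ h₃ h₄ z hz => ?_⟩
  obtain rfl : k = i - 1 := by omega
  have hdz : p.app (E.d.app h₃ z) = 0 := by rw [p.map_d, hz, map_zero]
  have h5 := ht h₄ h₃ (by omega : i - 1 = i - 1 - 1 + 1) _ hdz (E.d_d _ _ z)
  have h6 := ht h₁ h₂ h₃ (z - t.app h₄ (E.d.app h₃ z)) (by rw [map_sub, hz, h5.1, sub_zero])
    (by rw [map_sub, h5.2, sub_self])
  refine ⟨h6.1, ?_⟩
  have h7 : h.app h₄ (E.d.app h₃ z) = t.app h₄ (E.d.app h₃ z) := by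
    change t.app h₄ (E.d.app h₃ z - t.app (by omega : i - 1 - 1 = i - 1 + -1)
      (E.d.app (by omega) (E.d.app h₃ z))) = _
    rw [E.d_d, map_zero, sub_zero]
  rw [h7]
  exact (congrArg (· + _) h6.2).trans (sub_add_cancel _ _)

end DGOperad

/-! ### Lifting along acyclic fibrations -/

namespace CurvedCooperad
variable {D : CurvedCooperad K} {E : DGOperad K}

/-- The obstruction `d L - L d` for a morphism `L` of graded operads, given by `φ` on generators, to
commute with the differentials. -/
def obstruction (φ : SMod.Hom D.desusp E.toSMod) :
    SMod.DegHom 1 (free D.desusp).toSMod E.toSMod where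
  app h := E.d.app h ∘ₗ (lift φ).app - (lift φ).app ∘ₗ D.cobarDiff.app h
  naturality h σ x := by
    simp only [LinearMap.sub_apply, LinearMap.comp_apply, SMod.DegHom.naturality,
      (lift φ).naturality, map_sub]

variable (φ : SMod.Hom D.desusp E.toSMod)

theorem obstruction_app {n : ℕ} {i j : ℤ} (h : i = j + 1) (x : free D.desusp n i) :
    (obstruction φ).app h x = E.d.app h ((lift φ).app x) - (lift φ).app (D.cobarDiff.app h x) := rfl

theorem obstruction_comp {m b n : ℕ} {p q r p' q' r' : ℤ} (i : Fin m) (e : Slot m b n i)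
    (h : p + q = r) (hp : p = p' + 1) (hq : q = q' + 1) (hr : r = r' + 1)
    (x : free D.desusp m p) (y : free D.desusp b q) :
    (obstruction φ).app hr ((free D.desusp).comp i e h x y) =
      E.comp i e (by omega) ((obstruction φ).app hp x) ((lift φ).app y) +
      (-1 : K) ^ p • E.comp i e (by omega) ((lift φ).app x) ((obstruction φ).app hq y) := by
  simp only [obstruction_app]
  rw [(lift φ).map_comp, E.leibniz i e h hp hq hr, D.cobarDiff_comp i e h hp hq hr, map_add,
    map_smul, (lift φ).map_comp, (lift φ).map_comp]
  simp only [map_sub, LinearMap.sub_apply, smul_sub]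
  abel

theorem obstruction_oneAt {n : ℕ} {i j : ℤ} (h : i = j + 1) :
    (obstruction φ).app h ((free D.desusp).oneAt n i) = 0 := by
  rw [obstruction_app, (lift φ).map_oneAt, E.d_oneAt, CurvedCooperad.cobarDiff,
    derivation_oneAt, map_zero, sub_zero]

/-- The Bianchi identity. -/
theorem d_obstruction {n : ℕ} {i j k : ℤ} (h : i = j + 1) (h' : j = k + 1)
    (x : free D.desusp n i) : E.d.app h' ((obstruction φ).app h x) =
      -(obstruction φ).app h' (D.cobarDiff.app h x) := by
  rw [obstruction_app, obstruction_app, map_sub, E.d_d,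
    show D.cobarDiff.app h' (D.cobarDiff.app h x) = 0 from (cobar D).d_d h h' x, map_zero]
  abel

/-- The obstruction of `φ` vanishes on the desuspension of the part `F r` of the coradical
filtration. -/
def SolvedUpTo (r : ℕ) : Prop := ∀ {n : ℕ} {i j k : ℤ} (h : i = j + 1) (h' : j = k + 1) (x : D n i),
  x ∈ D.corad r n i → (obstruction φ).app h' (D.twist.app h x) = 0

theorem solvedUpTo_zero : SolvedUpTo φ 0 := fun h h' x hx => by
  rw [D.twist_unitPart h hx, map_zero]

variable {φ}

/-- When the obstruction vanishes on `F r`, it vanishes on the quadratic part of the differential of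
`F (r + 1)`. -/
theorem SolvedUpTo.obstruction_infConv {r : ℕ} (hr : SolvedUpTo φ r) {n : ℕ} {i j k : ℤ}
    (h : i = j + (1 + 1)) (h' : j = k + 1) {x : D n i} (hx : x ∈ D.corad (r + 1) n i) :
    (obstruction φ).app h' ((D.infConv D.twist D.twist).app h x) = 0 := by
  refine Cooperad.compSpan_le (N := LinearMap.ker ((obstruction φ).app h')) ?_
    (D.infConv_twist_mem h hx)
  intro m b p q p' q' i e hh hp hq y z hy hz
  rw [LinearMap.mem_ker, obstruction_comp φ i e hh (p' := p' - 1) (q' := q' - 1) (by omega)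
    (by omega) h', hr hp _ y hy, hr hq _ z hz]
  simp

theorem SolvedUpTo.d_obstruction_twist {r : ℕ} (hr : SolvedUpTo φ r) {n : ℕ} {i j k s : ℤ}
    (h : i = j + 1) (h' : j = k + 1) (h'' : k = s + 1) {x : D n i} (hx : x ∈ D.corad (r + 1) n i) :
    E.d.app h'' ((obstruction φ).app h' (D.twist.app h x)) =
      (obstruction φ).app h'' (D.twist.app h' (D.d.app h x)) := by
  rw [d_obstruction, D.cobarDiff_twist, D.cobarFun_app _ h, map_sub, map_sub,
    hr.obstruction_infConv _ _ hx, scalar_app, map_smul, obstruction_oneAt]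
  simp

/-- The correction of `φ` by a homotopy applied to its obstruction. -/
def correct (η : SMod.DegHom (-1) E.toSMod E.toSMod) (φ : SMod.Hom D.desusp E.toSMod) :
    SMod.Hom D.desusp E.toSMod where
  app {n i} := φ.app - η.app (by omega : i - 1 = i + -1) ∘ₗ
    (obstruction φ).app (by omega : i = i - 1 + 1) ∘ₗ (gen D.desusp).app
  naturality σ x := by
    simp only [LinearMap.sub_apply, LinearMap.comp_apply, φ.naturality, (gen _).naturality,
      SMod.DegHom.naturality, map_sub]

theorem correct_app (η : SMod.DegHom (-1) E.toSMod E.toSMod) {n : ℕ} {i j : ℤ} (h : i = j + 1)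
    (h' : j = i + -1) (x : D.desusp n i) : (correct η φ).app x =
      φ.app x - η.app h' ((obstruction φ).app h ((gen D.desusp).app x)) := by
  obtain rfl : j = i - 1 := by omega
  rfl

theorem lift_correct_twist (η : SMod.DegHom (-1) E.toSMod E.toSMod) {n : ℕ} {i j k : ℤ}
    (h : i = j + 1) (h' : j = k + 1) (h'' : k = j + -1) (x : D n i) :
    (lift (correct η φ)).app (D.twist.app h x) = (lift φ).app (D.twist.app h x) -
      η.app h'' ((obstruction φ).app h' (D.twist.app h x)) :=
  correct_app η h' h'' _

theorem SolvedUpTo.lift_correct_infConv {r : ℕ} (hr : SolvedUpTo φ r)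
    (η : SMod.DegHom (-1) E.toSMod E.toSMod) {n : ℕ} {i j : ℤ}
    (h : i = j + (1 + 1)) {x : D n i} (hx : x ∈ D.corad (r + 1) n i) :
    (lift (correct η φ)).app ((D.infConv D.twist D.twist).app h x) =
      (lift φ).app ((D.infConv D.twist D.twist).app h x) := by
  refine Cooperad.compSpan_le (N := LinearMap.eqLocus (lift (correct η φ)).app (lift φ).app) ?_
    (D.infConv_twist_mem h hx)
  intro m b p q p' q' i e hh hp hq y z hy hz
  rw [LinearMap.mem_eqLocus, (lift φ).map_comp, (lift (correct η φ)).map_comp,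
    lift_correct_twist η hp (k := p' - 1) (by omega) (by omega),
    lift_correct_twist η hq (k := q' - 1) (by omega) (by omega), hr hp _ y hy, hr hq _ z hz]
  simp

/-- The correction by a contracting homotopy `η` of the kernel of `p` kills the obstruction on the
next step of the coradical filtration: there, the new obstruction is `o - d η o - η d o = 0`. -/
theorem SolvedUpTo.succ {r : ℕ} (hr : SolvedUpTo φ r) {η : SMod.DegHom (-1) E.toSMod E.toSMod}
    (hη : ∀ {n : ℕ} {i j k : ℤ} (h₁ : i = j + -1) (h₂ : j = i + 1) (h₃ : i = k + 1)
      (h₄ : k = i + -1) (x : D.desusp n j),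
        E.d.app h₂ (η.app h₁ ((obstruction φ).app h₂ ((gen _).app x))) +
          η.app h₄ (E.d.app h₃ ((obstruction φ).app h₂ ((gen _).app x))) =
        (obstruction φ).app h₂ ((gen _).app x)) :
    SolvedUpTo (correct η φ) (r + 1) := fun {n i j k} h h' x hx => by
  have h1 := hη (by omega) h' (by omega : k = k - 1 + 1) (by omega) (D.sInv.app h x)
  change E.d.app h' (η.app _ ((obstruction φ).app h' (D.twist.app h x))) +
    η.app _ (E.d.app _ ((obstruction φ).app h' (D.twist.app h x))) =
      (obstruction φ).app h' (D.twist.app h x) at h1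
  rw [hr.d_obstruction_twist h h' _ hx] at h1
  rw [obstruction_app, D.cobarDiff_twist, D.cobarFun_app _ h, map_sub, map_sub,
    hr.lift_correct_infConv η _ hx, lift_correct_twist η h h' (by omega),
    lift_correct_twist η h' (k := k - 1) (by omega) (by omega), map_sub,
    eq_sub_of_add_eq h1, obstruction_app φ h', D.cobarDiff_twist, D.cobarFun_app _ h, map_sub,
    map_sub, scalar_app, map_smul, map_smul, (lift φ).map_oneAt, (lift (correct η φ)).map_oneAt]
  abel

end CurvedCooperad

/-! ### Limits of sequences of corrections -/

theorem SMod.Hom.exists_limit {V W : SMod K} (Φ : ℕ → Hom V W)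
    (hΦ : ∀ {n : ℕ} {i : ℤ} (x : V n i), ∃ y, ∀ᶠ r in Filter.atTop, (Φ r).app x = y) :
    ∃ φ : Hom V W, ∀ {n : ℕ} {i : ℤ} (x : V n i),
      ∀ᶠ r in Filter.atTop, (Φ r).app x = φ.app x := by
  choose φ hφ using @hΦ
  refine ⟨⟨fun {n i} => ⟨⟨φ, fun x y => ?_⟩, fun c x => ?_⟩, fun σ x => ?_⟩, hφ⟩
  · obtain ⟨r, h₁, h₂, h₃⟩ := ((hφ x).and ((hφ y).and (hφ (x + y)))).exists
    rw [← h₁, ← h₂, ← h₃, map_add]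
  · obtain ⟨r, h₁, h₂⟩ := ((hφ x).and (hφ (c • x))).exists
    refine h₂.symm.trans (((Φ r).app.map_smul c x).trans ?_)
    exact congrArg (c • ·) h₁
  · obtain ⟨r, h₁, h₂⟩ := ((hφ x).and (hφ (V.map σ x))).exists
    refine h₂.symm.trans (((Φ r).naturality σ x).trans ?_)
    exact congrArg (W.map σ) h₁

theorem Free.eventually_lift_eq {V : SMod K} {P : Operad K} {Φ : ℕ → SMod.Hom V P.toSMod}
    {φ : SMod.Hom V P.toSMod} (hφ : ∀ {n : ℕ} {i : ℤ} (x : V n i),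
      ∀ᶠ r in Filter.atTop, (Φ r).app x = φ.app x) {n : ℕ} {i : ℤ} (t : free V n i) :
    ∀ᶠ r in Filter.atTop, (lift (Φ r)).app t = (lift φ).app t := by
  induction t using Free.induction with
  | hgen x => exact hφ x
  | hone => exact .of_forall fun r => ((lift _).map_one).trans (lift _).map_one.symm
  | hmap σ x ih =>
    filter_upwards [ih] with r h
    rw [(lift _).naturality, (lift _).naturality, h]
  | hcomp i e hh x y ih ih' =>
    filter_upwards [ih, ih'] with r h h'
    rw [(lift _).map_comp, (lift _).map_comp, h, h']
  | hzero => exact .of_forall fun r => by rw [map_zero, map_zero]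
  | hadd x y ih ih' =>
    filter_upwards [ih, ih'] with r h h'
    rw [map_add, map_add, h, h']
  | hsmul c x ih =>
    filter_upwards [ih] with r h
    rw [map_smul, map_smul, h]

namespace CurvedCooperad

/-- A morphism of graded operads out of the cobar construction commutes with the differentials when
its obstruction vanishes on generators. -/
theorem obstruction_eq_zero {D : CurvedCooperad K} {E : DGOperad K}
    {φ : SMod.Hom D.desusp E.toSMod}
    (hφ : ∀ {n : ℕ} {i j : ℤ} (h : i = j + 1) (x : D.desusp n i),
      (obstruction φ).app h ((gen _).app x) = 0)
    {n : ℕ} {i j : ℤ} (h : i = j + 1) (t : free D.desusp n i) :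
    (obstruction φ).app h t = 0 := by
  induction t using Free.induction generalizing j with
  | hgen x => exact hφ h x
  | hone => rw [← oneAt_one, obstruction_oneAt]
  | hmap σ x ih => rw [(obstruction φ).naturality, ih, map_zero]
  | @hcomp _ _ _ p q r i e hh x y ih ih' =>
    rw [obstruction_comp φ i e hh (p' := p - 1) (q' := q - 1) (by omega) (by omega) h, ih, ih']
    simp
  | hzero => rw [map_zero]
  | hadd x y ih ih' => rw [map_add, ih, ih', add_zero]
  | hsmul c x ih => rw [map_smul, ih, smul_zero]

section Square
variable {C D : CurvedCooperad K} (f : C.Hom D) {E F : DGOperad K} (p : DGOperad.Hom E F)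
  (a : DGOperad.Hom (cobar C) E) (b : DGOperad.Hom (cobar D) F)

/-- The morphism of graded operads given by `φ` on generators is a diagonal filler of the square
with sides `Ω f`, `p`, `a` and `b`; it need not commute with the differentials. -/
structure IsFiller (φ : SMod.Hom D.desusp E.toSMod) : Prop where
  left : ∀ {n : ℕ} {i : ℤ} (x : C.desusp n i), φ.app (f.desusp.app x) = a.app ((gen _).app x)
  right : ∀ {n : ℕ} {i : ℤ} (x : D.desusp n i), p.app (φ.app x) = b.app ((gen _).app x)

variable {f p a b} {φ : SMod.Hom D.desusp E.toSMod}

theorem IsFiller.lift_left (hφ : IsFiller f p a b φ) {n : ℕ} {i : ℤ} (t : free C.desusp n i) :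
    (lift φ).app (f.cobarOperadHom.app t) = a.app t :=
  hom_ext (f := f.cobarOperadHom.trans (lift φ)) (g := a.toOperadHom) hφ.left t

theorem IsFiller.lift_right (hφ : IsFiller f p a b φ) {n : ℕ} {i : ℤ} (t : free D.desusp n i) :
    p.app ((lift φ).app t) = b.app t :=
  hom_ext (f := (lift φ).trans p.toOperadHom) (g := b.toOperadHom) hφ.right t

theorem IsFiller.obstruction_left (hφ : IsFiller f p a b φ) {n : ℕ} {i j : ℤ} (h : i = j + 1)
    (t : free C.desusp n i) : (obstruction φ).app h (f.cobarOperadHom.app t) = 0 := by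
  rw [obstruction_app, ← f.cobar_diff, hφ.lift_left, hφ.lift_left, sub_eq_zero]
  exact (a.map_d h t).symm

theorem IsFiller.obstruction_right (hφ : IsFiller f p a b φ) {n : ℕ} {i j : ℤ} (h : i = j + 1)
    (t : free D.desusp n i) : p.app ((obstruction φ).app h t) = 0 := by
  rw [obstruction_app, map_sub, p.map_d, hφ.lift_right, hφ.lift_right, sub_eq_zero]
  exact (b.map_d h t).symm

theorem IsFiller.correct (hφ : IsFiller f p a b φ) {η : SMod.DegHom (-1) E.toSMod E.toSMod}
    (hη : ∀ {n : ℕ} {i j : ℤ} (h : i = j + -1) (z : E n i), p.app z = 0 → p.app (η.app h z) = 0) :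
    IsFiller f p a b (correct η φ) where
  left {n i} x := by
    rw [correct_app η (by omega : i = i - 1 + 1) (by omega)]
    have h1 := hφ.obstruction_left (by omega : i = i - 1 + 1) ((gen _).app x)
    rw [show f.cobarOperadHom.app ((gen _).app x) = (gen _).app (f.desusp.app x) from rfl] at h1
    rw [h1, map_zero, sub_zero, hφ.left]
  right {n i} x := by
    rw [correct_app η (by omega : i = i - 1 + 1) (by omega), map_sub,
      hη _ _ (hφ.obstruction_right _ _), sub_zero, hφ.right]

theorem exists_isFiller [CharZero K] (hab : a.trans p = f.cobarMap.trans b) (hp : p.IsFibration)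
    (hf : ∀ n i, Function.Injective (f.desusp.app (n := n) (i := i))) :
    ∃ φ, IsFiller f p a b φ := by
  obtain ⟨r, hr⟩ := f.desusp.exists_retraction hf
  obtain ⟨s, hs⟩ := p.toHom.exists_section hp
  have hab' : ∀ {n : ℕ} {i : ℤ} (x : C.desusp n i),
      p.app (a.app ((gen _).app x)) = b.app ((gen _).app (f.desusp.app x)) := fun x =>
    congrArg (fun φ : DGOperad.Hom (cobar C) F => φ.app ((gen C.desusp).app x)) hab
  let α : SMod.Hom D.desusp E.toSMod := (r.trans (gen _)).trans a.toHom
  let β : SMod.Hom D.desusp F.toSMod := (gen _).trans b.toHom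
  refine ⟨⟨α.app + s.app ∘ₗ (β.app - p.app ∘ₗ α.app), fun σ x => ?_⟩, fun x => ?_, fun x => ?_⟩
  · simp only [LinearMap.add_apply, LinearMap.comp_apply, LinearMap.sub_apply, α.naturality,
      β.naturality, p.naturality, ← map_sub, s.naturality, ← map_add]
  · change a.app ((gen _).app (r.app (f.desusp.app x))) +
      s.app (b.app ((gen _).app (f.desusp.app x)) -
        p.app (a.app ((gen _).app (r.app (f.desusp.app x))))) = _
    rw [hr, hab', sub_self, map_zero, add_zero]
  · change p.app (α.app x + s.app (β.app x - p.app (α.app x))) = β.app x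
    rw [map_add, hs, add_sub_cancel]

end Square

end CurvedCooperad

open CurvedCooperad in
/-- The cobar construction of an injection `f` lifts against acyclic fibrations: a filler of graded
operads exists, its obstruction takes values in the contractible kernel of the fibration, and it is
corrected step by step along the coradical filtration. -/
theorem CurvedConilpotentCooperad.isCofibration_of_injective [CharZero K]
    {C D : CurvedConilpotentCooperad K} (f : Hom C D)
    (hf : ∀ n i, Function.Injective (f.app (n := n) (i := i))) : IsCofibration f := by
  intro E F p hp hp' a b hab
  obtain ⟨η, hη⟩ := DGOperad.Hom.exists_homotopy hp hp'
  obtain ⟨φ₀, hφ₀⟩ := exists_isFiller hab hp fun n i x y hxy =>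
    Subtype.ext (hf n (i + 1) (congrArg Subtype.val hxy))
  let Φ : ℕ → SMod.Hom D.desusp E.toSMod := fun r => (correct η)^[r] φ₀
  have hΦ : ∀ r, Φ (r + 1) = correct η (Φ r) := fun r => Function.iterate_succ_apply' _ _ _
  have hfill : ∀ r, IsFiller f p a b (Φ r) := fun r => by
    induction r with
    | zero => exact hφ₀
    | succ r ih =>
      rw [hΦ]
      exact ih.correct fun {n i j} h z hz => (hη h (by omega) (by omega : i = i - 1 + 1)
        (by omega) z hz).1
  have hsol : ∀ r, SolvedUpTo (Φ r) r := fun r => by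
    induction r with
    | zero => exact solvedUpTo_zero _
    | succ r ih =>
      rw [hΦ]
      exact ih.succ fun h₁ h₂ h₃ h₄ x => (hη h₁ h₂ h₃ h₄ _ ((hfill r).obstruction_right _ _)).2
  have hgen : ∀ {n : ℕ} {i j : ℤ} (h : i = j + 1) (x : D.desusp n i),
      ∀ᶠ r in Filter.atTop, (obstruction (Φ r)).app h ((gen _).app x) = 0 := fun {n i j} h x => by
    obtain ⟨N, hN⟩ := D.conilpotent x.1
    filter_upwards [Filter.eventually_ge_atTop N] with r hr
    have := hsol r rfl h x.1 (D.corad_mono n _ hr hN)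
    rwa [D.twist_coe] at this
  obtain ⟨φ, hφ⟩ := SMod.Hom.exists_limit Φ fun {n i} x => by
    obtain ⟨N, hN⟩ := Filter.eventually_atTop.1 (hgen (by omega : i = i - 1 + 1) x)
    refine ⟨(Φ N).app x, Filter.eventually_atTop.2 ⟨N, fun r hr => ?_⟩⟩
    induction r, hr using Nat.le_induction with
    | base => rfl
    | succ r hr ih =>
      rw [hΦ, correct_app η (by omega : i = i - 1 + 1) (by omega), hN r hr, map_zero, sub_zero, ih]
  have hφfill : IsFiller f p a b φ :=
    { left := fun x => by
        obtain ⟨r, hr⟩ := (hφ (f.desusp.app x)).exists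
        rw [← hr, (hfill r).left]
      right := fun x => by
        obtain ⟨r, hr⟩ := (hφ x).exists
        rw [← hr, (hfill r).right] }
  have hobs : ∀ {n : ℕ} {i j : ℤ} (h : i = j + 1) (t : free D.desusp n i),
      (obstruction φ).app h t = 0 := obstruction_eq_zero fun h x => by
    obtain ⟨r, h₁, h₂, h₃⟩ := ((hgen h x).and ((eventually_lift_eq hφ ((gen _).app x)).and
      (eventually_lift_eq hφ (D.cobarDiff.app h ((gen _).app x))))).exists
    rwa [obstruction_app, h₂, h₃] at h₁
  exact ⟨⟨lift φ, fun h t => (sub_eq_zero.1 (hobs h t)).symm⟩,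
    DGOperad.Hom.ext_app fun t => hφfill.lift_left t,
    DGOperad.Hom.ext_app fun t => hφfill.lift_right t⟩

end OperadTheory

/-- The cofibrations of curved conilpotent cooperads over a field of characteristic zero are exactly
the degreewise injections. -/
theorem mainTheorem12 {K : Type u} [Field K] [CharZero K]
    {C D : OperadTheory.CurvedConilpotentCooperad K}
    (f : OperadTheory.CurvedConilpotentCooperad.Hom C D) :
    OperadTheory.CurvedConilpotentCooperad.IsCofibration f ↔
      ∀ (n : ℕ) (i : ℤ), Function.Injective (f.app (n := n) (i := i)) :=
  ⟨fun h => h.injective, OperadTheory.CurvedConilpotentCooperad.isCofibration_of_injective f⟩
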